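/- Let $\mathbb T^2=\mathbb R^2/\mathbb Z^2$, $\mathcal H:=L^2(\mathbb T^2)$ (real-valued), $P_t=e^{t\Delta}$, and for $\alpha\in\mathbb R$ let $\mathcal C^\alpha$ be the closure of the smooth functions in the Hölder–Besov space $B^\alpha_{\infty,\infty}(\mathbb T^2)$. Let $0<\kappa<\tfrac12$, $T>0$, $B:=\mathcal C^{-1-\kappa}$ and $\mathcal X_T:=C([0,T];\mathcal C^{1-\kappa})$. Let $g\in C^7_b(\mathbb R)$ with $g(0)=g'(0)=g''(0)=0$ and $u_0\in B^{1+2\kappa}_{\infty,\infty}(\mathbb T^2)$. For $h\in\mathcal H$ let $w_h\in\mathcal X_T$ be the mild solution of $$(\partial_t-\Delta)w_h=g(w_h)h,\qquad w_h(0)=u_0 .$$ Let $F:\mathcal X_T\to\mathbb R$ be continuous and bounded, and suppose that * $\mathscr F(h):=F(w_h)+\tfrac12\|h\|_{\mathcal H}^2$ attains its unique minimum over $\mathcal H$ at $\mathsf h$; * $F$ is three times Fréchet differentiable on an open neighbourhood $\mathcal N$ of $w_{\mathsf h}$, and there are constants $M_1,M_2,M_3$ with $|D^mF(v)[y,\dots,y]|\le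 M_m\|y\|_{\mathcal X_T}^m$ for $m=1,2,3$, $v\in\mathcal N$, $y\in\mathcal X_T$; * $D^2\mathscr F|_{\mathsf h}[k,k]>0$ for all $k\in\mathcal H\setminus\{0\}$. Write $v_{k}$ and $v_{k,\ell}$ for the first and second Fréchet derivatives at $\mathsf h$ of $h\mapsto w_h$ in the directions $k,\ell\in\mathcal H$. Let $v^{\mathrm{reg}}_{k,\ell},v^{\mathrm{sing}}_{k,\ell}\in\mathcal X_T$ be the solutions of $$v^{\mathrm{reg}}_{k,\ell}(t)=\int_0^tP_{t-s}\big[g'(w_{\mathsf h}(s))\,v^{\mathrm{reg}}_{k,\ell}(s)\,\mathsf h\big]ds+\int_0^tP_{t-s}\big[g''(w_{\mathsf h}(s))\,v_k(s)\,v_\ell(s)\,\mathsf h\big]ds,$$ $$v^{\mathrm{sing}}_{k,\ell}(t)=\int_0^tP_{t-s}\big[g'(w_{\mathsf h}(s))\,v^{\mathrm{sing}}_{k,\ell}(s)\,\mathsf h\big]ds+\int_0^tP_{t-s}\big[g'(w_{\mathsf h}(s))\,v_k(s)\,\ell+g'(w_{\mathsf h}(s))\,v_\ell(s)\,k\big]ds,$$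 and set $$A_{\mathsf h}[k,\ell]:=DF|_{w_{\mathsf h}}[v_{k,\ell}]+D^2F|_{w_{\mathsf h}}[v_k,v_\ell],\qquad \tilde A_{\mathsf h}[k,\ell]:=DF|_{w_{\mathsf h}}[v^{\mathrm{sing}}_{k,\ell}],\qquad q_{\mathsf h}:=A_{\mathsf h}-\tilde A_{\mathsf h}.$$ Then all these objects are well defined: for every $h\in\mathcal H$ there is exactly one mild solution $w_h\in\mathcal X_T$, the map $h\mapsto w_h$ is $C^2$ near $\mathsf h$ as a map $\mathcal H\to\mathcal X_T$, and the equations for $v^{\mathrm{reg}}_{k,\ell}$ and $v^{\mathrm{sing}}_{k,\ell}$ are uniquely solvable in $\mathcal X_T$ for all $k,\ell\in\mathcal H$. Moreover $$q_{\mathsf h}[k,\ell]=DF|_{w_{\mathsf h}}[v^{\mathrm{reg}}_{k,\ell}]+D^2F|_{w_{\mathsf h}}[v_k,v_\ell],\qquad k,\ell\in\mathcal H,$$ the bilinear form $q_{\mathsf h}$ is trace class on $\mathcal H$ (it is $\langle S\,\cdot,\cdot\rangle_{\mathcal H}$ with a trace-class operator $S$), and it extends uniquely to a continuous bilinear form $Q$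 on $B\times B$. The norm of $Q$ on $B\times B$ is the least constant $C\ge0$ such that $|q_{\mathsf h}[k,\ell]|\le C\|k\|_B\|\ell\|_B$ for all $k,\ell\in\mathcal H$. -/

import Mathlib

open Set Filter Topology MeasureTheory

noncomputable section

namespace GPAM

/-! ### The torus, real `L²`, Fourier coefficients -/

/-- The two-dimensional torus `T² = ℝ² / ℤ²`. -/
abbrev Torus : Type := UnitAddTorus (Fin 2)

/-- The uniform probability measure on the torus. -/
abbrev torusMeasure : Measure Torus := Measure.pi fun _ => AddCircle.haarAddCircle

/-- The Cameron-Martin space `L²(T²)` of real valued square integrable functions. -/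
abbrev CM : Type := Lp ℝ 2 torusMeasure

/-- Frequencies. -/
abbrev Freq : Type := Fin 2 → ℤ

/-- Families of Fourier coefficients. A periodic distribution is identified with the family of its
Fourier coefficients. -/
abbrev Coeffs : Type := Freq → ℂ

/-- Fourier coefficients `∫ f(x) e^{-2πi n·x} dx` of a real function on the torus. -/
def coeff (f : Torus → ℝ) : Coeffs := fun n => UnitAddTorus.mFourierCoeff (fun x => (f x : ℂ)) n

/-! ### Littlewood-Paley blocks and the spaces `C^α` -/

/-- The Euclidean length of a frequency. -/
def freqNorm (n : Freq) : ℝ := Real.sqrt ((n 0 : ℝ) ^ 2 + (n 1 : ℝ) ^ 2)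

/-- A smooth cut-off of frequencies: `1` for `|n| ≤ 2^j`, and `0` for `|n| ≥ 2^(j+1)`. -/
def lowPass (j : ℕ) (n : Freq) : ℝ := Real.smoothTransition (2 - freqNorm n / 2 ^ j)

/-- The smooth dyadic partition of unity on the frequencies: the `0`-th function is supported in
`|n| ≤ 2`, the `j`-th one for `j ≥ 1` in the annulus `2^(j-1) ≤ |n| ≤ 2^(j+1)`. -/
def dyadic : ℕ → Freq → ℝ
  | 0 => lowPass 0
  | j + 1 => fun n => lowPass (j + 1) n - lowPass j n

/-- A box of frequencies that contains the support of `dyadic j`. -/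
def freqBox (j : ℕ) : Finset Freq :=
  Fintype.piFinset fun _ => Finset.Icc (-(2 ^ (j + 1) : ℤ)) (2 ^ (j + 1))

/-- The Littlewood-Paley block `Δ_j c`, a trigonometric polynomial. -/
def block (j : ℕ) (c : Coeffs) : C(Torus, ℂ) where
  toFun x := ∑ n ∈ freqBox j, (dyadic j n : ℂ) * c n * UnitAddTorus.mFourier n x
  continuous_toFun := by fun_prop

lemma block_apply (j : ℕ) (c : Coeffs) (x : Torus) :
    block j c x = ∑ n ∈ freqBox j, (dyadic j n : ℂ) * c n * UnitAddTorus.mFourier n x := rfl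

/-- The weighted sup norm `2^(αj) ‖Δ_j c‖_∞` of the `j`-th block. -/
def blockNorm (α : ℝ) (j : ℕ) (c : Coeffs) : ℝ := (2 : ℝ) ^ (α * j) * ‖block j c‖

lemma block_add (j : ℕ) (c d : Coeffs) : block j (c + d) = block j c + block j d := by
  ext x
  simp [block_apply, mul_add, add_mul, Finset.sum_add_distrib]

lemma block_smul (j : ℕ) (r : ℝ) (c : Coeffs) : block j (r • c) = r • block j c := by
  ext x
  simp only [block_apply, ContinuousMap.smul_apply, Pi.smul_apply, Complex.real_smul,
    Finset.mul_sum]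
  exact Finset.sum_congr rfl fun n _ => by ring

lemma blockNorm_nonneg (α : ℝ) (j : ℕ) (c : Coeffs) : 0 ≤ blockNorm α j c := by
  unfold blockNorm; positivity

lemma blockNorm_zero (α : ℝ) (j : ℕ) : blockNorm α j 0 = 0 := by
  have : block j 0 = 0 := by ext x; simp [block_apply]
  simp [blockNorm, this]

lemma blockNorm_add_le (α : ℝ) (j : ℕ) (c d : Coeffs) :
    blockNorm α j (c + d) ≤ blockNorm α j c + blockNorm α j d := by
  unfold blockNorm
  rw [block_add, ← mul_add]
  gcongr
  exact norm_add_le _ _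

lemma blockNorm_smul (α : ℝ) (j : ℕ) (r : ℝ) (c : Coeffs) :
    blockNorm α j (r • c) = |r| * blockNorm α j c := by
  unfold blockNorm
  rw [block_smul, norm_smul, Real.norm_eq_abs]
  ring

/-- The real periodic distributions whose weighted blocks `2^(αj) ‖Δ_j c‖_∞` tend to zero, i.e. the
closure of the smooth functions in the Hölder-Besov space `B^α_{∞,∞}(T²)`. -/
def besovSubmodule (α : ℝ) : Submodule ℝ Coeffs where
  carrier := {c | (∀ n, c (-n) = starRingEnd ℂ (c n)) ∧
    Tendsto (fun j => blockNorm α j c) atTop (𝓝 0)}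
  zero_mem' := ⟨by simp, by simp [blockNorm_zero]⟩
  add_mem' := by
    rintro c d ⟨hc, hc'⟩ ⟨hd, hd'⟩
    refine ⟨fun n => by simp [hc, hd], ?_⟩
    refine squeeze_zero (fun j => blockNorm_nonneg _ _ _) (fun j => blockNorm_add_le _ _ _ _) ?_
    simpa using hc'.add hd'
  smul_mem' := by
    rintro r c ⟨hc, hc'⟩
    refine ⟨fun n => by simp [hc], ?_⟩
    simp only [blockNorm_smul]
    simpa using hc'.const_mul |r|

/-- The space `C^α = C^α(T²)`, for any `α : ℝ`: the closure of the smooth functions in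
`B^α_{∞,∞}(T²)`, as a space of real periodic distributions. -/
def Besov (α : ℝ) : Type := besovSubmodule α

namespace Besov

variable {α : ℝ}

instance : AddCommGroup (Besov α) := inferInstanceAs (AddCommGroup (besovSubmodule α))

instance : Module ℝ (Besov α) := inferInstanceAs (Module ℝ (besovSubmodule α))

/-- The Fourier coefficients of an element of `C^α`. -/
def toCoeffs : Besov α →ₗ[ℝ] Coeffs := (besovSubmodule α).subtype

/-- The norm `sup_j 2^(αj) ‖Δ_j c‖_∞`. -/
instance : Norm (Besov α) := ⟨fun c => ⨆ j, blockNorm α j (toCoeffs c)⟩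

lemma norm_def (c : Besov α) : ‖c‖ = ⨆ j, blockNorm α j (toCoeffs c) := rfl

lemma bddAbove (c : Besov α) : BddAbove (range fun j => blockNorm α j (toCoeffs c)) :=
  (show Tendsto (fun j => blockNorm α j (toCoeffs c)) atTop (𝓝 0) from c.2.2).bddAbove_range

lemma blockNorm_le (c : Besov α) (j : ℕ) : blockNorm α j (toCoeffs c) ≤ ‖c‖ :=
  le_ciSup (bddAbove c) j

end Besov

/-! The blocks determine the distribution. -/

lemma abs_le_freqNorm (n : Freq) (i : Fin 2) : |(n i : ℝ)| ≤ freqNorm n := by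
  refine Real.abs_le_sqrt ?_
  fin_cases i <;> simp <;> positivity

lemma lowPass_eq_one {j : ℕ} {n : Freq} (h : freqNorm n ≤ 2 ^ j) : lowPass j n = 1 := by
  refine Real.smoothTransition.one_of_one_le ?_
  have : freqNorm n / 2 ^ j ≤ 1 := (div_le_one (by positivity)).2 h
  linarith

lemma lowPass_eq_zero {j : ℕ} {n : Freq} (h : 2 ^ (j + 1) ≤ freqNorm n) : lowPass j n = 0 := by
  refine Real.smoothTransition.zero_of_nonpos ?_
  have : 2 ≤ freqNorm n / 2 ^ j := by
    rw [le_div_iff₀ (by positivity)]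
    calc (2 : ℝ) * 2 ^ j = 2 ^ (j + 1) := by ring
      _ ≤ _ := h
  linarith

lemma sum_dyadic (J : ℕ) (n : Freq) : ∑ j ∈ Finset.range (J + 1), dyadic j n = lowPass J n := by
  induction J with
  | zero => simp [dyadic]
  | succ J ih => rw [Finset.sum_range_succ, ih]; simp [dyadic]

lemma abs_dyadic_le (j : ℕ) (n : Freq) : |dyadic j n| ≤ 1 := by
  have h0 : ∀ i, 0 ≤ lowPass i n := fun i => Real.smoothTransition.nonneg _
  have h1 : ∀ i, lowPass i n ≤ 1 := fun i => Real.smoothTransition.le_one _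
  cases j with
  | zero => exact abs_le.2 ⟨by linarith [h0 0, show dyadic 0 n = lowPass 0 n from rfl], h1 0⟩
  | succ j =>
    show |lowPass (j + 1) n - lowPass j n| ≤ 1
    exact abs_le.2 ⟨by linarith [h0 (j + 1), h1 j], by linarith [h0 j, h1 (j + 1)]⟩

lemma dyadic_eq_zero {j : ℕ} {n : Freq} (h : n ∉ freqBox j) : dyadic j n = 0 := by
  have h' : (2 : ℝ) ^ (j + 1) ≤ freqNorm n := by
    by_contra! hlt
    apply h
    simp only [freqBox, Fintype.mem_piFinset, Finset.mem_Icc]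
    intro i
    have := abs_le.1 ((abs_le_freqNorm n i).trans hlt.le)
    exact ⟨by exact_mod_cast this.1, by exact_mod_cast this.2⟩
  cases j with
  | zero => exact lowPass_eq_zero h'
  | succ j =>
    show lowPass (j + 1) n - lowPass j n = 0
    rw [lowPass_eq_zero h', lowPass_eq_zero (le_trans ?_ h'), sub_zero]
    exact pow_le_pow_right₀ (by norm_num) (by omega)

lemma exists_dyadic_ne_zero (n : Freq) : ∃ j, dyadic j n ≠ 0 := by
  obtain ⟨J, hJ⟩ := pow_unbounded_of_one_lt (freqNorm n) (one_lt_two)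
  by_contra! h
  have := sum_dyadic J n
  rw [lowPass_eq_one hJ.le, Finset.sum_eq_zero fun j _ => h j] at this
  exact zero_ne_one this

lemma mFourier_linearIndependent :
    LinearIndependent ℂ (fun n : Freq => (UnitAddTorus.mFourier n : C(Torus, ℂ))) :=
  LinearIndependent.of_comp (ContinuousMap.toLp (E := ℂ) 2 torusMeasure ℂ).toLinearMap
    (UnitAddTorus.orthonormal_mFourier (d := Fin 2)).linearIndependent

lemma eq_zero_of_block (c : Coeffs) (h : ∀ j, block j c = 0) : c = 0 := by
  funext n
  obtain ⟨j, hj⟩ := exists_dyadic_ne_zero n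
  have hn : n ∈ freqBox j := by
    by_contra hn
    exact hj (dyadic_eq_zero hn)
  have := linearIndependent_iff'.1 mFourier_linearIndependent (freqBox j)
    (fun n => (dyadic j n : ℂ) * c n) (by
      rw [← h j]
      ext x
      rw [block_apply, ContinuousMap.sum_apply]
      rfl) n hn
  simpa [hj] using this

namespace Besov

variable {α : ℝ}

lemma core : NormedSpace.Core ℝ (Besov α) where
  norm_nonneg c := Real.iSup_nonneg fun j => blockNorm_nonneg _ _ _
  norm_smul r c := by
    simp only [norm_def, map_smul, blockNorm_smul, Real.norm_eq_abs]
    exact (Real.mul_iSup_of_nonneg (abs_nonneg r) _).symm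
  norm_triangle c d := by
    rw [norm_def, map_add]
    exact ciSup_le fun j => (blockNorm_add_le _ _ _ _).trans
      (add_le_add (blockNorm_le c j) (blockNorm_le d j))
  norm_eq_zero_iff c := by
    refine ⟨fun h => ?_, ?_⟩
    · refine Subtype.ext (eq_zero_of_block _ fun j => ?_)
      have h1 : blockNorm α j (toCoeffs c) = 0 :=
        le_antisymm (h ▸ blockNorm_le c j) (blockNorm_nonneg _ _ _)
      have h2 : (2 : ℝ) ^ (α * j) ≠ 0 := by positivity
      exact norm_eq_zero.1 ((mul_eq_zero.1 h1).resolve_left h2)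
    · rintro rfl
      simp [norm_def, blockNorm_zero]

instance : NormedAddCommGroup (Besov α) := NormedAddCommGroup.ofCore core

instance : NormedSpace ℝ (Besov α) := NormedSpace.ofCore core

end Besov

/-! ### Continuous functions of class `C^α` -/

lemma integrable_mFourier_mul {f : Torus → ℝ} (hf : Integrable f torusMeasure) (n : Freq) :
    Integrable (fun x => UnitAddTorus.mFourier n x • (f x : ℂ)) torusMeasure := by
  refine Integrable.bdd_mul (c := 1) hf.ofReal
    (UnitAddTorus.mFourier n).continuous.aestronglyMeasurable (.of_forall fun x => ?_)
  exact ((UnitAddTorus.mFourier n).norm_coe_le_norm x).trans UnitAddTorus.mFourier_norm.le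

lemma coeff_add {f g : Torus → ℝ} (hf : Integrable f torusMeasure)
    (hg : Integrable g torusMeasure) :
    coeff (fun x => f x + g x) = coeff f + coeff g := by
  funext n
  have := integral_add (integrable_mFourier_mul hf (-n)) (integrable_mFourier_mul hg (-n))
  simp only [← smul_add, ← Complex.ofReal_add] at this
  exact this

lemma coeff_smul (r : ℝ) (f : Torus → ℝ) : coeff (fun x => r * f x) = r • coeff f := by
  funext n
  have := integral_const_mul (μ := torusMeasure) (r : ℂ)
    (fun x => UnitAddTorus.mFourier (-n) x • (f x : ℂ))
  rw [Pi.smul_apply, Complex.real_smul]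
  refine Eq.trans ?_ this
  refine integral_congr_ae (.of_forall fun x => ?_)
  simp only [smul_eq_mul, Complex.ofReal_mul]
  ring

lemma coeff_congr {f g : Torus → ℝ} (h : f =ᵐ[torusMeasure] g) : coeff f = coeff g := by
  funext n
  refine integral_congr_ae ?_
  filter_upwards [h] with x hx
  simp [hx]

lemma coeff_neg (f : Torus → ℝ) (n : Freq) : coeff f (-n) = starRingEnd ℂ (coeff f n) := by
  have := integral_conj (μ := torusMeasure)
    (f := fun x => UnitAddTorus.mFourier (-n) x • (f x : ℂ))
  refine Eq.trans ?_ this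
  refine integral_congr_ae (.of_forall fun x => ?_)
  simp [UnitAddTorus.mFourier_neg]

lemma integrable_continuousMap (f : C(Torus, ℝ)) : Integrable f torusMeasure :=
  f.continuous.integrable_of_hasCompactSupport (HasCompactSupport.of_compactSpace _)

/-- The Fourier coefficients of a continuous function, as a linear map. -/
def coeffC : C(Torus, ℝ) →ₗ[ℝ] Coeffs where
  toFun f := coeff f
  map_add' f g := coeff_add (integrable_continuousMap f) (integrable_continuousMap g)
  map_smul' r f := coeff_smul r f

lemma coeffC_injective : Function.Injective coeffC := by
  rw [← LinearMap.ker_eq_bot, LinearMap.ker_eq_bot']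
  intro f hf
  let F : C(Torus, ℂ) := ⟨fun x => (f x : ℂ), by fun_prop⟩
  have hs : UnitAddTorus.mFourierCoeff F = 0 := hf
  have h2 : F = 0 := by
    ext x
    have h3 := UnitAddTorus.hasSum_mFourier_series_apply_of_summable (f := F)
      (by rw [hs]; exact summable_zero) x
    rw [hs] at h3
    refine h3.unique ?_
    simp
  ext x
  simpa [F] using congrArg (fun G : C(Torus, ℂ) => G x) h2

/-- The continuous functions on the torus that belong to `C^α`. For `α > 0` every element of `C^α`
is such a function, and for `0 < α < 1` the functions in question are the closure of the smooth
functions in the usual space of `α`-Hölder continuous functions. -/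
def Hol (α : ℝ) : Type := (besovSubmodule α).comap coeffC

namespace Hol

variable {α : ℝ}

instance : AddCommGroup (Hol α) := inferInstanceAs (AddCommGroup ((besovSubmodule α).comap coeffC))

instance : Module ℝ (Hol α) := inferInstanceAs (Module ℝ ((besovSubmodule α).comap coeffC))

/-- The underlying continuous function. -/
def toC : Hol α →ₗ[ℝ] C(Torus, ℝ) := ((besovSubmodule α).comap coeffC).subtype

/-- The inclusion into the space `C^α` of distributions. -/
def toBesov : Hol α →ₗ[ℝ] Besov α :=
  (coeffC ∘ₗ ((besovSubmodule α).comap coeffC).subtype).codRestrict (besovSubmodule α) fun f => f.2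

lemma toBesov_injective : Function.Injective (toBesov (α := α)) := by
  intro f g h
  exact Subtype.ext (coeffC_injective (congrArg Subtype.val h))

/-- The norm of `C^α`. -/
instance : NormedAddCommGroup (Hol α) :=
  NormedAddCommGroup.induced (Hol α) (Besov α) toBesov toBesov_injective

instance : NormedSpace ℝ (Hol α) := NormedSpace.induced ℝ (Hol α) (Besov α) toBesov

end Hol

/-- Membership of a continuous function in the full space `B^α_{∞,∞}(T²)`. -/
def IsHolder (α : ℝ) (f : C(Torus, ℝ)) : Prop := ∃ M, ∀ j, blockNorm α j (coeff f) ≤ M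

/-! ### The embedding of `L²` into `C^{-1-κ}` -/

lemma memLp_ofReal (k : CM) : MemLp (fun x => (k x : ℂ)) 2 torusMeasure :=
  (Lp.memLp k).ofReal

lemma integrable_CM (k : CM) : Integrable k torusMeasure :=
  (Lp.memLp k).integrable (by norm_num)

lemma exists_sum_sq_coeff_le (k : CM) : ∃ M, ∀ s : Finset Freq, ∑ n ∈ s, ‖coeff k n‖ ^ 2 ≤ M := by
  have h := UnitAddTorus.hasSum_sq_mFourierCoeff (d := Fin 2) (memLp_ofReal k).toLp
  have hc : ∀ n, UnitAddTorus.mFourierCoeff (memLp_ofReal k).toLp n = coeff k n := fun n => by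
    refine integral_congr_ae ?_
    filter_upwards [(memLp_ofReal k).coeFn_toLp] with x hx
    rw [hx]
  simp only [hc] at h
  exact ⟨_, fun s => sum_le_hasSum s (fun n _ => by positivity) h⟩

lemma card_freqBox_le (j : ℕ) : ((freqBox j).card : ℝ) ≤ (5 * 2 ^ j) ^ 2 := by
  have : (freqBox j).card = (2 * 2 ^ (j + 1) + 1) ^ 2 := by
    simp only [freqBox, Fintype.card_piFinset, Finset.prod_const, Finset.card_univ,
      Fintype.card_fin, Int.card_Icc]
    congr 1
    have : ((2 : ℤ) ^ (j + 1) + 1 - -2 ^ (j + 1)) = ((2 * 2 ^ (j + 1) + 1 : ℕ) : ℤ) := by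
      push_cast; ring
    rw [this, Int.toNat_natCast]
  rw [this]
  push_cast
  gcongr
  have : (1 : ℝ) ≤ 2 ^ j := one_le_pow₀ (by norm_num)
  calc (2 : ℝ) * 2 ^ (j + 1) + 1 = 4 * 2 ^ j + 1 := by ring
    _ ≤ 5 * 2 ^ j := by linarith

lemma norm_block_le (k : CM) {M : ℝ} (hM : ∀ s : Finset Freq, ∑ n ∈ s, ‖coeff k n‖ ^ 2 ≤ M)
    (j : ℕ) : ‖block j (coeff k)‖ ≤ 5 * 2 ^ j * Real.sqrt M := by
  have h1 : ‖block j (coeff k)‖ ≤ ∑ n ∈ freqBox j, ‖coeff k n‖ := by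
    refine (ContinuousMap.norm_le _ (by positivity)).2 fun x => ?_
    rw [block_apply]
    refine (norm_sum_le _ _).trans (Finset.sum_le_sum fun n _ => ?_)
    have h2 : ‖UnitAddTorus.mFourier n x‖ ≤ 1 :=
      ((UnitAddTorus.mFourier n).norm_coe_le_norm x).trans UnitAddTorus.mFourier_norm.le
    rw [norm_mul, norm_mul, Complex.norm_real, Real.norm_eq_abs]
    calc |dyadic j n| * ‖coeff k n‖ * ‖UnitAddTorus.mFourier n x‖
        ≤ 1 * ‖coeff k n‖ * 1 := by
          gcongr
          exact abs_dyadic_le j n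
      _ = ‖coeff k n‖ := by ring
  have h3 : (∑ n ∈ freqBox j, ‖coeff k n‖) ^ 2 ≤ (5 * 2 ^ j) ^ 2 * M :=
    sq_sum_le_card_mul_sum_sq.trans
      (mul_le_mul (card_freqBox_le j) (hM _) (by positivity) (by positivity))
  have h4 := Real.le_sqrt_of_sq_le h3
  rw [Real.sqrt_mul (by positivity), Real.sqrt_sq (by positivity)] at h4
  exact h1.trans h4

lemma coeff_mem_besov {κ : ℝ} (hκ : 0 < κ) (k : CM) : coeff k ∈ besovSubmodule (-1 - κ) := by
  refine ⟨coeff_neg _, ?_⟩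
  obtain ⟨M, hM⟩ := exists_sum_sq_coeff_le k
  have hlim : Tendsto (fun j : ℕ => 5 * Real.sqrt M * ((2 : ℝ) ^ (-κ)) ^ j) atTop (𝓝 0) := by
    have := tendsto_pow_atTop_nhds_zero_of_lt_one (r := (2 : ℝ) ^ (-κ)) (by positivity)
      (Real.rpow_lt_one_of_one_lt_of_neg one_lt_two (by linarith))
    simpa using this.const_mul (5 * Real.sqrt M)
  refine squeeze_zero (fun j => blockNorm_nonneg _ _ _) (fun j => ?_) hlim
  calc blockNorm (-1 - κ) j (coeff k)
      ≤ (2 : ℝ) ^ ((-1 - κ) * j) * (5 * 2 ^ j * Real.sqrt M) := by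
        unfold blockNorm
        gcongr
        exact norm_block_le k hM j
    _ = 5 * Real.sqrt M * ((2 : ℝ) ^ (-κ)) ^ j := by
        rw [← Real.rpow_natCast ((2 : ℝ) ^ (-κ)) j, ← Real.rpow_mul (by norm_num),
          show (-1 - κ) * (j : ℝ) = -κ * j - j by ring, Real.rpow_sub (by norm_num),
          Real.rpow_natCast]
        field_simp

/-- The embedding of the Cameron-Martin space `L²(T²)` into `B = C^{-1-κ}(T²)`. -/
def embB {κ : ℝ} (hκ : 0 < κ) : CM →ₗ[ℝ] Besov (-1 - κ) where
  toFun k := ⟨coeff k, coeff_mem_besov hκ k⟩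
  map_add' k l := Subtype.ext <| by
    refine Eq.trans (coeff_congr ?_) (coeff_add (integrable_CM k) (integrable_CM l))
    exact Lp.coeFn_add k l
  map_smul' r k := Subtype.ext <| by
    refine Eq.trans (coeff_congr ?_) (coeff_smul r k)
    exact Lp.coeFn_smul r k

/-! ### The heat semigroup and mild solutions -/

/-- The heat semigroup `P_t = e^{tΔ}` on periodic distributions. -/
def heat (t : ℝ) (c : Coeffs) : Coeffs :=
  fun n => (Real.exp (-(4 * Real.pi ^ 2 * freqNorm n ^ 2) * t) : ℂ) * c n

/-- The Duhamel integral `∫_0^t P_{t-s} [f(s)] ds` of a time dependent function on the torus, as a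
periodic distribution. -/
def duhamel (f : ℝ → Torus → ℝ) (t : ℝ) : Coeffs :=
  fun n => ∫ s in (0 : ℝ)..t, heat (t - s) (coeff (f s)) n

/-- The path space `X_T = C([0,T]; C^{1-κ}(T²))` with the supremum norm. -/
abbrev PathSpace (κ T : ℝ) : Type := C(Icc (0 : ℝ) T, Hol (1 - κ))

/-- The value `w(s, x)` for `s ∈ [0,T]`. -/
def eval {κ T : ℝ} (w : PathSpace κ T) (s : ℝ) (x : Torus) : ℝ :=
  open Classical in if hs : s ∈ Icc (0 : ℝ) T then Hol.toC (w ⟨s, hs⟩) x else 0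

/-- `w ∈ X_T` is a mild solution of `(∂_t - Δ) w = g(w) h`, `w(0) = u₀`. -/
def IsSolution {κ T : ℝ} (g : ℝ → ℝ) (u₀ : C(Torus, ℝ)) (h : CM) (w : PathSpace κ T) : Prop :=
  ∀ t : Icc (0 : ℝ) T, coeff (Hol.toC (w t)) =
    heat t (coeff u₀) + duhamel (fun s x => g (eval w s x) * h x) t

/-- `v ∈ X_T` is a mild solution of `(∂_t - Δ) v = g'(w) v h + f`, `v(0) = 0`. -/
def IsLinSolution {κ T : ℝ} (g : ℝ → ℝ) (h : CM) (w : PathSpace κ T) (f : ℝ → Torus → ℝ)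
    (v : PathSpace κ T) : Prop :=
  ∀ t : Icc (0 : ℝ) T, coeff (Hol.toC (v t)) =
    duhamel (fun s x => deriv g (eval w s x) * eval v s x * h x) t + duhamel f t

section Forms

variable {κ T : ℝ} (g : ℝ → ℝ) (u₀ : C(Torus, ℝ)) (F : PathSpace κ T → ℝ) (h : CM)

/-- The solution map `h ↦ w_h`. -/
def sol (h : CM) : PathSpace κ T := Classical.epsilon (IsSolution g u₀ h)

/-- The functional `h ↦ F(w_h) + ‖h‖² / 2`. -/
def phaseFunctional (h : CM) : ℝ := F (sol g u₀ h) + ‖h‖ ^ 2 / 2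

/-- The first derivative `v_{h,k}` at `h` of the solution map, in the direction `k`. -/
def der1 (k : CM) : PathSpace κ T := fderiv ℝ (sol g u₀) h k

/-- The second derivative `v_{h,k,l}` at `h` of the solution map, in the directions `k, l`. -/
def der2 (k l : CM) : PathSpace κ T := iteratedFDeriv ℝ 2 (sol g u₀) h ![k, l]

/-- The source term `g''(w_h) v_{h,k} v_{h,l} h` of the non-singular part. -/
def regularSource (κ T : ℝ) (k l : CM) (s : ℝ) (x : Torus) : ℝ :=
  iteratedDeriv 2 g (eval (sol g u₀ h : PathSpace κ T) s x) *
    eval (der1 g u₀ h k : PathSpace κ T) s x * eval (der1 g u₀ h l : PathSpace κ T) s x * h x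

/-- The source term `g'(w_h) v_{h,k} l + g'(w_h) v_{h,l} k` of the singular part. -/
def singularSource (κ T : ℝ) (k l : CM) (s : ℝ) (x : Torus) : ℝ :=
  deriv g (eval (sol g u₀ h : PathSpace κ T) s x) *
      eval (der1 g u₀ h k : PathSpace κ T) s x * l x +
    deriv g (eval (sol g u₀ h : PathSpace κ T) s x) *
      eval (der1 g u₀ h l : PathSpace κ T) s x * k x

/-- The defining equation of the non-singular part of `v_{h,k,l}`. -/
def IsRegularPart (k l : CM) (v : PathSpace κ T) : Prop :=
  IsLinSolution g h (sol g u₀ h) (regularSource g u₀ h κ T k l) v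

/-- The defining equation of the singular part of `v_{h,k,l}`. -/
def IsSingularPart (k l : CM) (v : PathSpace κ T) : Prop :=
  IsLinSolution g h (sol g u₀ h) (singularSource g u₀ h κ T k l) v

/-- The non-singular part of `v_{h,k,l}`. -/
def regularPart (k l : CM) : PathSpace κ T := Classical.epsilon (IsRegularPart g u₀ h k l)

/-- The singular part of `v_{h,k,l}`. -/
def singularPart (k l : CM) : PathSpace κ T := Classical.epsilon (IsSingularPart g u₀ h k l)

/-- `A_h[k,l] = DF(w_h)[v_{h,k,l}] + D²F(w_h)[v_{h,k}, v_{h,l}]`. -/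
def formA (k l : CM) : ℝ :=
  fderiv ℝ F (sol g u₀ h) (der2 g u₀ h k l) +
    iteratedFDeriv ℝ 2 F (sol g u₀ h) ![der1 g u₀ h k, der1 g u₀ h l]

/-- `Ã_h[k,l] = DF(w_h)[v]` with the singular part `v` of `v_{h,k,l}`. -/
def formASing (k l : CM) : ℝ := fderiv ℝ F (sol g u₀ h) (singularPart g u₀ h k l)

/-- `q_h = A_h - Ã_h`. -/
def formQ (k l : CM) : ℝ := formA g u₀ F h k l - formASing g u₀ F h k l

end Forms

/-! ### Trace class operators -/

/-- An operator on a Hilbert space is trace class if it has a singular value decomposition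
`S x = ∑ s_i ⟨e_i, x⟩ f_i` with orthonormal families `e`, `f` and summable singular values. -/
def IsTraceClass {H : Type*} [NormedAddCommGroup H] [InnerProductSpace ℝ H] (S : H →L[ℝ] H) :
    Prop :=
  ∃ (ι : Type) (s : ι → ℝ) (e f : ι → H), Orthonormal ℝ e ∧ Orthonormal ℝ f ∧ (∀ i, 0 ≤ s i) ∧
    Summable s ∧ ∀ x, HasSum (fun i => (s i * inner ℝ (e i) x) • f i) (S x)

/-- A bilinear form is trace class if it is given by a trace class operator. -/
def IsTraceClassForm {H : Type*} [NormedAddCommGroup H] [InnerProductSpace ℝ H]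
    (q : H → H → ℝ) : Prop :=
  ∃ S : H →L[ℝ] H, (∀ k l, inner ℝ (S k) l = q k l) ∧ IsTraceClass S

end GPAM

end

/-! The form `q` sees its two arguments only through the first derivatives `v_k`, `v_l` of the
solution map. Differentiating the mild equation twice gives a linear Volterra equation for
`v_{k,l}`, and by uniqueness `v_{k,l}` is the sum of its regular and singular parts; subtracting the
singular form leaves `DF[v^reg] + D²F[v_k, v_l]`. The regular part is the inverse of `v ↦ v - ∫
P[g'(w) v h]` applied to the Duhamel integral of `g''(w) v_k v_l h`, hence a continuous bilinear
function of `(v_k, v_l)`. So `q[k,l] = B(v_k, v_l)` with `B` continuous and symmetric on the path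
space (`exists_formQ_eq_bilin`).

What remains is the estimate `‖v_k‖ ≤ C ‖k‖_B` (`exists_norm_der1_le`). After inverting the Volterra
operator it concerns the Duhamel integral of `g(w) k` alone. Here `k` has regularity `-1-κ`, while
`h` is merely square integrable, so that Hölder regularity of `w` above `1+κ` is not available.
Regularity measured in `L²` replaces it: `w` has `1+2κ` derivatives in the sense of `DyadicL2`, and
second differences carry `1+ρ` of them over to `g(w)` for some `κ < ρ < 2κ`
(`exists_sum_sq_coeff_nem_le`). A block of `k` of frequency much higher than the output interacts
only with the same shell of `g(w)`. Cauchy-Schwarz and Bernstein's inequality bound this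
interaction, and `ρ > κ` makes the series converge (`exists_norm_block_heat_mul_le`). Integrating
the parabolic decay of the blocks gains exactly the two derivatives between `-1-κ` and `1-κ`
(`exists_norm_duhL_mulPath_le`).

A symmetric form bounded in the norm of `B` is trace class because white noise takes values in `B`.
In discrete form: a random sum `∑ ε_i v_i` of orthonormal vectors has expected norm in `B` bounded
independently of their number (`exists_sum_signs_norm_embB_le`). Testing the form on such sums of
eigenvectors bounds `∑ |μ_i|` (`exists_sum_abs_eigenvalues_le`). Compactness comes from the
geometric gain `2^{-κJ}` of high frequencies in `B`. Existence, uniqueness and norm of the extension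
follow from the density of `L²` in `B`.

Well-posedness rests on a contraction in exponentially weighted norms (`existsUnique_fixedPoint`),
and smoothness of the solution map on the implicit function theorem (`contDiff_sol`). -/

namespace GPAM

/-! ### Fourier analysis on the torus -/

/-- The trigonometric polynomial with coefficients `c` and frequencies in `s`. -/
noncomputable def trig (s : Finset Freq) (c : Coeffs) : C(Torus, ℂ) :=
  ∑ n ∈ s, c n • UnitAddTorus.mFourier n

/-- The Fourier coefficients of a complex function. -/
noncomputable def fcoeff (f : Torus → ℂ) (n : Freq) : ℂ :=
  ∫ x, UnitAddTorus.mFourier (-n) x * f x ∂torusMeasure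

lemma coeff_eq_fcoeff (f : Torus → ℝ) : coeff f = fcoeff fun x => (f x : ℂ) := rfl

lemma fcoeff_eq (f : Torus → ℂ) : fcoeff f = UnitAddTorus.mFourierCoeff f := rfl

lemma trig_apply (s : Finset Freq) (c : Coeffs) (x : Torus) :
    trig s c x = ∑ n ∈ s, c n * UnitAddTorus.mFourier n x := by
  simp [trig, ContinuousMap.sum_apply]

lemma block_eq_trig (j : ℕ) (c : Coeffs) :
    block j c = trig (freqBox j) fun n => (dyadic j n : ℂ) * c n := by
  ext x
  rw [block_apply, trig_apply]

lemma norm_mFourier_apply (n : Freq) (x : Torus) : ‖UnitAddTorus.mFourier n x‖ = 1 := by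
  simp only [UnitAddTorus.mFourier, ContinuousMap.coe_mk, norm_prod, fourier_apply]
  exact Finset.prod_eq_one fun i _ => Circle.norm_coe _

lemma mFourier_add_apply (n : Freq) (x y : Torus) :
    UnitAddTorus.mFourier n (x + y) = UnitAddTorus.mFourier n x * UnitAddTorus.mFourier n y := by
  simp only [UnitAddTorus.mFourier, ContinuousMap.coe_mk, Pi.add_apply, ← Finset.prod_mul_distrib]
  refine Finset.prod_congr rfl fun i _ => ?_
  simp [fourier_apply, AddCircle.toCircle_add]

lemma integrable_of_continuous {f : Torus → ℂ} (hf : Continuous f) :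
    Integrable f torusMeasure :=
  hf.integrable_of_hasCompactSupport (HasCompactSupport.of_compactSpace _)

lemma integrable_mFourier_mul_complex {f : Torus → ℂ} (hf : Integrable f torusMeasure) (n : Freq) :
    Integrable (fun x => UnitAddTorus.mFourier n x * f x) torusMeasure :=
  Integrable.bdd_mul (c := 1) hf (UnitAddTorus.mFourier n).continuous.aestronglyMeasurable
    (.of_forall fun x => (norm_mFourier_apply n x).le)

lemma fcoeff_add {f g : Torus → ℂ} (hf : Integrable f torusMeasure)
    (hg : Integrable g torusMeasure) (n : Freq) :
    fcoeff (fun x => f x + g x) n = fcoeff f n + fcoeff g n := by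
  unfold fcoeff
  rw [← integral_add (integrable_mFourier_mul_complex hf _) (integrable_mFourier_mul_complex hg _)]
  simp only [mul_add]

lemma fcoeff_sub {f g : Torus → ℂ} (hf : Integrable f torusMeasure)
    (hg : Integrable g torusMeasure) (n : Freq) :
    fcoeff (fun x => f x - g x) n = fcoeff f n - fcoeff g n := by
  unfold fcoeff
  rw [← integral_sub (integrable_mFourier_mul_complex hf _) (integrable_mFourier_mul_complex hg _)]
  simp only [mul_sub]

lemma fcoeff_const_mul (z : ℂ) (f : Torus → ℂ) (n : Freq) :
    fcoeff (fun x => z * f x) n = z * fcoeff f n := by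
  unfold fcoeff
  rw [← integral_const_mul]
  congr 1 with x
  ring

lemma fcoeff_finset_sum {ι : Type*} (s : Finset ι) {f : ι → Torus → ℂ}
    (hf : ∀ i ∈ s, Integrable (f i) torusMeasure) (n : Freq) :
    fcoeff (fun x => ∑ i ∈ s, f i x) n = ∑ i ∈ s, fcoeff (f i) n := by
  unfold fcoeff
  simp only [Finset.mul_sum]
  exact integral_finsetSum _ fun i hi => integrable_mFourier_mul_complex (hf i hi) _

lemma integral_mFourier (n : Freq) :
    ∫ x, UnitAddTorus.mFourier n x ∂torusMeasure = if n = 0 then 1 else 0 := by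
  have h := orthonormal_iff_ite.1 (UnitAddTorus.orthonormal_mFourier (d := Fin 2)) 0 n
  simp only [ContinuousMap.inner_toLp, ← UnitAddTorus.mFourier_neg, ← UnitAddTorus.mFourier_add] at h
  simp only [neg_zero, add_zero, eq_comm] at h
  exact h.symm

lemma fcoeff_mFourier (m n : Freq) :
    fcoeff (UnitAddTorus.mFourier m) n = if m = n then 1 else 0 := by
  unfold fcoeff
  simp only [← UnitAddTorus.mFourier_add]
  rw [integral_mFourier]
  congr 1
  rw [eq_iff_iff, neg_add_eq_zero, eq_comm]

lemma fcoeff_trig (s : Finset Freq) (c : Coeffs) (n : Freq) :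
    fcoeff (trig s c) n = if n ∈ s then c n else 0 := by
  have h : (trig s c : Torus → ℂ) = fun x => ∑ m ∈ s, c m * UnitAddTorus.mFourier m x := by
    ext x; exact trig_apply s c x
  rw [h, fcoeff_finset_sum _ fun m _ => integrable_of_continuous (by fun_prop)]
  simp only [fcoeff_const_mul, fcoeff_mFourier]
  simp

lemma fcoeff_block (j : ℕ) (c : Coeffs) (n : Freq) :
    fcoeff (block j c) n = dyadic j n * c n := by
  rw [block_eq_trig, fcoeff_trig]
  split_ifs with h
  · rfl
  · simp [dyadic_eq_zero h]

lemma norm_fcoeff_le (f : C(Torus, ℂ)) (n : Freq) : ‖fcoeff f n‖ ≤ ‖f‖ := by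
  unfold fcoeff
  refine (norm_integral_le_of_norm_le_const (C := ‖f‖) (.of_forall fun x => ?_)).trans ?_
  · rw [norm_mul, norm_mFourier_apply, one_mul]
    exact f.norm_coe_le_norm x
  · simp

lemma fcoeff_mFourier_mul (m n : Freq) (f : Torus → ℂ) :
    fcoeff (fun x => UnitAddTorus.mFourier m x * f x) n = fcoeff f (n - m) := by
  unfold fcoeff
  congr 1 with x
  rw [← mul_assoc, ← UnitAddTorus.mFourier_add]
  congr 3
  abel

lemma fcoeff_translate (f : Torus → ℂ) (y : Torus) (n : Freq) :
    fcoeff (fun x => f (x + y)) n = UnitAddTorus.mFourier n y * fcoeff f n := by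
  unfold fcoeff
  rw [← integral_const_mul, ← integral_add_right_eq_self (μ := torusMeasure)
    (fun x => UnitAddTorus.mFourier n y * (UnitAddTorus.mFourier (-n) x * f x)) y]
  congr 1 with x
  rw [mFourier_add_apply (-n) x y]
  have : UnitAddTorus.mFourier n y * UnitAddTorus.mFourier (-n) y = 1 := by
    rw [← UnitAddTorus.mFourier_add]; simp [UnitAddTorus.mFourier_zero]
  linear_combination -(UnitAddTorus.mFourier (-n) x * f (x + y)) * this

/-! Parseval's identity. -/

lemma hasSum_sq_fcoeff {f : Torus → ℂ} (hf : MemLp f 2 torusMeasure) :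
    HasSum (fun n => ‖fcoeff f n‖ ^ 2) (∫ x, ‖f x‖ ^ 2 ∂torusMeasure) := by
  have h := UnitAddTorus.hasSum_sq_mFourierCoeff (d := Fin 2) hf.toLp
  have hc : ∀ n, UnitAddTorus.mFourierCoeff hf.toLp n = fcoeff f n := fun n => by
    refine integral_congr_ae ?_
    filter_upwards [hf.coeFn_toLp] with x hx
    rw [hx]; rfl
  simp only [hc] at h
  convert! h using 1
  refine integral_congr_ae ?_
  filter_upwards [hf.coeFn_toLp] with x hx
  rw [hx]

lemma memLp_of_continuous {f : Torus → ℂ} (hf : Continuous f) : MemLp f 2 torusMeasure := by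
  obtain ⟨C, hC⟩ := (isCompact_range hf).isBounded.exists_norm_le
  exact MemLp.of_bound hf.aestronglyMeasurable C (.of_forall fun x => hC _ ⟨x, rfl⟩)

lemma sum_sq_fcoeff_le {f : Torus → ℂ} (hf : MemLp f 2 torusMeasure) (s : Finset Freq) :
    ∑ n ∈ s, ‖fcoeff f n‖ ^ 2 ≤ ∫ x, ‖f x‖ ^ 2 ∂torusMeasure :=
  sum_le_hasSum s (fun n _ => by positivity) (hasSum_sq_fcoeff hf)

lemma integral_sq_norm_trig (s : Finset Freq) (c : Coeffs) :
    ∫ x, ‖trig s c x‖ ^ 2 ∂torusMeasure = ∑ n ∈ s, ‖c n‖ ^ 2 := by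
  refine (hasSum_sq_fcoeff (memLp_of_continuous (trig s c).continuous)).unique ?_
  have h : (fun n => ‖fcoeff (trig s c) n‖ ^ 2) = fun n => if n ∈ s then ‖c n‖ ^ 2 else 0 := by
    ext n
    rw [fcoeff_trig]
    split_ifs <;> simp
  rw [h]
  have := hasSum_sum_of_ne_finset_zero (L := .unconditional _) (f := fun n => if n ∈ s then ‖c n‖ ^ 2 else 0) (s := s)
    (fun n hn => by simp [hn])
  convert! this using 1
  exact Finset.sum_congr rfl fun n hn => by simp [hn]

lemma integral_sq_norm_le (f : C(Torus, ℂ)) : ∫ x, ‖f x‖ ^ 2 ∂torusMeasure ≤ ‖f‖ ^ 2 := by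
  have h : ∫ x, ‖f x‖ ^ 2 ∂torusMeasure ≤ ∫ _, ‖f‖ ^ 2 ∂torusMeasure := by
    refine integral_mono_of_nonneg (.of_forall fun x => by positivity) (integrable_const _)
      (.of_forall fun x => ?_)
    simp only
    gcongr
    exact f.norm_coe_le_norm x
  simpa using h

/-- A continuous function is determined by its Fourier coefficients. -/
lemma eq_of_fcoeff_eq {f g : C(Torus, ℂ)} (h : ∀ n, fcoeff f n = fcoeff g n) : f = g := by
  have h0 : fcoeff (f - g : C(Torus, ℂ)) = 0 := by
    ext n
    have := fcoeff_sub (integrable_of_continuous f.continuous)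
      (integrable_of_continuous g.continuous) n
    rw [show ((f - g : C(Torus, ℂ)) : Torus → ℂ) = fun x => f x - g x from rfl, this, h n]
    simp
  ext x
  have h3 := UnitAddTorus.hasSum_mFourier_series_apply_of_summable (f := f - g)
    (by rw [← fcoeff_eq, h0]; exact summable_zero) x
  rw [← fcoeff_eq, h0] at h3
  have h4 : (f - g) x = 0 := h3.unique (by simp)
  simpa [sub_eq_zero] using h4

/-! ### Sup bounds for trigonometric polynomials and the supports of the dyadic cut-offs -/

lemma norm_trig_le (s : Finset Freq) (c : Coeffs) : ‖trig s c‖ ≤ ∑ n ∈ s, ‖c n‖ := by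
  refine (norm_sum_le _ _).trans (Finset.sum_le_sum fun n _ => ?_)
  rw [norm_smul, UnitAddTorus.mFourier_norm, mul_one]

/-- Cauchy-Schwarz. On `freqBox j` the cardinality factor is at most `5 * 2 ^ j`, so this is
Bernstein's inequality in dimension two: passing from `L²` to the sup norm costs one derivative. -/
lemma norm_trig_le_sqrt (s : Finset Freq) (c : Coeffs) :
    ‖trig s c‖ ≤ Real.sqrt s.card * Real.sqrt (∑ n ∈ s, ‖c n‖ ^ 2) := by
  refine (norm_trig_le s c).trans ?_
  rw [← Real.sqrt_mul (by positivity)]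
  exact Real.le_sqrt_of_sq_le sq_sum_le_card_mul_sum_sq

lemma sqrt_card_freqBox_le (j : ℕ) : Real.sqrt (freqBox j).card ≤ 5 * 2 ^ j :=
  (Real.sqrt_le_sqrt (card_freqBox_le j)).trans (Real.sqrt_sq (by positivity)).le

lemma freqNorm_neg (n : Freq) : freqNorm (-n) = freqNorm n := by simp [freqNorm]

lemma dyadic_neg (j : ℕ) (n : Freq) : dyadic j (-n) = dyadic j n := by
  cases j <;> simp [dyadic, lowPass, freqNorm_neg]

lemma dyadic_succ_eq_zero {j : ℕ} {n : Freq} (h : freqNorm n ≤ 2 ^ j) : dyadic (j + 1) n = 0 := by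
  show lowPass (j + 1) n - lowPass j n = 0
  rw [lowPass_eq_one h, lowPass_eq_one (h.trans (pow_le_pow_right₀ (by norm_num) (by omega))),
    sub_self]

/-- The weight `4π²|n|²` of the Laplacian. -/
noncomputable def lam (n : Freq) : ℝ := 4 * Real.pi ^ 2 * freqNorm n ^ 2

lemma lam_nonneg (n : Freq) : 0 ≤ lam n := by unfold lam; positivity

lemma heat_apply (t : ℝ) (c : Coeffs) (n : Freq) : heat t c n = (Real.exp (-(lam n * t)) : ℂ) * c n := by
  simp [heat, lam, neg_mul]

/-- The term `-1` only serves `j = 0`, whose block contains the zero frequency. For later blocks the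
factor `4π²` more than makes up for the annulus starting at `2 ^ (j - 1)`. -/
lemma le_lam {j : ℕ} {n : Freq} (h : dyadic j n ≠ 0) : (4 : ℝ) ^ j - 1 ≤ lam n := by
  cases j with
  | zero => simpa using lam_nonneg n
  | succ j =>
    have h1 : (2 : ℝ) ^ j < freqNorm n := by
      by_contra! h1
      exact h (dyadic_succ_eq_zero h1)
    have h2 : ((2 : ℝ) ^ j) ^ 2 ≤ freqNorm n ^ 2 := by gcongr
    have h3 : ((2 : ℝ) ^ j) ^ 2 = 4 ^ j := by rw [← pow_mul, mul_comm, pow_mul]; norm_num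
    have h4 : (1 : ℝ) ≤ Real.pi ^ 2 := by nlinarith [Real.pi_gt_three]
    unfold lam
    rw [h3] at h2
    have h5 : (0 : ℝ) < 4 ^ j := by positivity
    rw [pow_succ]
    nlinarith

end GPAM

namespace GPAM

/-! ### Fourier multipliers on the space of continuous functions -/

/-- The Fourier multiplier `m` has norm at most `C` for the uniform norm. -/
def MultBound (m : Freq → ℂ) (C : ℝ) : Prop :=
  ∀ (s : Finset Freq) (c : Coeffs), ‖trig s fun n => m n * c n‖ ≤ C * ‖trig s c‖

lemma trig_add (s : Finset Freq) (c d : Coeffs) : trig s (c + d) = trig s c + trig s d := by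
  ext x
  simp [trig_apply, add_mul, Finset.sum_add_distrib]

lemma trig_smul (s : Finset Freq) (z : ℂ) (c : Coeffs) : trig s (z • c) = z • trig s c := by
  ext x
  simp [trig_apply, mul_assoc, Finset.mul_sum]

lemma trig_congr {s : Finset Freq} {c d : Coeffs} (h : ∀ n ∈ s, c n = d n) :
    trig s c = trig s d :=
  Finset.sum_congr rfl fun n hn => by rw [h n hn]

lemma trig_subset {s t : Finset Freq} (hst : s ⊆ t) {c : Coeffs} (h : ∀ n ∈ t, n ∉ s → c n = 0) :
    trig s c = trig t c :=
  Finset.sum_subset hst fun n hn hn' => by rw [h n hn hn']; ext x; simp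

namespace MultBound

variable {m m₁ m₂ : Freq → ℂ} {C C₁ C₂ : ℝ}

lemma mono (h : MultBound m C₁) (hC : C₁ ≤ C₂) : MultBound m C₂ := fun s c =>
  (h s c).trans (by gcongr)

lemma mul (h₁ : MultBound m₁ C₁) (h₂ : MultBound m₂ C₂) (hC : 0 ≤ C₁) :
    MultBound (fun n => m₁ n * m₂ n) (C₁ * C₂) := fun s c => by
  have := h₁ s fun n => m₂ n * c n
  simp only [← mul_assoc] at this
  refine this.trans ?_
  rw [mul_assoc]
  gcongr
  exact h₂ s c

lemma add (h₁ : MultBound m₁ C₁) (h₂ : MultBound m₂ C₂) :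
    MultBound (fun n => m₁ n + m₂ n) (C₁ + C₂) := fun s c => by
  have : (fun n => (m₁ n + m₂ n) * c n) = (fun n => m₁ n * c n) + fun n => m₂ n * c n := by
    ext n; simp [add_mul]
  rw [this, trig_add, add_mul]
  exact (norm_add_le _ _).trans (add_le_add (h₁ s c) (h₂ s c))

lemma const_mul (z : ℂ) (h : MultBound m C) : MultBound (fun n => z * m n) (‖z‖ * C) :=
  fun s c => by
    have : (fun n => z * m n * c n) = z • fun n => m n * c n := by
      ext n; simp [mul_assoc]
    rw [this, trig_smul, norm_smul, mul_assoc]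
    gcongr
    exact h s c

lemma sub (h₁ : MultBound m₁ C₁) (h₂ : MultBound m₂ C₂) :
    MultBound (fun n => m₁ n - m₂ n) (C₁ + C₂) := by
  simpa [sub_eq_add_neg] using h₁.add (h₂.const_mul (-1))

/-- A Fourier-Stieltjes transform is a multiplier. -/
lemma of_integral {α : Type*} [MeasurableSpace α] (μ : Measure α) (G : α → ℂ)
    (hG : Integrable G μ) (p : α → Torus) (hp : Measurable p)
    (hm : ∀ n, m n = ∫ z, G z * UnitAddTorus.mFourier n (p z) ∂μ) :
    MultBound m (∫ z, ‖G z‖ ∂μ) := fun s c => by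
  have hint : ∀ n, Integrable (fun z => G z * UnitAddTorus.mFourier n (p z)) μ := fun n => by
    refine hG.mul_bdd (c := 1) ?_ (.of_forall fun z => (norm_mFourier_apply n _).le)
    exact ((UnitAddTorus.mFourier n).continuous.measurable.comp hp).aestronglyMeasurable
  refine (ContinuousMap.norm_le _ (by positivity)).2 fun x => ?_
  -- The multiplier averages translates of the polynomial against `G`, and translations preserve the
  -- sup norm.
  have h : trig s (fun n => m n * c n) x = ∫ z, G z * trig s c (x + p z) ∂μ := by
    simp only [trig_apply, mFourier_add_apply, Finset.mul_sum]
    have : ∀ z, ∀ n, G z * (c n * (UnitAddTorus.mFourier n x * UnitAddTorus.mFourier n (p z))) =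
      (c n * UnitAddTorus.mFourier n x) * (G z * UnitAddTorus.mFourier n (p z)) := by
      intro z n; ring
    simp only [this]
    rw [integral_finsetSum _ fun n _ => (hint n).const_mul _]
    refine Finset.sum_congr rfl fun n _ => ?_
    rw [integral_const_mul, hm]
    ring
  rw [h, ← integral_mul_const]
  refine norm_integral_le_of_norm_le (hG.norm.mul_const _) (.of_forall fun z => ?_)
  rw [norm_mul]
  gcongr
  exact (trig s c).norm_coe_le_norm _

end MultBound

/-- A frequency as a vector of the Euclidean plane. -/
noncomputable def freqVec (n : Freq) : EuclideanSpace ℝ (Fin 2) := WithLp.toLp 2 fun i => (n i : ℝ)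

lemma norm_freqVec (n : Freq) : ‖freqVec n‖ = freqNorm n := by
  simp [freqVec, freqNorm, EuclideanSpace.norm_eq]

-- The constant is the `L¹` norm of the Fourier transform of `f`. Dilating `f` only rescales the
-- translations that are averaged, so the same constant works for every `r`.
open scoped FourierTransform SchwartzMap in
lemma exists_multBound_of_contDiff {f : EuclideanSpace ℝ (Fin 2) → ℂ}
    (hf : ContDiff ℝ (⊤ : ℕ∞) f) (hf' : HasCompactSupport f) :
    ∃ C, ∀ r : ℝ, MultBound (fun n => f (r • freqVec n)) C := by
  let φ : 𝓢(EuclideanSpace ℝ (Fin 2), ℂ) := hf'.toSchwartzMap hf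
  let ψ : 𝓢(EuclideanSpace ℝ (Fin 2), ℂ) := 𝓕 φ
  refine ⟨∫ w, ‖ψ w‖, fun r => ?_⟩
  refine MultBound.of_integral volume ψ ψ.integrable
    (fun (w : EuclideanSpace ℝ (Fin 2)) i => ((r * w i : ℝ) : AddCircle (1 : ℝ))) ?_ fun n => ?_
  · refine measurable_pi_lambda _ fun i => ?_
    refine (Continuous.measurable ?_)
    exact (AddCircle.continuous_mk' (1 : ℝ)).comp (by fun_prop)
  · have h1 : f (r • freqVec n) = (𝓕⁻ ψ) (r • freqVec n) := by
      simp only [ψ]; rw [FourierTransform.fourierInv_fourier_eq]; rfl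
    rw [h1, SchwartzMap.fourierInv_coe, Real.fourierInv_eq']
    congr 1 with w
    rw [smul_eq_mul, mul_comm]
    congr 1
    simp only [UnitAddTorus.mFourier, ContinuousMap.coe_mk, fourier_coe_apply, ← Complex.exp_sum]
    congr 1
    simp [PiLp.inner_apply, freqVec, Fin.sum_univ_two]
    ring

/-- The radial cut-off function, equal to `1` for `|ξ| ≤ 1` and to `0` for `|ξ| ≥ 2`. -/
noncomputable def radialCutoff (ξ : EuclideanSpace ℝ (Fin 2)) : ℝ := Real.smoothTransition (2 - ‖ξ‖)

lemma radialCutoff_eq_one {ξ : EuclideanSpace ℝ (Fin 2)} (h : ‖ξ‖ ≤ 1) : radialCutoff ξ = 1 :=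
  Real.smoothTransition.one_of_one_le (by linarith)

lemma radialCutoff_eq_zero {ξ : EuclideanSpace ℝ (Fin 2)} (h : 2 ≤ ‖ξ‖) : radialCutoff ξ = 0 :=
  Real.smoothTransition.zero_of_nonpos (by linarith)

/-- The norm is not smooth at the origin, but the cut-off is constant near it. -/
lemma contDiff_radialCutoff : ContDiff ℝ (⊤ : ℕ∞) radialCutoff := by
  rw [contDiff_iff_contDiffAt]
  intro ξ
  by_cases h : ξ = 0
  · have : radialCutoff =ᶠ[𝓝 ξ] fun _ => 1 := by
      have h0 : ∀ᶠ η in 𝓝 ξ, ‖η‖ < 1 := by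
        rw [h]; exact (continuous_norm.tendsto' 0 0 norm_zero).eventually_lt_const one_pos
      filter_upwards [h0] with η hη using radialCutoff_eq_one hη.le
    exact contDiffAt_const.congr_of_eventuallyEq this
  · unfold radialCutoff
    exact Real.smoothTransition.contDiffAt.comp ξ (contDiffAt_const.sub (contDiffAt_norm ℝ h))

lemma hasCompactSupport_of_eq_zero {f : EuclideanSpace ℝ (Fin 2) → ℂ}
    (h : ∀ ξ, 2 < ‖ξ‖ → f ξ = 0) : HasCompactSupport f := by
  refine HasCompactSupport.intro (isCompact_closedBall 0 2) fun ξ hξ => h ξ ?_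
  simpa using hξ

lemma lowPass_eq_radialCutoff (j : ℕ) (n : Freq) :
    lowPass j n = radialCutoff (((2 : ℝ) ^ j)⁻¹ • freqVec n) := by
  simp only [lowPass, radialCutoff, norm_smul, norm_freqVec, norm_inv, norm_pow, Real.norm_ofNat]
  congr 2
  ring

lemma exists_multBound_lowPass : ∃ C, 0 ≤ C ∧ ∀ j, MultBound (fun n => lowPass j n) C := by
  obtain ⟨C, hC⟩ := exists_multBound_of_contDiff (f := fun ξ => (radialCutoff ξ : ℂ))
    (Complex.ofRealCLM.contDiff.comp contDiff_radialCutoff)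
    (hasCompactSupport_of_eq_zero fun ξ hξ => by simp [radialCutoff_eq_zero hξ.le])
  refine ⟨max C 0, le_max_right _ _, fun j => ?_⟩
  simp only [lowPass_eq_radialCutoff]
  exact (hC _).mono (le_max_left _ _)

lemma exists_multBound_dyadic : ∃ C, 0 ≤ C ∧ ∀ j, MultBound (fun n => dyadic j n) C := by
  obtain ⟨C, hC0, hC⟩ := exists_multBound_lowPass
  refine ⟨C + C, by positivity, fun j => ?_⟩
  cases j with
  | zero => exact (hC 0).mono (by linarith)
  | succ j => simpa [dyadic] using (hC (j + 1)).sub (hC j)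

/-- Dividing by `lam n ^ 2` pays for the factor `(lam n * τ) ^ 2` in `multBound_sq_lam_mul_heat`;
together they give the decay `(4 ^ j τ)^{-2}` of a heat block. The symbol is a dilation of one fixed
function, smooth because the difference of cut-offs vanishes near the origin. -/
lemma exists_multBound_dyadic_div : ∃ C, 0 ≤ C ∧
    ∀ j, MultBound (fun n => ((dyadic (j + 1) n * (4 ^ (j + 1)) ^ 2 / lam n ^ 2 : ℝ) : ℂ)) C := by
  let χ : EuclideanSpace ℝ (Fin 2) → ℝ := fun ξ =>
    (radialCutoff ξ - radialCutoff ((2 : ℝ) • ξ)) / (4 * Real.pi ^ 2 * ‖ξ‖ ^ 2) ^ 2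
  have hχ : ContDiff ℝ (⊤ : ℕ∞) χ := by
    rw [contDiff_iff_contDiffAt]
    intro ξ
    by_cases h : ξ = 0
    · have : χ =ᶠ[𝓝 ξ] fun _ => 0 := by
        have h0 : ∀ᶠ η in 𝓝 ξ, ‖η‖ < 1 / 2 := by
          rw [h]
          exact (continuous_norm.tendsto' 0 0 norm_zero).eventually_lt_const (by norm_num)
        filter_upwards [h0] with η hη
        simp only [χ]
        rw [radialCutoff_eq_one (by linarith), radialCutoff_eq_one, sub_self, zero_div]
        rw [norm_smul, Real.norm_ofNat]; linarith
      exact contDiffAt_const.congr_of_eventuallyEq this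
    · have h1 : ContDiffAt ℝ (⊤ : ℕ∞) (fun ξ : EuclideanSpace ℝ (Fin 2) =>
          (4 * Real.pi ^ 2 * ‖ξ‖ ^ 2) ^ 2) ξ :=
        (contDiffAt_const.mul (contDiff_norm_sq ℝ).contDiffAt).pow 2
      have h2 : ContDiff ℝ (⊤ : ℕ∞) fun ξ : EuclideanSpace ℝ (Fin 2) =>
          radialCutoff ξ - radialCutoff ((2 : ℝ) • ξ) :=
        contDiff_radialCutoff.sub (contDiff_radialCutoff.comp (contDiff_const_smul _))
      refine h2.contDiffAt.div h1 ?_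
      have := norm_pos_iff.2 h
      positivity
  obtain ⟨C, hC⟩ := exists_multBound_of_contDiff (f := fun ξ => (χ ξ : ℂ))
    (Complex.ofRealCLM.contDiff.comp hχ)
    (hasCompactSupport_of_eq_zero fun ξ hξ => by
      simp only [χ]
      rw [radialCutoff_eq_zero hξ.le, radialCutoff_eq_zero, sub_self, zero_div, Complex.ofReal_zero]
      rw [norm_smul, Real.norm_ofNat]; linarith)
  refine ⟨max C 0, le_max_right _ _, fun j => ?_⟩
  convert! (hC ((2 : ℝ) ^ (j + 1))⁻¹).mono (le_max_left _ 0) using 3 with n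
  have h2 : (2 : ℝ) • ((2 : ℝ) ^ (j + 1))⁻¹ • freqVec n = ((2 : ℝ) ^ j)⁻¹ • freqVec n := by
    rw [smul_smul]
    congr 1
    rw [pow_succ]
    field_simp
  simp only [χ, h2, ← lowPass_eq_radialCutoff]
  rw [norm_smul, norm_freqVec]
  simp only [norm_inv, norm_pow, Real.norm_ofNat, dyadic, lam]
  have h4 : ((4 : ℝ) ^ (j + 1)) = (2 ^ (j + 1)) ^ 2 := by
    rw [← pow_mul, mul_comm, pow_mul]; norm_num
  rw [h4]
  by_cases h0 : freqNorm n = 0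
  · simp [h0]
  · field_simp

/-! The heat semigroup. -/

-- Averaging translations along one coordinate axis against `G` times a standard Gaussian. The heat
-- kernel on the torus is the composition of two such averages, one for each axis.
open ProbabilityTheory in
lemma multBound_gaussian (r : ℝ) (i : Fin 2) (G : ℝ → ℂ)
    (hG : Integrable G (gaussianReal 0 1)) {m : ℝ → ℂ}
    (hm : ∀ t, m t = ∫ z, G z * Complex.exp (t * z * Complex.I) ∂(gaussianReal 0 1)) :
    MultBound (fun n => m (r * n i)) (∫ z, ‖G z‖ ∂(gaussianReal 0 1)) := by
  refine MultBound.of_integral (gaussianReal 0 1) G hG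
    (fun z => Pi.single i ((r * z / (2 * Real.pi) : ℝ) : AddCircle (1 : ℝ))) ?_ fun n => ?_
  · have h : Continuous fun z : ℝ => (Pi.single i ((r * z / (2 * Real.pi) : ℝ) : AddCircle (1 : ℝ)) : Torus) := by
      refine (continuous_single i).comp ?_
      exact (AddCircle.continuous_mk' (1 : ℝ)).comp (by fun_prop)
    exact h.measurable
  · rw [hm]
    congr 1 with z
    congr 1
    have h1 : UnitAddTorus.mFourier n (Pi.single i ((r * z / (2 * Real.pi) : ℝ) : AddCircle (1 : ℝ))) =
        fourier (n i) ((r * z / (2 * Real.pi) : ℝ) : AddCircle (1 : ℝ)) := by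
      simp only [UnitAddTorus.mFourier, ContinuousMap.coe_mk]
      rw [Finset.prod_eq_single i]
      · simp
      · intro b _ hb
        simp [Pi.single_eq_of_ne hb]
      · simp
    rw [h1, fourier_coe_apply]
    congr 1
    push_cast
    have : (Real.pi : ℂ) ≠ 0 := by exact_mod_cast Real.pi_ne_zero
    field_simp

open ProbabilityTheory in
lemma charFun_gaussian (t : ℝ) :
    charFun (gaussianReal 0 1) t = Complex.exp (-((t : ℂ) ^ 2 / 2)) := by
  rw [charFun_gaussianReal]; simp

lemma multBound_exp (r : ℝ) (i : Fin 2) :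
    MultBound (fun n => Complex.exp (-(((r * n i : ℝ) : ℂ) ^ 2 / 2))) 1 := by
  have := multBound_gaussian r i (fun _ => 1) (integrable_const _)
    (m := fun t => Complex.exp (-((t : ℂ) ^ 2 / 2))) (fun t => by
      rw [← charFun_gaussian, charFun_apply_real]
      simp)
  simpa using this

lemma hasDerivAt_gaussian (t : ℝ) : HasDerivAt (fun t : ℝ => Complex.exp (-((t : ℂ) ^ 2 / 2)))
    (-t * Complex.exp (-((t : ℂ) ^ 2 / 2))) t := by
  have h := (((Complex.ofRealCLM.hasDerivAt (x := t)).pow 2).div_const 2).neg.cexp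
  convert! h using 1
  simp
  ring

-- The second moment against a character is minus the second derivative of the characteristic
-- function.
open ProbabilityTheory in
lemma integral_sq_mul_exp (t : ℝ) :
    ∫ z, (z : ℂ) ^ 2 * Complex.exp (t * z * Complex.I) ∂(gaussianReal 0 1) =
      (1 - (t : ℂ) ^ 2) * Complex.exp (-((t : ℂ) ^ 2 / 2)) := by
  have h := iteratedDeriv_charFun (μ := gaussianReal 0 1) (n := 2) (t := t)
    (memLp_id_gaussianReal' _ (by simp))
  have h1 : charFun (gaussianReal 0 1) = fun t : ℝ => Complex.exp (-((t : ℂ) ^ 2 / 2)) :=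
    funext charFun_gaussian
  have h2 : deriv (fun t : ℝ => Complex.exp (-((t : ℂ) ^ 2 / 2))) =
      fun t : ℝ => -(t : ℂ) * Complex.exp (-((t : ℂ) ^ 2 / 2)) :=
    funext fun t => (hasDerivAt_gaussian t).deriv
  have h3 : HasDerivAt (fun t : ℝ => -(t : ℂ) * Complex.exp (-((t : ℂ) ^ 2 / 2)))
      (-1 * Complex.exp (-((t : ℂ) ^ 2 / 2)) + -(t : ℂ) * (-t * Complex.exp (-((t : ℂ) ^ 2 / 2)))) t :=
    (Complex.ofRealCLM.hasDerivAt (x := t)).neg.mul (hasDerivAt_gaussian t)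
  rw [iteratedDeriv_succ, iteratedDeriv_one, h1, h2, h3.deriv, Complex.I_sq] at h
  linear_combination h

-- The symbol is the characteristic function weighted by `1 - z ^ 2`, and the Gaussian `L¹` norm of
-- this weight is at most `1 + 1`.
open ProbabilityTheory in
lemma multBound_sq_mul_exp (r : ℝ) (i : Fin 2) :
    MultBound (fun n => ((r * n i : ℝ) : ℂ) ^ 2 * Complex.exp (-(((r * n i : ℝ) : ℂ) ^ 2 / 2))) 2 := by
  have hsq : Integrable (fun z : ℝ => z ^ 2) (gaussianReal 0 1) :=
    (memLp_id_gaussianReal' 2 (by simp)).integrable_sq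
  have hsq' : Integrable (fun z : ℝ => (z : ℂ) ^ 2) (gaussianReal 0 1) := by
    simpa using hsq.ofReal (𝕜 := ℂ)
  have hsqint : ∫ z, z ^ 2 ∂(gaussianReal 0 1) = 1 := by
    have h := variance_of_integral_eq_zero (X := id) (μ := gaussianReal 0 1) aemeasurable_id
      (by simp)
    rw [variance_id_gaussianReal] at h
    simpa using h.symm
  have h := multBound_gaussian r i (fun z => 1 - (z : ℂ) ^ 2) ((integrable_const 1).sub hsq')
    (m := fun t => (t : ℂ) ^ 2 * Complex.exp (-((t : ℂ) ^ 2 / 2))) (fun t => by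
      have hb : ∀ z : ℝ, ‖Complex.exp (t * z * Complex.I)‖ ≤ 1 := fun z => by
        rw [← Complex.ofReal_mul, Complex.norm_exp_ofReal_mul_I]
      have hm : AEStronglyMeasurable (fun z : ℝ => Complex.exp (t * z * Complex.I))
          (gaussianReal 0 1) := by
        refine Continuous.aestronglyMeasurable ?_; fun_prop
      simp only [sub_mul, one_mul]
      rw [integral_sub, integral_sq_mul_exp]
      · have h1 := charFun_gaussian t
        rw [charFun_apply_real] at h1
        rw [h1]; ring
      · simpa using (integrable_const (μ := gaussianReal 0 1) (1 : ℂ)).mul_bdd (c := 1) hm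
          (.of_forall hb)
      · exact hsq'.mul_bdd (c := 1) hm (.of_forall hb))
  refine h.mono ?_
  calc ∫ z : ℝ, ‖1 - (z : ℂ) ^ 2‖ ∂(gaussianReal 0 1)
      ≤ ∫ z : ℝ, (1 + z ^ 2) ∂(gaussianReal 0 1) := by
        refine integral_mono ((integrable_const 1).sub hsq').norm ((integrable_const 1).add hsq)
          fun z => ?_
        refine (norm_sub_le _ _).trans ?_
        simp
    _ = 2 := by
        rw [integral_add (integrable_const 1) hsq, hsqint]; simp; norm_num

lemma lam_mul_eq {τ : ℝ} (hτ : 0 ≤ τ) (n : Freq) :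
    lam n * τ = (2 * Real.pi * Real.sqrt (2 * τ) * n 0) ^ 2 / 2 +
      (2 * Real.pi * Real.sqrt (2 * τ) * n 1) ^ 2 / 2 := by
  have h : Real.sqrt (2 * τ) ^ 2 = 2 * τ := Real.sq_sqrt (by positivity)
  have h' : freqNorm n ^ 2 = (n 0 : ℝ) ^ 2 + (n 1 : ℝ) ^ 2 := Real.sq_sqrt (by positivity)
  simp only [lam, mul_pow, h, h']
  ring

lemma exp_lam_eq {τ : ℝ} (hτ : 0 ≤ τ) (n : Freq) :
    (Real.exp (-(lam n * τ)) : ℂ) =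
      Complex.exp (-(((2 * Real.pi * Real.sqrt (2 * τ) * n 0 : ℝ) : ℂ) ^ 2 / 2)) *
      Complex.exp (-(((2 * Real.pi * Real.sqrt (2 * τ) * n 1 : ℝ) : ℂ) ^ 2 / 2)) := by
  rw [lam_mul_eq hτ, neg_add, Real.exp_add]
  push_cast
  rfl

lemma multBound_heat {τ : ℝ} (hτ : 0 ≤ τ) :
    MultBound (fun n => (Real.exp (-(lam n * τ)) : ℂ)) 1 := by
  have h := (multBound_exp (2 * Real.pi * Real.sqrt (2 * τ)) 0).mul
    (multBound_exp (2 * Real.pi * Real.sqrt (2 * τ)) 1) zero_le_one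
  simpa only [exp_lam_eq hτ, mul_one] using h

lemma multBound_lam_mul_heat {τ : ℝ} (hτ : 0 ≤ τ) :
    MultBound (fun n => ((lam n * τ * Real.exp (-(lam n * τ)) : ℝ) : ℂ)) 2 := by
  set r := 2 * Real.pi * Real.sqrt (2 * τ) with hr
  have h := (((multBound_sq_mul_exp r 0).mul (multBound_exp r 1) zero_le_two).add
    ((multBound_exp r 0).mul (multBound_sq_mul_exp r 1) zero_le_one)).const_mul (1 / 2)
  convert! h using 1
  · ext n
    rw [Complex.ofReal_mul, exp_lam_eq hτ, lam_mul_eq hτ, ← hr]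
    push_cast
    ring
  · norm_num

/-- The symbol is four times the square of that of `multBound_lam_mul_heat` at time `τ / 2`, whence
`4 * 2 * 2`. -/
lemma multBound_sq_lam_mul_heat {τ : ℝ} (hτ : 0 ≤ τ) :
    MultBound (fun n => (((lam n * τ) ^ 2 * Real.exp (-(lam n * τ)) : ℝ) : ℂ)) 16 := by
  have h := ((multBound_lam_mul_heat (τ := τ / 2) (by positivity)).mul
    (multBound_lam_mul_heat (τ := τ / 2) (by positivity)) zero_le_two).const_mul 4
  convert! h using 1
  · ext n
    have : Real.exp (-(lam n * τ)) = Real.exp (-(lam n * (τ / 2))) * Real.exp (-(lam n * (τ / 2))) := by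
      rw [← Real.exp_add]; congr 1; ring
    rw [this]
    push_cast
    ring
  · norm_num

/-- Parabolic smoothing on Littlewood-Paley blocks. -/
lemma exists_multBound_dyadic_heat (T : ℝ) : ∃ C, 0 ≤ C ∧ ∀ j τ, 0 ≤ τ → τ ≤ T →
    MultBound (fun n => (dyadic j n : ℂ) * (Real.exp (-(lam n * τ)) : ℂ))
      (C / (1 + (4 ^ j * τ) ^ 2)) := by
  obtain ⟨C₁, hC₁, h₁⟩ := exists_multBound_dyadic
  obtain ⟨C₂, hC₂, h₂⟩ := exists_multBound_dyadic_div
  have key : ∀ j τ, 0 ≤ τ → MultBound (fun n => (dyadic j n : ℂ) * (Real.exp (-(lam n * τ)) : ℂ)) C₁ :=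
    fun j τ hτ => by simpa using (h₁ j).mul (multBound_heat hτ) hC₁
  -- One summand for each case below: `2 * C₁` when `4 ^ j * τ ≤ 1`, where the heat contraction
  -- suffices; `C₁ * (1 + T ^ 2)` for the block `j = 0`, which has no decay and uses `τ ≤ T`; `32 *
  -- C₂` in the smoothing regime.
  refine ⟨2 * C₁ + C₁ * (1 + T ^ 2) + 32 * C₂, by positivity, fun j τ hτ hτT => ?_⟩
  cases j with
  | zero =>
    refine (key 0 τ hτ).mono ?_
    rw [le_div_iff₀ (by positivity)]
    have : τ ^ 2 ≤ T ^ 2 := by gcongr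
    simp only [pow_zero, one_mul]
    nlinarith
  | succ j =>
    by_cases hle : 4 ^ (j + 1) * τ ≤ 1
    · refine (key _ τ hτ).mono ?_
      rw [le_div_iff₀ (by positivity)]
      have : (4 ^ (j + 1) * τ) ^ 2 ≤ 1 := pow_le_one₀ (by positivity) hle
      have : 0 ≤ C₁ * (1 + T ^ 2) := by positivity
      nlinarith
    · push Not at hle
      have hτ0 : 0 < τ := by
        rcases hτ.lt_or_eq with h | h
        · exact h
        · rw [← h] at hle; norm_num at hle
      have h := ((h₂ j).mul (multBound_sq_lam_mul_heat hτ) hC₂).const_mul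
        ((((4 : ℝ) ^ (j + 1) * τ) ^ 2)⁻¹ : ℝ)
      have heq : (fun n => (dyadic (j + 1) n : ℂ) * (Real.exp (-(lam n * τ)) : ℂ)) = fun n =>
          (((((4 : ℝ) ^ (j + 1) * τ) ^ 2)⁻¹ : ℝ) : ℂ) *
          (((dyadic (j + 1) n * (4 ^ (j + 1)) ^ 2 / lam n ^ 2 : ℝ) : ℂ) *
            (((lam n * τ) ^ 2 * Real.exp (-(lam n * τ)) : ℝ) : ℂ)) := by
        ext n
        by_cases h0 : dyadic (j + 1) n = 0
        · simp [h0]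
        · have h1 : lam n ≠ 0 := by
            have := le_lam h0
            have h4 : (1 : ℝ) < 4 ^ (j + 1) := one_lt_pow₀ (by norm_num) (by omega)
            linarith
          have h1' : (lam n : ℂ) ≠ 0 := by exact_mod_cast h1
          have hτ' : (τ : ℂ) ≠ 0 := by exact_mod_cast hτ0.ne'
          push_cast
          field_simp
      rw [heq]
      refine h.mono ?_
      have hx : 1 + (4 ^ (j + 1) * τ) ^ 2 ≤ 2 * (4 ^ (j + 1) * τ) ^ 2 := by nlinarith
      rw [le_div_iff₀ (by positivity), Complex.norm_real, Real.norm_of_nonneg (by positivity)]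
      set x := (4 : ℝ) ^ (j + 1) * τ
      have hx0 : 0 < x ^ 2 := by positivity
      calc (x ^ 2)⁻¹ * (C₂ * 16) * (1 + x ^ 2) ≤ (x ^ 2)⁻¹ * (C₂ * 16) * (2 * x ^ 2) := by gcongr
        _ = 32 * C₂ := by field_simp; ring
        _ ≤ _ := by
          have : 0 ≤ C₁ * (1 + T ^ 2) := by positivity
          linarith

/-- A multiplier with finitely many frequencies acts on all continuous functions. -/
lemma MultBound.norm_trig_fcoeff_le {m : Freq → ℂ} {C : ℝ} (h : MultBound m C) (s : Finset Freq)
    (hs : ∀ n ∉ s, m n = 0) (f : C(Torus, ℂ)) :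
    ‖trig s fun n => m n * fcoeff f n‖ ≤ C * ‖f‖ := by
  -- Both sides are continuous in `f` because only finitely many coefficients enter, so it suffices
  -- to check the dense set of trigonometric polynomials.
  have hc : IsClosed {f : C(Torus, ℂ) | ‖trig s fun n => m n * fcoeff f n‖ ≤ C * ‖f‖} := by
    refine isClosed_le (Continuous.norm ?_) (by fun_prop)
    refine continuous_finsetSum _ fun n _ => ?_
    refine Continuous.smul (M := ℂ) (continuous_const.mul ?_) continuous_const
    have hl : LipschitzWith 1 fun f : C(Torus, ℂ) => fcoeff f n := LipschitzWith.of_dist_le_mul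
      fun f g => by
        rw [dist_eq_norm, dist_eq_norm, NNReal.coe_one, one_mul, ← fcoeff_sub
          (integrable_of_continuous f.continuous) (integrable_of_continuous g.continuous)]
        exact norm_fcoeff_le (f - g) n
    exact hl.continuous
  have hd : Dense (Submodule.span ℂ (range (UnitAddTorus.mFourier (d := Fin 2))) :
      Set C(Torus, ℂ)) :=
    Submodule.dense_iff_topologicalClosure_eq_top.2 UnitAddTorus.span_mFourier_closure_eq_top
  refine hc.closure_subset_iff.2 ?_ (hd.closure_eq ▸ mem_univ f)
  intro f hf
  obtain ⟨c, rfl⟩ := (Finsupp.mem_span_range_iff_exists_finsupp).1 hf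
  have h1 : (c.sum fun i a => a • UnitAddTorus.mFourier i) = trig (c.support ∪ s) c := by
    refine (trig_subset (c := c) (t := c.support ∪ s) Finset.subset_union_left ?_)
    intro n _ hn
    simpa using hn
  simp only [mem_ofPred_eq]
  rw [h1]
  have h2 := h (c.support ∪ s) c
  convert! h2 using 2
  rw [← trig_subset (c := fun n => m n * c n)
    (Finset.subset_union_right (s₁ := c.support) (s₂ := s))]
  · refine trig_congr fun n hn => ?_
    rw [fcoeff_trig, if_pos (Finset.mem_union_right _ hn)]
  · intro n _ hn
    rw [hs n hn, zero_mul]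

end GPAM

namespace GPAM

/-! ### Littlewood-Paley theory -/

lemma block_neg (j : ℕ) (c : Coeffs) : block j (-c) = -block j c := by
  ext x; simp [block_apply, Finset.sum_neg_distrib]

lemma block_sub (j : ℕ) (c d : Coeffs) : block j (c - d) = block j c - block j d := by
  rw [sub_eq_add_neg, block_add, block_neg, sub_eq_add_neg]

lemma continuous_block (j : ℕ) : Continuous (block j) := by
  have h : block j = fun c => ∑ n ∈ freqBox j,
      ((dyadic j n : ℂ) * c n) • (UnitAddTorus.mFourier n : C(Torus, ℂ)) := by
    ext1 c; exact block_eq_trig j c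
  rw [h]
  refine continuous_finsetSum _ fun n _ => ?_
  exact Continuous.smul (M := ℂ) (continuous_const.mul (continuous_apply n)) continuous_const

lemma continuous_blockNorm (α : ℝ) (j : ℕ) : Continuous (blockNorm α j) :=
  continuous_const.mul (continuous_block j).norm

lemma blockNorm_sub_le (α : ℝ) (j : ℕ) (c d : Coeffs) :
    blockNorm α j (c - d) ≤ blockNorm α j c + blockNorm α j d := by
  unfold blockNorm
  rw [block_sub, ← mul_add]
  gcongr
  exact norm_sub_le _ _

lemma norm_dyadic_mul_le (j : ℕ) (c : Coeffs) (n : Freq) : |dyadic j n| * ‖c n‖ ≤ ‖block j c‖ := by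
  have h := norm_fcoeff_le (block j c) n
  rw [fcoeff_block, norm_mul, Complex.norm_real] at h
  exact h

/-- Fourier coefficients at a fixed frequency, as a continuous linear form. -/
noncomputable def fcoeffL (n : Freq) : C(Torus, ℂ) →L[ℂ] ℂ :=
  LinearMap.mkContinuous
    { toFun := fun f => fcoeff f n
      map_add' := fun f g => fcoeff_add (integrable_of_continuous f.continuous)
        (integrable_of_continuous g.continuous) n
      map_smul' := fun z f => fcoeff_const_mul z f n } 1 fun f => by
        rw [one_mul]; exact norm_fcoeff_le f n

lemma fcoeffL_apply (n : Freq) (f : C(Torus, ℂ)) : fcoeffL n f = fcoeff f n := rfl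

lemma hasSum_dyadic (n : Freq) : HasSum (fun j => dyadic j n) 1 := by
  obtain ⟨J, hJ⟩ := pow_unbounded_of_one_lt (freqNorm n) one_lt_two
  have h := hasSum_sum_of_ne_finset_zero (L := .unconditional _) (f := fun j => dyadic j n)
    (s := Finset.range (J + 1)) (fun j hj => by
      simp only [Finset.mem_range, not_lt] at hj
      obtain ⟨i, rfl⟩ := Nat.exists_eq_add_of_lt (Nat.lt_of_succ_le hj)
      exact dyadic_succ_eq_zero (hJ.le.trans (pow_le_pow_right₀ (by norm_num) (by omega))))
  rwa [sum_dyadic, lowPass_eq_one hJ.le] at h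

lemma fcoeff_conj (f : Torus → ℂ) (n : Freq) :
    fcoeff (fun x => starRingEnd ℂ (f x)) n = starRingEnd ℂ (fcoeff f (-n)) := by
  unfold fcoeff
  rw [← integral_conj]
  congr 1 with x
  simp [UnitAddTorus.mFourier_neg]

/-- A continuous function with hermitian Fourier coefficients is real. -/
lemma ofReal_re_eq {f : C(Torus, ℂ)} (h : ∀ n, fcoeff f (-n) = starRingEnd ℂ (fcoeff f n))
    (x : Torus) : ((f x).re : ℂ) = f x := by
  have h1 : (⟨fun x => starRingEnd ℂ (f x), by fun_prop⟩ : C(Torus, ℂ)) = f := by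
    refine eq_of_fcoeff_eq fun n => ?_
    refine (fcoeff_conj f n).trans ?_
    rw [h, Complex.conj_conj]
  exact Complex.conj_eq_iff_re.1 (congrArg (fun g : C(Torus, ℂ) => g x) h1)

/-- The real part of a continuous function. -/
noncomputable def rePart (f : C(Torus, ℂ)) : C(Torus, ℝ) := ⟨fun x => (f x).re, by fun_prop⟩

lemma coeff_rePart {f : C(Torus, ℂ)} (h : ∀ n, fcoeff f (-n) = starRingEnd ℂ (fcoeff f n)) :
    coeff (rePart f) = fcoeff f := by
  rw [coeff_eq_fcoeff]
  congr 1
  ext x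
  exact ofReal_re_eq h x

lemma norm_rePart_le (f : C(Torus, ℂ)) : ‖rePart f‖ ≤ ‖f‖ :=
  (ContinuousMap.norm_le _ (norm_nonneg _)).2 fun x =>
    (Complex.abs_re_le_norm _).trans (f.norm_coe_le_norm x)

/-- The continuous function with given hermitian coefficients and summable blocks. -/
lemma exists_coeff_eq {c : Coeffs} (hc : ∀ n, c (-n) = starRingEnd ℂ (c n))
    (hs : Summable fun j => ‖block j c‖) :
    ∃ f : C(Torus, ℝ), coeff f = c ∧ ‖f‖ ≤ ∑' j, ‖block j c‖ := by
  have hf : ∀ n, fcoeff (∑' j, block j c : C(Torus, ℂ)) n = c n := fun n => by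
    have h1 := (fcoeffL n).hasSum hs.of_norm.hasSum
    have h2 : (fun j => fcoeffL n (block j c)) = fun j => (dyadic j n : ℂ) * c n := by
      ext j; rw [fcoeffL_apply, fcoeff_block]
    have h3 := (Complex.hasSum_ofReal.2 (hasSum_dyadic n)).mul_right (c n)
    rw [Complex.ofReal_one, one_mul] at h3
    rw [← fcoeffL_apply]
    refine h1.unique ?_
    simpa [Function.comp_def, fcoeffL_apply, fcoeff_block] using h3
  refine ⟨rePart (∑' j, block j c), ?_, ?_⟩
  · rw [coeff_rePart fun n => by rw [hf, hf, hc]]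
    exact funext hf
  · exact (norm_rePart_le _).trans (norm_tsum_le_tsum_norm hs)

lemma norm_block_le_of_blockNorm_le {α M : ℝ} {j : ℕ} {c : Coeffs} (h : blockNorm α j c ≤ M) :
    ‖block j c‖ ≤ M * ((2 : ℝ) ^ (-α)) ^ j := by
  have h2 : ((2 : ℝ) ^ (-α)) ^ j = ((2 : ℝ) ^ (α * j))⁻¹ := by
    rw [← Real.rpow_natCast, ← Real.rpow_mul (by norm_num), ← Real.rpow_neg (by norm_num)]
    congr 1; ring
  rw [h2, ← div_eq_mul_inv, le_div_iff₀ (by positivity), mul_comm]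
  exact h

lemma two_rpow_neg_lt_one {α : ℝ} (hα : 0 < α) : (2 : ℝ) ^ (-α) < 1 :=
  Real.rpow_lt_one_of_one_lt_of_neg one_lt_two (by linarith)

lemma summable_norm_block {α M : ℝ} (hα : 0 < α) {c : Coeffs} (h : ∀ j, blockNorm α j c ≤ M) :
    Summable fun j => ‖block j c‖ :=
  Summable.of_nonneg_of_le (fun _ => norm_nonneg _)
    (fun j => norm_block_le_of_blockNorm_le (h j))
    ((summable_geometric_of_lt_one (by positivity) (two_rpow_neg_lt_one hα)).mul_left M)

lemma tsum_norm_block_le {α M : ℝ} (hα : 0 < α) {c : Coeffs} (h : ∀ j, blockNorm α j c ≤ M) :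
    ∑' j, ‖block j c‖ ≤ (1 - (2 : ℝ) ^ (-α))⁻¹ * M := by
  have hg := summable_geometric_of_lt_one (by positivity) (two_rpow_neg_lt_one hα)
  refine ((summable_norm_block hα h).tsum_le_tsum
    (fun j => norm_block_le_of_blockNorm_le (h j)) (hg.mul_left M)).trans ?_
  rw [tsum_mul_left, tsum_geometric_of_lt_one (by positivity) (two_rpow_neg_lt_one hα), mul_comm]

/-! ### Completeness of `Besov α` -/

namespace Besov

variable {α : ℝ}

/-- An element of `C^α` from its Fourier coefficients. -/
def ofCoeffs (c : Coeffs) (hc : c ∈ besovSubmodule α) : Besov α :=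
  (⟨c, hc⟩ : besovSubmodule α)

lemma toCoeffs_ofCoeffs (c : Coeffs) (hc : c ∈ besovSubmodule α) :
    toCoeffs (ofCoeffs c hc) = c := rfl

lemma toCoeffs_neg (c : Besov α) (n : Freq) :
    toCoeffs c (-n) = starRingEnd ℂ (toCoeffs c n) := c.2.1 n

lemma norm_le {c : Besov α} {M : ℝ} (h : ∀ j, blockNorm α j (toCoeffs c) ≤ M) : ‖c‖ ≤ M :=
  ciSup_le h

lemma exists_norm_toCoeffs_le (α : ℝ) (n : Freq) : ∃ C, ∀ c : Besov α, ‖toCoeffs c n‖ ≤ C * ‖c‖ := by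
  obtain ⟨j, hj⟩ := exists_dyadic_ne_zero n
  refine ⟨|dyadic j n|⁻¹ * ((2 : ℝ) ^ (-α)) ^ j, fun c => ?_⟩
  have h := (norm_dyadic_mul_le j (toCoeffs c) n).trans
    (norm_block_le_of_blockNorm_le (blockNorm_le c j))
  rw [mul_assoc, inv_mul_eq_div, le_div_iff₀ (abs_pos.2 hj)]
  linarith

/-- Coefficients of a Cauchy sequence converge one by one. Each block depends continuously on
finitely many of them, so the Cauchy bounds pass to the limit uniformly in `j`; this uniformity also
gives the vanishing tail of the limit. -/
instance : CompleteSpace (Besov α) := by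
  refine Metric.complete_of_cauchySeq_tendsto fun u hu => ?_
  have hlim : ∀ n, ∃ z, Tendsto (fun k => toCoeffs (u k) n) atTop (𝓝 z) := fun n => by
    obtain ⟨C, hC⟩ := exists_norm_toCoeffs_le α n
    refine cauchySeq_tendsto_of_complete ?_
    have hl : LipschitzWith (Real.toNNReal C) fun c : Besov α => toCoeffs c n :=
      LipschitzWith.of_dist_le_mul fun c d => by
        rw [dist_eq_norm, dist_eq_norm, ← Pi.sub_apply, ← map_sub]
        exact (hC _).trans (by gcongr; exact Real.le_coe_toNNReal C)
    exact hl.uniformContinuous.comp_cauchySeq hu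
  choose z hz using hlim
  have hz' : Tendsto (fun k => toCoeffs (u k)) atTop (𝓝 z) := tendsto_pi_nhds.2 hz
  have key : ∀ ε > 0, ∃ N, ∀ k ≥ N, ∀ j, blockNorm α j (toCoeffs (u k) - z) ≤ ε := fun ε hε => by
    obtain ⟨N, hN⟩ := Metric.cauchySeq_iff.1 hu ε hε
    refine ⟨N, fun k hk j => ?_⟩
    refine le_of_tendsto (((continuous_blockNorm α j).tendsto _).comp
      (tendsto_const_nhds.sub hz')) ?_
    filter_upwards [eventually_ge_atTop N] with l hl
    have h := blockNorm_le (u k - u l) j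
    rw [map_sub] at h
    exact h.trans ((dist_eq_norm (u k) (u l)) ▸ (hN k hk l hl).le)
  have hzmem : z ∈ besovSubmodule α := by
    refine ⟨fun n => ?_, ?_⟩
    · refine tendsto_nhds_unique (hz (-n)) ?_
      have : (fun k => toCoeffs (u k) (-n)) = fun k => starRingEnd ℂ (toCoeffs (u k) n) :=
        funext fun k => (u k).2.1 n
      rw [this]
      exact (Complex.continuous_conj.tendsto _).comp (hz n)
    · refine (Metric.tendsto_atTop).2 fun ε hε => ?_
      obtain ⟨N, hN⟩ := key (ε / 2) (half_pos hε)
      obtain ⟨J, hJ⟩ := (Metric.tendsto_atTop.1 (u N).2.2) (ε / 2) (half_pos hε)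
      refine ⟨J, fun j hj => ?_⟩
      have h1 := hJ j hj
      have h2 := hN N le_rfl j
      have h3 := blockNorm_sub_le α j (toCoeffs (u N)) (toCoeffs (u N) - z)
      rw [sub_sub_cancel] at h3
      rw [Real.dist_eq, sub_zero, abs_of_nonneg (blockNorm_nonneg _ _ _)] at h1 ⊢
      have h4 : blockNorm α j (toCoeffs (u N)) < ε / 2 := h1
      linarith
  refine ⟨ofCoeffs z hzmem, ?_⟩
  refine Metric.tendsto_atTop.2 fun ε hε => ?_
  obtain ⟨N, hN⟩ := key (ε / 2) (half_pos hε)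
  refine ⟨N, fun k hk => ?_⟩
  rw [dist_eq_norm]
  refine lt_of_le_of_lt (norm_le (M := ε / 2) fun j => ?_) (half_lt_self hε)
  rw [map_sub, toCoeffs_ofCoeffs]
  exact hN k hk j

end Besov

/-! ### Positive regularity: distributions that are continuous functions -/

namespace Hol

variable {α : ℝ}

lemma coeff_toC (f : Hol α) : coeff (toC f) = Besov.toCoeffs (toBesov f) := rfl

lemma norm_toBesov (f : Hol α) : ‖toBesov f‖ = ‖f‖ := rfl

lemma blockNorm_le (f : Hol α) (j : ℕ) : blockNorm α j (coeff (toC f)) ≤ ‖f‖ :=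
  Besov.blockNorm_le (toBesov f) j

lemma norm_le {f : Hol α} {M : ℝ} (h : ∀ j, blockNorm α j (coeff (toC f)) ≤ M) : ‖f‖ ≤ M :=
  Besov.norm_le (c := toBesov f) h

lemma coeff_toC_sub (f g : Hol α) : coeff (toC (f - g)) = coeff (toC f) - coeff (toC g) := by
  rw [coeff_toC, map_sub, map_sub]; rfl

lemma coeff_toC_smul (r : ℝ) (f : Hol α) : coeff (toC (r • f)) = r • coeff (toC f) := by
  rw [coeff_toC, map_smul, map_smul]; rfl

lemma coeff_toC_add (f g : Hol α) : coeff (toC (f + g)) = coeff (toC f) + coeff (toC g) := by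
  rw [coeff_toC, map_add, map_add]; rfl

lemma ext_coeff {f g : Hol α} (h : coeff (toC f) = coeff (toC g)) : f = g :=
  toBesov_injective (Subtype.ext h)

lemma exists_coeff_toC_eq (hα : 0 < α) {c : Coeffs} (hc : c ∈ besovSubmodule α) :
    ∃ f : Hol α, coeff (toC f) = c := by
  let d : Besov α := Besov.ofCoeffs c hc
  obtain ⟨f, hf, -⟩ := exists_coeff_eq hc.1 (summable_norm_block hα fun j => d.blockNorm_le j)
  exact ⟨(⟨f, by
    rw [Submodule.mem_comap]
    exact (show coeffC f = c from hf) ▸ hc⟩ : (besovSubmodule α).comap coeffC), hf⟩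

lemma norm_toC_le (hα : 0 < α) (f : Hol α) : ‖toC f‖ ≤ (1 - (2 : ℝ) ^ (-α))⁻¹ * ‖f‖ := by
  have hb := blockNorm_le f
  obtain ⟨g, hg, hg'⟩ := exists_coeff_eq (toBesov f).2.1
    (summable_norm_block hα hb)
  have : toC f = g := coeffC_injective hg.symm
  rw [this]
  exact hg'.trans (tsum_norm_block_le hα hb)

/-- For `α > 0` the isometry `toBesov` is onto, since the blocks sum in the sup norm; completeness
is then that of `Besov α`. -/
lemma completeSpace (hα : 0 < α) : CompleteSpace (Hol α) := by
  have hi : Isometry (toBesov (α := α)) :=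
    AddMonoidHomClass.isometry_of_norm _ norm_toBesov
  refine (hi.isUniformInducing.completeSpace_congr fun c => ?_).2 inferInstance
  obtain ⟨f, hf⟩ := exists_coeff_toC_eq hα c.2
  exact ⟨f, Subtype.ext hf⟩

/-- The embedding of `C^α`, `α > 0`, into the continuous functions. -/
noncomputable def toCL (hα : 0 < α) : Hol α →L[ℝ] C(Torus, ℝ) :=
  LinearMap.mkContinuous toC _ (norm_toC_le hα)

end Hol

/-! ### Smooth truncation of frequencies -/

/-- The coefficients of the smooth truncation at frequency `2^J`. -/
noncomputable def truncC (J : ℕ) (c : Coeffs) : Coeffs := fun n => (lowPass J n : ℂ) * c n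

lemma lowPass_eq_zero_of_notMem {J : ℕ} {n : Freq} (h : n ∉ freqBox J) : lowPass J n = 0 := by
  refine lowPass_eq_zero ?_
  by_contra! hlt
  apply h
  simp only [freqBox, Fintype.mem_piFinset, Finset.mem_Icc]
  intro i
  have := abs_le.1 ((abs_le_freqNorm n i).trans hlt.le)
  exact ⟨by exact_mod_cast this.1, by exact_mod_cast this.2⟩

lemma freqNorm_lt_of_dyadic_ne_zero {j : ℕ} {n : Freq} (h : dyadic j n ≠ 0) :
    freqNorm n < 2 ^ (j + 1) := by
  by_contra! h'
  apply h
  cases j with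
  | zero => exact lowPass_eq_zero h'
  | succ j =>
    show lowPass (j + 1) n - lowPass j n = 0
    rw [lowPass_eq_zero h', lowPass_eq_zero (le_trans ?_ h'), sub_zero]
    exact pow_le_pow_right₀ (by norm_num) (by omega)

lemma lowPass_neg (J : ℕ) (n : Freq) : lowPass J (-n) = lowPass J n := by
  simp [lowPass, freqNorm_neg]

lemma block_truncC_of_lt {j J : ℕ} (h : j < J) (c : Coeffs) : block j (truncC J c) = block j c := by
  rw [block_eq_trig, block_eq_trig]
  refine trig_congr fun n _ => ?_
  by_cases h0 : dyadic j n = 0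
  · simp [h0]
  · rw [truncC, lowPass_eq_one, Complex.ofReal_one, one_mul]
    exact (freqNorm_lt_of_dyadic_ne_zero h0).le.trans (pow_le_pow_right₀ (by norm_num) (by omega))

lemma block_truncC_of_le {j J : ℕ} (h : J + 2 ≤ j) (c : Coeffs) : block j (truncC J c) = 0 := by
  rw [block_eq_trig]
  ext x
  rw [trig_apply]
  refine Finset.sum_eq_zero fun n _ => ?_
  obtain ⟨i, rfl⟩ : ∃ i, j = i + 1 := ⟨j - 1, by omega⟩
  by_cases h0 : dyadic (i + 1) n = 0
  · simp [h0]
  · have : (2 : ℝ) ^ (J + 1) ≤ freqNorm n := by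
      by_contra! h1
      refine h0 (dyadic_succ_eq_zero (h1.le.trans (pow_le_pow_right₀ (by norm_num) (by omega))))
    simp [truncC, lowPass_eq_zero this]

lemma exists_norm_block_truncC_le : ∃ C, 0 ≤ C ∧ ∀ J j c, ‖block j (truncC J c)‖ ≤ C * ‖block j c‖ := by
  obtain ⟨C, hC, h⟩ := exists_multBound_lowPass
  refine ⟨C, hC, fun J j c => ?_⟩
  convert! h J (freqBox j) fun n => (dyadic j n : ℂ) * c n using 2
  · rw [block_eq_trig]
    refine trig_congr fun n _ => ?_
    simp only [truncC]; ring
  · rw [block_eq_trig]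

lemma truncC_mem {α : ℝ} (J : ℕ) {c : Coeffs} (hc : ∀ n, c (-n) = starRingEnd ℂ (c n)) :
    truncC J c ∈ besovSubmodule α := by
  refine ⟨fun n => by simp [truncC, lowPass_neg, hc], ?_⟩
  refine tendsto_const_nhds.congr' ?_
  filter_upwards [eventually_ge_atTop (J + 2)] with j hj
  rw [blockNorm, block_truncC_of_le hj, norm_zero, mul_zero]

/-- The truncation error lives in the blocks `j ≥ J` and is no larger there than the function
itself, up to a constant independent of `J`. Both the density of `L²` in `B` and the compactness
argument use it. -/
lemma exists_blockNorm_sub_truncC_le : ∃ C, 0 ≤ C ∧ ∀ α J j c,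
    (j < J → blockNorm α j (c - truncC J c) = 0) ∧
    blockNorm α j (c - truncC J c) ≤ C * blockNorm α j c := by
  obtain ⟨C, hC, h⟩ := exists_norm_block_truncC_le
  refine ⟨1 + C, by positivity, fun α J j c => ⟨fun hj => ?_, ?_⟩⟩
  · rw [blockNorm, block_sub, block_truncC_of_lt hj, sub_self, norm_zero, mul_zero]
  · unfold blockNorm
    rw [block_sub, mul_left_comm]
    gcongr
    refine (norm_sub_le _ _).trans ?_
    rw [add_mul, one_mul]
    gcongr
    exact h J j c

/-- The smooth truncation at frequency `2^J`, a real trigonometric polynomial. -/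
noncomputable def truncFun (J : ℕ) (c : Coeffs) : C(Torus, ℝ) :=
  rePart (trig (freqBox J) (truncC J c))

lemma fcoeff_trig_truncC (J : ℕ) (c : Coeffs) :
    fcoeff (trig (freqBox J) (truncC J c)) = truncC J c := by
  ext n
  rw [fcoeff_trig]
  split_ifs with h
  · rfl
  · simp [truncC, lowPass_eq_zero_of_notMem h]

lemma coeff_truncFun (J : ℕ) {c : Coeffs} (hc : ∀ n, c (-n) = starRingEnd ℂ (c n)) :
    coeff (truncFun J c) = truncC J c := by
  rw [truncFun, coeff_rePart, fcoeff_trig_truncC]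
  intro n
  rw [fcoeff_trig_truncC]
  exact (truncC_mem (α := 0) J hc).1 n

/-- A continuous function as an element of the Cameron-Martin space. -/
noncomputable def toCM : C(Torus, ℝ) →L[ℝ] CM := ContinuousMap.toLp 2 torusMeasure ℝ

lemma coeFn_toCM (f : C(Torus, ℝ)) : toCM f =ᵐ[torusMeasure] f :=
  ContinuousMap.coeFn_toLp torusMeasure f

lemma coeff_toCM (f : C(Torus, ℝ)) : coeff (toCM f) = coeff f := coeff_congr (coeFn_toCM f)

/-! ### The embedding of `L²` into `B`: density and decay of blocks -/

section EmbB

variable {κ : ℝ} (hκ : 0 < κ)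

lemma toCoeffs_embB (k : CM) : Besov.toCoeffs (embB hκ k) = coeff k := rfl

/-- Smooth truncations lie in `L²` and converge because the weighted blocks of an element of `Besov`
tend to zero. In the full space `B^α_{∞,∞}`, where this fails, the argument would not apply. -/
lemma denseRange_embB : DenseRange (embB hκ) := by
  obtain ⟨C, hC, h⟩ := exists_blockNorm_sub_truncC_le
  refine Metric.denseRange_iff.2 fun c ε hε => ?_
  have hlim : Tendsto (fun j => blockNorm (-1 - κ) j (Besov.toCoeffs c)) atTop (𝓝 0) := c.2.2
  obtain ⟨J, hJ⟩ := eventually_atTop.1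
    (hlim.eventually_lt_const (show 0 < ε / 2 / (C + 1) by positivity))
  refine ⟨toCM (truncFun J (Besov.toCoeffs c)), ?_⟩
  rw [dist_eq_norm]
  refine lt_of_le_of_lt (Besov.norm_le (M := ε / 2) fun j => ?_) (half_lt_self hε)
  rw [map_sub, toCoeffs_embB, coeff_toCM, coeff_truncFun J (Besov.toCoeffs_neg c)]
  obtain ⟨h1, h2⟩ := h (-1 - κ) J j (Besov.toCoeffs c)
  rcases lt_or_ge j J with hj | hj
  · rw [h1 hj]; positivity
  · refine h2.trans ?_
    have h3 := (hJ j hj).le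
    rw [le_div_iff₀ (by positivity)] at h3
    nlinarith [blockNorm_nonneg (-1 - κ) j (Besov.toCoeffs c)]

lemma integral_sq_CM (k : CM) : ∫ x, ‖(k x : ℂ)‖ ^ 2 ∂torusMeasure = ‖k‖ ^ 2 := by
  rw [← real_inner_self_eq_norm_sq, L2.inner_def]
  refine integral_congr_ae (.of_forall fun x => ?_)
  simp [sq]

lemma sum_sq_coeff_le (k : CM) (s : Finset Freq) : ∑ n ∈ s, ‖coeff k n‖ ^ 2 ≤ ‖k‖ ^ 2 := by
  rw [← integral_sq_CM]
  exact sum_sq_fcoeff_le (memLp_ofReal k) s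

lemma norm_block_coeff_le (k : CM) (j : ℕ) : ‖block j (coeff k)‖ ≤ 5 * 2 ^ j * ‖k‖ := by
  simpa [Real.sqrt_sq] using norm_block_le k (sum_sq_coeff_le k) j

lemma two_rpow_mul_nat (α : ℝ) (j : ℕ) : (2 : ℝ) ^ (α * j) = ((2 : ℝ) ^ α) ^ j := by
  rw [← Real.rpow_natCast, ← Real.rpow_mul (by norm_num)]

/-- Bernstein's inequality uses up one of the `1 + κ` derivatives granted by `B`. The remaining `κ`
becomes geometric decay in `j`, which later yields compactness. -/
lemma blockNorm_coeff_le (κ : ℝ) (k : CM) (j : ℕ) :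
    blockNorm (-1 - κ) j (coeff k) ≤ 5 * ‖k‖ * ((2 : ℝ) ^ (-κ)) ^ j := by
  calc blockNorm (-1 - κ) j (coeff k)
      ≤ (2 : ℝ) ^ ((-1 - κ) * j) * (5 * 2 ^ j * ‖k‖) := by
        unfold blockNorm
        gcongr
        exact norm_block_coeff_le k j
    _ = 5 * ‖k‖ * ((2 : ℝ) ^ (-κ)) ^ j := by
        rw [← two_rpow_mul_nat,
          show (-1 - κ) * (j : ℝ) = -κ * j - j by ring, Real.rpow_sub (by norm_num),
          Real.rpow_natCast]
        field_simp

lemma norm_embB_le (k : CM) : ‖embB hκ k‖ ≤ 5 * ‖k‖ :=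
  Besov.norm_le fun j => (blockNorm_coeff_le κ k j).trans <|
    mul_le_of_le_one_right (by positivity)
      (pow_le_one₀ (by positivity) (two_rpow_neg_lt_one hκ).le)

end EmbB

end GPAM

namespace GPAM

/-! ### The Duhamel operator -/

lemma coeff_norm_le (k : CM) (n : Freq) : ‖coeff k n‖ ≤ ‖k‖ := by
  have h := sum_sq_coeff_le k {n}
  rw [Finset.sum_singleton] at h
  exact (pow_le_pow_iff_left₀ (norm_nonneg _) (norm_nonneg _) two_ne_zero).1 h

/-- Fourier coefficients of square integrable functions, as continuous linear forms. -/
noncomputable def coeffL (n : Freq) : CM →L[ℝ] ℂ :=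
  LinearMap.mkContinuous
    ((LinearMap.proj n).comp (Besov.toCoeffs.comp (embB one_pos))) 1 fun k => by
      rw [one_mul]; exact coeff_norm_le k n

lemma coeffL_apply (n : Freq) (k : CM) : coeffL n k = coeff k n := rfl

lemma coeff_sub_CM (k l : CM) : coeff (k - l : CM) = coeff k - coeff l :=
  map_sub (Besov.toCoeffs.comp (embB one_pos)) k l

lemma coeff_add_CM (k l : CM) : coeff (k + l : CM) = coeff k + coeff l :=
  map_add (Besov.toCoeffs.comp (embB one_pos)) k l

lemma coeff_smul_CM (r : ℝ) (k : CM) : coeff (r • k : CM) = r • coeff k :=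
  map_smul (Besov.toCoeffs.comp (embB one_pos)) r k

lemma norm_dyadic_heat_le (j : ℕ) {τ : ℝ} (hτ : 0 ≤ τ) (c : Coeffs) (n : Freq) :
    ‖(dyadic j n : ℂ) * heat τ c n‖ ≤ Real.exp (-((4 ^ j - 1) * τ)) * ‖c n‖ := by
  by_cases h0 : dyadic j n = 0
  · rw [h0, Complex.ofReal_zero, zero_mul, norm_zero]; positivity
  rw [heat_apply, norm_mul, norm_mul, Complex.norm_real, Complex.norm_real, Real.norm_eq_abs,
    Real.norm_of_nonneg (Real.exp_pos _).le]
  have h1 : Real.exp (-(lam n * τ)) ≤ Real.exp (-((4 ^ j - 1) * τ)) := by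
    gcongr
    exact le_lam h0
  calc |dyadic j n| * (Real.exp (-(lam n * τ)) * ‖c n‖)
      ≤ 1 * (Real.exp (-((4 ^ j - 1) * τ)) * ‖c n‖) := by
        gcongr
        exact abs_dyadic_le j n
    _ = _ := one_mul _

lemma sum_sq_dyadic_heat_le (j : ℕ) {τ : ℝ} (hτ : 0 ≤ τ) {c : Coeffs} {M : ℝ} (s : Finset Freq)
    (hc : ∑ n ∈ s, ‖c n‖ ^ 2 ≤ M ^ 2) :
    ∑ n ∈ s, ‖(dyadic j n : ℂ) * heat τ c n‖ ^ 2 ≤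
      (Real.exp (-((4 ^ j - 1) * τ)) * M) ^ 2 := by
  calc ∑ n ∈ s, ‖(dyadic j n : ℂ) * heat τ c n‖ ^ 2
      ≤ ∑ n ∈ s, (Real.exp (-((4 ^ j - 1) * τ)) * ‖c n‖) ^ 2 := by
        gcongr with n _
        exact norm_dyadic_heat_le j hτ c n
    _ ≤ _ := by
        simp only [mul_pow, ← Finset.mul_sum]
        gcongr

lemma norm_block_heat_le_of_sum (j : ℕ) {τ : ℝ} (hτ : 0 ≤ τ) {c : Coeffs} {M : ℝ} (hM : 0 ≤ M)
    (hc : ∑ n ∈ freqBox j, ‖c n‖ ^ 2 ≤ M ^ 2) :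
    ‖block j (heat τ c)‖ ≤ Real.exp (-((4 ^ j - 1) * τ)) * (5 * 2 ^ j * M) := by
  rw [block_eq_trig]
  refine (norm_trig_le_sqrt _ _).trans ?_
  have h2 := Real.sqrt_le_sqrt (sum_sq_dyadic_heat_le j hτ _ hc)
  rw [Real.sqrt_sq (by positivity)] at h2
  refine (mul_le_mul (sqrt_card_freqBox_le j) h2 (by positivity) (by positivity)).trans (le_of_eq ?_)
  ring

lemma norm_block_heat_le (j : ℕ) {τ : ℝ} (hτ : 0 ≤ τ) (k : CM) :
    ‖block j (heat τ (coeff k))‖ ≤ Real.exp (-((4 ^ j - 1) * τ)) * (5 * 2 ^ j * ‖k‖) :=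
  norm_block_heat_le_of_sum j hτ (norm_nonneg _) (sum_sq_coeff_le k _)

lemma lam_neg (n : Freq) : lam (-n) = lam n := by simp [lam, freqNorm_neg]

lemma integral_exp_le {a : ℝ} (ha : 0 < a) {t : ℝ} :
    ∫ s in (0 : ℝ)..t, Real.exp (-(a * (t - s))) ≤ 1 / a := by
  have h : ∀ s ∈ uIcc 0 t, HasDerivAt (fun s => Real.exp (-(a * (t - s))) / a)
      (Real.exp (-(a * (t - s)))) s := fun s _ => by
    have h1 : HasDerivAt (fun s => -(a * (t - s))) a s := by
      have := (((hasDerivAt_id s).const_sub t).const_mul a).neg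
      convert! this using 1
      ring
    have h2 := h1.exp.div_const a
    convert! h2 using 1
    field_simp
  rw [intervalIntegral.integral_eq_sub_of_hasDerivAt h
    (Continuous.intervalIntegrable (by fun_prop) _ _)]
  simp only [sub_self, mul_zero, neg_zero, Real.exp_zero, sub_zero]
  have : 0 ≤ Real.exp (-(a * t)) / a := by positivity
  linarith

section Duhamel

variable {T : ℝ} (hT : 0 ≤ T)

/-- The Duhamel integral of a continuous path of square integrable functions. -/
noncomputable def duh (φ : C(Icc (0 : ℝ) T, CM)) (t : ℝ) : Coeffs :=
  fun n => ∫ s in (0 : ℝ)..t, heat (t - s) (coeff (φ (projIcc 0 T hT s))) n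

lemma continuous_coeff_path (φ : C(Icc (0 : ℝ) T, CM)) (n : Freq) :
    Continuous fun s => coeff (φ (projIcc 0 T hT s)) n := by
  have h : Continuous fun s => coeffL n (φ (projIcc 0 T hT s)) :=
    (coeffL n).continuous.comp (φ.continuous.comp continuous_projIcc)
  exact h

lemma continuous_heat_coeff (φ : C(Icc (0 : ℝ) T, CM)) (t : ℝ) (n : Freq) :
    Continuous fun s => heat (t - s) (coeff (φ (projIcc 0 T hT s))) n := by
  simp only [heat_apply]
  have := continuous_coeff_path hT φ n
  fun_prop

/-- The target space is left free so that one bound serves two norms: `C(Torus, ℂ)` gives sup bounds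
of blocks, a finite dimensional Euclidean space gives their `L²` bounds. -/
lemma sum_duh_smul {E : Type*} [NormedAddCommGroup E] [NormedSpace ℂ E] [CompleteSpace E]
    (φ : C(Icc (0 : ℝ) T, CM)) (t : ℝ) (s : Finset Freq) (v : Freq → E) :
    ∑ n ∈ s, duh hT φ t n • v n = ∫ r in (0 : ℝ)..t,
      ∑ n ∈ s, heat (t - r) (coeff (φ (projIcc 0 T hT r))) n • v n := by
  have hi : ∀ n ∈ s, IntervalIntegrable
      (fun r => heat (t - r) (coeff (φ (projIcc 0 T hT r))) n • v n) volume 0 t := fun n _ =>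
    ((continuous_heat_coeff hT φ t n).smul continuous_const).intervalIntegrable _ _
  rw [intervalIntegral.integral_finsetSum hi]
  refine Finset.sum_congr rfl fun n _ => ?_
  rw [intervalIntegral.integral_smul_const]
  rfl

lemma norm_sum_duh_smul_le {E : Type*} [NormedAddCommGroup E] [NormedSpace ℂ E] [CompleteSpace E]
    (φ : C(Icc (0 : ℝ) T, CM)) {t : ℝ} (ht : 0 ≤ t) (s : Finset Freq) (v : Freq → E) {B : ℝ → ℝ}
    (hB : Continuous B) (h : ∀ r ∈ Icc 0 t,
      ‖∑ n ∈ s, heat (t - r) (coeff (φ (projIcc 0 T hT r))) n • v n‖ ≤ B r) :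
    ‖∑ n ∈ s, duh hT φ t n • v n‖ ≤ ∫ r in (0 : ℝ)..t, B r := by
  rw [sum_duh_smul]
  exact intervalIntegral.norm_integral_le_of_norm_le ht
    (.of_forall fun r hr => h r ⟨hr.1.le, hr.2⟩) (hB.intervalIntegrable _ _)

lemma norm_block_duh_le (φ : C(Icc (0 : ℝ) T, CM)) {t : ℝ} (ht : 0 ≤ t) (j : ℕ) {B : ℝ → ℝ}
    (hB : Continuous B) (h : ∀ r ∈ Icc 0 t,
      ‖block j (heat (t - r) (coeff (φ (projIcc 0 T hT r))))‖ ≤ B r) :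
    ‖block j (duh hT φ t)‖ ≤ ∫ r in (0 : ℝ)..t, B r := by
  have e : ∀ c, block j c = ∑ n ∈ freqBox j,
      c n • ((dyadic j n : ℂ) • (UnitAddTorus.mFourier n : C(Torus, ℂ))) := fun c => by
    ext x
    simp only [block_apply, ContinuousMap.sum_apply, ContinuousMap.smul_apply, smul_eq_mul]
    exact Finset.sum_congr rfl fun n _ => by ring
  rw [e]
  refine norm_sum_duh_smul_le hT φ ht _ _ hB fun r hr => ?_
  rw [← e]
  exact h r hr

lemma duh_neg (φ : C(Icc (0 : ℝ) T, CM)) (t : ℝ) (n : Freq) :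
    duh hT φ t (-n) = starRingEnd ℂ (duh hT φ t n) := by
  have h := Complex.conjCLE.toContinuousLinearMap.intervalIntegral_comp_comm
    ((continuous_heat_coeff hT φ t n).intervalIntegrable (μ := volume) 0 t)
  refine Eq.trans ?_ h
  refine intervalIntegral.integral_congr fun s _ => ?_
  simp only [heat_apply, coeff_neg, lam_neg]
  show _ = starRingEnd ℂ (_ * _)
  rw [map_mul, Complex.conj_ofReal]

lemma continuous_duh (φ : C(Icc (0 : ℝ) T, CM)) (n : Freq) :
    Continuous fun t => duh hT φ t n := by
  -- Pulling `exp (-λ t)` out of the integral leaves a primitive of a continuous function.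
  have h : (fun t => duh hT φ t n) = fun t => (Real.exp (-(lam n * t)) : ℂ) *
      ∫ s in (0 : ℝ)..t, (Real.exp (lam n * s) : ℂ) * coeff (φ (projIcc 0 T hT s)) n := by
    ext t
    rw [← intervalIntegral.integral_const_mul]
    refine intervalIntegral.integral_congr fun s _ => ?_
    simp only [heat_apply]
    rw [← mul_assoc, ← Complex.ofReal_mul, ← Real.exp_add]
    congr 3
    ring
  rw [h]
  have hc := continuous_coeff_path hT φ n
  have h2 : Continuous fun t : ℝ =>
      ∫ s in (0 : ℝ)..t, (Real.exp (lam n * s) : ℂ) * coeff (φ (projIcc 0 T hT s)) n :=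
    intervalIntegral.continuous_primitive
      (fun a b => Continuous.intervalIntegrable (by fun_prop) a b) 0
  fun_prop

/-- Growth `exp (μ s)` of the source combines with the heat decay: the integrand becomes `exp (μ t)`
times decay at rate `4 ^ j + (μ - 1)`, so a large `μ` acts as extra damping on every block. -/
lemma norm_block_duh_weighted_le (φ : C(Icc (0 : ℝ) T, CM)) {t : ℝ} (ht : t ∈ Icc 0 T) {μ M : ℝ}
    (hμ : 1 < μ) (hφ : ∀ s : Icc (0 : ℝ) T, ‖φ s‖ ≤ M * Real.exp (μ * s)) (j : ℕ) :
    ‖block j (duh hT φ t)‖ ≤ 5 * 2 ^ j * M * Real.exp (μ * t) / (4 ^ j + (μ - 1)) := by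
  have hM : 0 ≤ M := by
    have := (norm_nonneg _).trans (hφ ⟨0, le_rfl, hT⟩)
    simpa using this
  have hpos : (0 : ℝ) < 4 ^ j + (μ - 1) := by
    have : (0 : ℝ) < 4 ^ j := by positivity
    linarith
  refine (norm_block_duh_le hT φ ht.1 j (B := fun r => (5 * 2 ^ j * M * Real.exp (μ * t)) *
    Real.exp (-((4 ^ j + (μ - 1)) * (t - r)))) (by fun_prop) fun r hr => ?_).trans ?_
  · refine (norm_block_heat_le j (sub_nonneg.2 hr.2) _).trans ?_
    have h1 := hφ (projIcc 0 T hT r)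
    rw [projIcc_of_mem hT ⟨hr.1, hr.2.trans ht.2⟩] at h1 ⊢
    have h2 : Real.exp (μ * t) * Real.exp (-((4 ^ j + (μ - 1)) * (t - r))) =
        Real.exp (-((4 ^ j - 1) * (t - r))) * Real.exp (μ * r) := by
      rw [← Real.exp_add, ← Real.exp_add]; congr 1; ring
    calc _ ≤ Real.exp (-((4 ^ j - 1) * (t - r))) * (5 * 2 ^ j * (M * Real.exp (μ * r))) := by
          gcongr
      _ = 5 * 2 ^ j * M * (Real.exp (-((4 ^ j - 1) * (t - r))) * Real.exp (μ * r)) := by ring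
      _ = _ := by rw [← h2]; ring
  · rw [intervalIntegral.integral_const_mul, div_eq_mul_one_div]
    gcongr
    exact integral_exp_le hpos

lemma two_rpow_eq_four_rpow (a : ℝ) (j : ℕ) : (2 : ℝ) ^ (a * j) = ((4 : ℝ) ^ j) ^ (a / 2) := by
  rw [← Real.rpow_natCast 4 j, ← Real.rpow_mul (by norm_num), show (4 : ℝ) = 2 ^ (2 : ℝ) by norm_num,
    ← Real.rpow_mul (by norm_num)]
  congr 1; ring

/-- The weights give `2 ^ ((2 - κ) j) = (4 ^ j) ^ (1 - κ/2)`, so only part of the denominator `4 ^ j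
+ (μ - 1)` is needed to absorb the frequencies. The remaining power `κ/2` makes the constant small
as `μ` grows. -/
lemma blockNorm_duh_weighted_le {κ : ℝ} (hκ : 0 < κ) (hκ1 : κ < 1)
    (φ : C(Icc (0 : ℝ) T, CM)) {t : ℝ} (ht : t ∈ Icc 0 T)
    {μ M : ℝ} (hμ : 1 < μ) (hφ : ∀ s : Icc (0 : ℝ) T, ‖φ s‖ ≤ M * Real.exp (μ * s)) (j : ℕ) :
    blockNorm (1 - κ) j (duh hT φ t) ≤ 5 * (μ - 1) ^ (-(κ / 2)) * M * Real.exp (μ * t) := by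
  have hM : 0 ≤ M := by
    have := (norm_nonneg _).trans (hφ ⟨0, le_rfl, hT⟩)
    simpa using this
  have hA : 0 < μ - 1 := by linarith
  have hx : (0 : ℝ) < 4 ^ j := by positivity
  have h1 : (2 : ℝ) ^ ((1 - κ) * j) * 2 ^ j = (4 ^ j) ^ (1 - κ / 2) := by
    rw [← Real.rpow_natCast 2 j, ← Real.rpow_add (by norm_num),
      show (1 - κ) * (j : ℝ) + j = (2 - κ) * j by ring, two_rpow_eq_four_rpow]
    congr 1; ring
  have h2 : (4 ^ j : ℝ) ^ (1 - κ / 2) ≤ (μ - 1) ^ (-(κ / 2)) * (4 ^ j + (μ - 1)) := by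
    rw [Real.rpow_neg hA.le, inv_mul_eq_div, le_div_iff₀ (by positivity)]
    calc (4 ^ j : ℝ) ^ (1 - κ / 2) * (μ - 1) ^ (κ / 2)
        ≤ (4 ^ j + (μ - 1)) ^ (1 - κ / 2) * (4 ^ j + (μ - 1)) ^ (κ / 2) := by
          gcongr <;> linarith
      _ = 4 ^ j + (μ - 1) := by
          rw [← Real.rpow_add (by linarith)]; simp
  have hpos : (0 : ℝ) < 4 ^ j + (μ - 1) := by linarith
  calc blockNorm (1 - κ) j (duh hT φ t)
      ≤ (2 : ℝ) ^ ((1 - κ) * j) * (5 * 2 ^ j * M * Real.exp (μ * t) / (4 ^ j + (μ - 1))) := by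
        unfold blockNorm
        gcongr
        exact norm_block_duh_weighted_le hT φ ht hμ hφ j
    _ = ((2 : ℝ) ^ ((1 - κ) * j) * 2 ^ j) * (5 * M * Real.exp (μ * t)) / (4 ^ j + (μ - 1)) := by ring
    _ ≤ ((μ - 1) ^ (-(κ / 2)) * (4 ^ j + (μ - 1))) * (5 * M * Real.exp (μ * t)) /
          (4 ^ j + (μ - 1)) := by
        rw [h1]; gcongr
    _ = _ := by field_simp

lemma norm_path_le (φ : C(Icc (0 : ℝ) T, CM)) (s : Icc (0 : ℝ) T) :
    ‖φ s‖ ≤ ‖φ‖ * Real.exp (2 * s) :=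
  (φ.norm_coe_le_norm s).trans <| le_mul_of_one_le_right (norm_nonneg _) <|
    Real.one_le_exp (by have := s.2.1; positivity)

/-- Here the surplus `κ` is spent on decay in `j`, uniformly in time. This places the Duhamel
integral in the closure of the smooth functions and makes it continuous in time. -/
lemma blockNorm_duh_le {κ : ℝ} (φ : C(Icc (0 : ℝ) T, CM)) {t : ℝ} (ht : t ∈ Icc 0 T) (j : ℕ) :
    blockNorm (1 - κ) j (duh hT φ t) ≤ 5 * ‖φ‖ * Real.exp (2 * T) * ((2 : ℝ) ^ (-κ)) ^ j := by
  have h := norm_block_duh_weighted_le hT φ ht one_lt_two (norm_path_le φ) j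
  have h4 : ((4 : ℝ) ^ j) = (2 ^ j) * 2 ^ j := by rw [← mul_pow]; norm_num
  calc blockNorm (1 - κ) j (duh hT φ t)
      ≤ (2 : ℝ) ^ ((1 - κ) * j) * (5 * 2 ^ j * ‖φ‖ * Real.exp (2 * T) / 4 ^ j) := by
        unfold blockNorm
        gcongr
        refine h.trans ?_
        gcongr
        · exact ht.2
        · norm_num
    _ = 5 * ‖φ‖ * Real.exp (2 * T) * ((2 : ℝ) ^ (-κ)) ^ j := by
        rw [← two_rpow_mul_nat, show (1 - κ) * (j : ℝ) = -κ * j + j by ring,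
          Real.rpow_add (by norm_num), Real.rpow_natCast, h4]
        field_simp

end Duhamel

lemma tendsto_geometric {κ : ℝ} (hκ : 0 < κ) (C : ℝ) :
    Tendsto (fun j : ℕ => C * ((2 : ℝ) ^ (-κ)) ^ j) atTop (𝓝 0) := by
  simpa using (tendsto_pow_atTop_nhds_zero_of_lt_one (by positivity)
    (two_rpow_neg_lt_one hκ)).const_mul C

lemma mem_besovSubmodule_of_le {α : ℝ} {c : Coeffs} (hc : ∀ n, c (-n) = starRingEnd ℂ (c n))
    {b : ℕ → ℝ} (hb : Tendsto b atTop (𝓝 0)) (h : ∀ j, blockNorm α j c ≤ b j) :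
    c ∈ besovSubmodule α :=
  ⟨hc, squeeze_zero (fun _ => blockNorm_nonneg _ _ _) h hb⟩

/-- Continuity of a path in `C^α` from coefficientwise continuity and uniformly small tails. -/
lemma continuous_of_coeff {Y : Type*} [TopologicalSpace Y] {α : ℝ} {c : Y → Hol α}
    (hc : ∀ n, Continuous fun t => coeff (Hol.toC (c t)) n) {b : ℕ → ℝ}
    (hb : Tendsto b atTop (𝓝 0)) (h : ∀ t j, blockNorm α j (coeff (Hol.toC (c t))) ≤ b j) :
    Continuous c := by
  refine continuous_iff_continuousAt.2 fun t₀ => ?_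
  refine Metric.tendsto_nhds.2 fun ε hε => ?_
  obtain ⟨J, hJ⟩ := eventually_atTop.1 (hb.eventually_lt_const (show 0 < ε / 4 by positivity))
  have hcc : Continuous fun t => coeff (Hol.toC (c t)) := continuous_pi hc
  have h1 : ∀ᶠ t in 𝓝 t₀, ∀ j ∈ Finset.range J,
      blockNorm α j (coeff (Hol.toC (c t)) - coeff (Hol.toC (c t₀))) < ε / 2 := by
    refine (Finset.eventually_all _).2 fun j _ => ?_
    have h2 : Continuous fun t =>
        blockNorm α j (coeff (Hol.toC (c t)) - coeff (Hol.toC (c t₀))) :=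
      (continuous_blockNorm α j).comp (hcc.sub continuous_const)
    have h3 := h2.tendsto t₀
    rw [sub_self, blockNorm_zero] at h3
    exact h3.eventually_lt_const (half_pos hε)
  filter_upwards [h1] with t ht
  rw [dist_eq_norm]
  refine lt_of_le_of_lt (Hol.norm_le (M := ε / 2) fun j => ?_) (half_lt_self hε)
  rw [Hol.coeff_toC_sub]
  rcases lt_or_ge j J with hj | hj
  · exact (ht j (Finset.mem_range.2 hj)).le
  · refine (blockNorm_sub_le _ _ _ _).trans ?_
    have := hJ j hj
    linarith [h t j, h t₀ j]

lemma exists_path {T κ : ℝ} (hκ1 : κ < 1) {c : ℝ → Coeffs}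
    (hn : ∀ t ∈ Icc 0 T, ∀ n, c t (-n) = starRingEnd ℂ (c t n))
    (hc : ∀ n, Continuous fun t => c t n) {b : ℕ → ℝ} (hb : Tendsto b atTop (𝓝 0))
    (h : ∀ t ∈ Icc 0 T, ∀ j, blockNorm (1 - κ) j (c t) ≤ b j) :
    ∃ w : PathSpace κ T, ∀ t : Icc (0 : ℝ) T, coeff (Hol.toC (w t)) = c t := by
  have hα : 0 < 1 - κ := by linarith
  choose w hw using fun t : Icc (0 : ℝ) T => Hol.exists_coeff_toC_eq hα
    (mem_besovSubmodule_of_le (hn t t.2) hb (h t t.2))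
  refine ⟨⟨w, continuous_of_coeff (fun n => ?_) hb fun t j => ?_⟩, hw⟩
  · simp only [hw]
    exact (hc n).comp continuous_subtype_val
  · rw [hw]
    exact h t t.2 j

/-! ### The Duhamel operator on the path space and Volterra equations -/

section Operator

variable {κ T : ℝ} (hκ : 0 < κ) (hκ1 : κ < 1) (hT : 0 ≤ T)

lemma PathSpace.ext_coeff {w v : PathSpace κ T}
    (h : ∀ t, coeff (Hol.toC (w t)) = coeff (Hol.toC (v t))) : w = v :=
  ContinuousMap.ext fun t => Hol.ext_coeff (h t)

include hκ hκ1 in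
lemma exists_duhamel_path (φ : C(Icc (0 : ℝ) T, CM)) :
    ∃ w : PathSpace κ T, ∀ t : Icc (0 : ℝ) T, coeff (Hol.toC (w t)) = duh hT φ t :=
  exists_path hκ1 (fun t _ n => duh_neg hT φ t n) (continuous_duh hT φ)
    (tendsto_geometric hκ _) fun _ ht j => blockNorm_duh_le hT φ ht j

lemma duh_add (φ ψ : C(Icc (0 : ℝ) T, CM)) (t : ℝ) :
    duh hT (φ + ψ) t = duh hT φ t + duh hT ψ t := by
  ext n
  simp only [duh, Pi.add_apply]
  rw [← intervalIntegral.integral_add ((continuous_heat_coeff hT φ t n).intervalIntegrable _ _)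
    ((continuous_heat_coeff hT ψ t n).intervalIntegrable _ _)]
  refine intervalIntegral.integral_congr fun s _ => ?_
  simp only [heat_apply, ContinuousMap.add_apply, coeff_add_CM, Pi.add_apply, mul_add]

lemma duh_smul (r : ℝ) (φ : C(Icc (0 : ℝ) T, CM)) (t : ℝ) :
    duh hT (r • φ) t = r • duh hT φ t := by
  ext n
  simp only [duh, Pi.smul_apply]
  rw [← intervalIntegral.integral_smul]
  refine intervalIntegral.integral_congr fun s _ => ?_
  simp only [heat_apply, ContinuousMap.smul_apply, coeff_smul_CM, Pi.smul_apply, mul_smul_comm]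

/-- The Duhamel integral as an element of the path space. -/
noncomputable def duhPath (φ : C(Icc (0 : ℝ) T, CM)) : PathSpace κ T :=
  (exists_duhamel_path hκ hκ1 hT φ).choose

lemma coeff_duhPath (φ : C(Icc (0 : ℝ) T, CM)) (t : Icc (0 : ℝ) T) :
    coeff (Hol.toC (duhPath hκ hκ1 hT φ t)) = duh hT φ t :=
  (exists_duhamel_path hκ hκ1 hT φ).choose_spec t

/-- The Duhamel operator from continuous paths in `L²` to the path space. -/
noncomputable def duhL : C(Icc (0 : ℝ) T, CM) →L[ℝ] PathSpace κ T :=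
  LinearMap.mkContinuous
    { toFun := duhPath hκ hκ1 hT
      map_add' := fun φ ψ => PathSpace.ext_coeff fun t => by
        rw [ContinuousMap.add_apply, Hol.coeff_toC_add, coeff_duhPath, coeff_duhPath,
          coeff_duhPath, duh_add]
      map_smul' := fun r φ => PathSpace.ext_coeff fun t => by
        rw [ContinuousMap.smul_apply, Hol.coeff_toC_smul, RingHom.id_apply, coeff_duhPath,
          coeff_duhPath, duh_smul] }
    (5 * Real.exp (2 * T)) fun φ => by
      refine (ContinuousMap.norm_le _ (by positivity)).2 fun t => Hol.norm_le fun j => ?_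
      refine (le_of_eq_of_le (congrArg _ (coeff_duhPath hκ hκ1 hT φ t))
        (blockNorm_duh_le hT φ t.2 j)).trans ?_
      have h : ((2 : ℝ) ^ (-κ)) ^ j ≤ 1 :=
        pow_le_one₀ (by positivity) (two_rpow_neg_lt_one hκ).le
      calc 5 * ‖φ‖ * Real.exp (2 * T) * ((2 : ℝ) ^ (-κ)) ^ j
          ≤ 5 * ‖φ‖ * Real.exp (2 * T) * 1 := by gcongr
        _ = _ := by ring

lemma coeff_duhL (φ : C(Icc (0 : ℝ) T, CM)) (t : Icc (0 : ℝ) T) :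
    coeff (Hol.toC (duhL hκ hκ1 hT φ t)) = duh hT φ t :=
  coeff_duhPath hκ hκ1 hT φ t

lemma norm_duhL_weighted_le (φ : C(Icc (0 : ℝ) T, CM)) (t : Icc (0 : ℝ) T) {μ M : ℝ}
    (hμ : 1 < μ) (hφ : ∀ s : Icc (0 : ℝ) T, ‖φ s‖ ≤ M * Real.exp (μ * s)) :
    ‖duhL hκ hκ1 hT φ t‖ ≤ 5 * (μ - 1) ^ (-(κ / 2)) * M * Real.exp (μ * t) :=
  Hol.norm_le fun j => by
    rw [coeff_duhL]
    exact blockNorm_duh_weighted_le hT hκ hκ1 φ t.2 hμ hφ j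

lemma blockNorm_heat_le {α : ℝ} (j : ℕ) {t : ℝ} (ht : 0 ≤ t) (c : Coeffs) :
    blockNorm α j (heat t c) ≤ blockNorm α j c := by
  unfold blockNorm
  gcongr
  have h := multBound_heat ht (freqBox j) fun n => (dyadic j n : ℂ) * c n
  rw [one_mul] at h
  rw [block_eq_trig, block_eq_trig]
  convert! h using 3
  ext n
  simp only [heat_apply]
  ring

lemma heat_neg {t : ℝ} {c : Coeffs} (hc : ∀ n, c (-n) = starRingEnd ℂ (c n)) (n : Freq) :
    heat t c (-n) = starRingEnd ℂ (heat t c n) := by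
  simp [heat_apply, hc, lam_neg, ← Complex.exp_conj]

include hκ hκ1 in
lemma exists_heat_path {u₀ : C(Torus, ℝ)} (hu₀ : IsHolder (1 + 2 * κ) u₀) :
    ∃ w : PathSpace κ T, ∀ t : Icc (0 : ℝ) T, coeff (Hol.toC (w t)) = heat t (coeff u₀) := by
  obtain ⟨M, hM⟩ := hu₀
  refine exists_path (c := fun t => heat t (coeff u₀)) hκ1 (fun t _ n => heat_neg (coeff_neg _) n) (fun n => ?_)
    -- The datum has regularity `1 + 2κ`, which exceeds `1 - κ` by `3κ`.
    (tendsto_geometric (κ := 3 * κ) (by linarith) M) fun t ht j => ?_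
  · simp only [heat_apply]; fun_prop
  · refine (blockNorm_heat_le j ht.1 _).trans ?_
    have h := hM j
    rw [← two_rpow_mul_nat]
    unfold blockNorm at h ⊢
    rw [show (1 - κ) * (j : ℝ) = (1 + 2 * κ) * j + -(3 * κ) * j by ring,
      Real.rpow_add (by norm_num), mul_right_comm]
    gcongr

include hκ1 in
lemma completeSpace_path : CompleteSpace (PathSpace κ T) := by
  have := Hol.completeSpace (α := 1 - κ) (by linarith)
  infer_instance

/-- Well-posedness of Volterra equations whose nonlinearity is Lipschitz at each time. -/
lemma existsUnique_fixedPoint (N : PathSpace κ T → C(Icc (0 : ℝ) T, CM)) (L : ℝ)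
    (hN : ∀ w v t, ‖N w t - N v t‖ ≤ L * ‖w t - v t‖) (b : PathSpace κ T) :
    ∃! w, w = b + duhL hκ hκ1 hT (N w) := by
  have := completeSpace_path (T := T) hκ1
  -- The negative power of `μ - 1` beats any Lipschitz constant, so no smallness of `T` is required.
  obtain ⟨μ, hμ1, hμ⟩ : ∃ μ : ℝ, 1 < μ ∧ 5 * (μ - 1) ^ (-(κ / 2)) * max L 0 ≤ 1 / 2 := by
    have h1 : Tendsto (fun x : ℝ => 5 * x ^ (-(κ / 2)) * max L 0) atTop (𝓝 0) := by
      have := ((tendsto_rpow_neg_atTop (half_pos hκ)).const_mul 5).mul_const (max L 0)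
      simpa using this
    obtain ⟨x, hx, hx0⟩ := ((h1.eventually_le_const (show (0 : ℝ) < 1 / 2 by norm_num)).and
      (eventually_gt_atTop 0)).exists
    exact ⟨x + 1, by linarith, by simpa using hx⟩
  let e : ℝ → C(Icc (0 : ℝ) T, ℝ) := fun a => ⟨fun t => Real.exp (a * t), by fun_prop⟩
  have he : ∀ a : ℝ, ∀ w : PathSpace κ T, e (-a) • e a • w = w := fun a w => by
    ext1 t
    simp only [ContinuousMap.smul_apply', e, ContinuousMap.coe_mk]
    rw [smul_smul, ← Real.exp_add]
    simp
  -- The fixed point map for the unknown `exp (-μ t) w`. Since the Lipschitz bound on `N` holds at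
  -- each time separately, the weight passes through `N`, and the weighted Duhamel bound makes `Φ` a
  -- `1/2`-contraction for the usual norm.
  let Φ : PathSpace κ T → PathSpace κ T := fun y =>
    e (-μ) • (b + duhL hκ hκ1 hT (N (e μ • y)))
  have hΦ : ContractingWith (1 / 2) Φ := by
    refine ⟨by norm_num [← NNReal.coe_lt_coe], LipschitzWith.of_dist_le_mul fun y z => ?_⟩
    rw [dist_eq_norm, dist_eq_norm]
    refine (ContinuousMap.norm_le _ (by positivity)).2 fun t => ?_
    have h1 : (Φ y - Φ z) t =
        Real.exp (-μ * t) • duhL hκ hκ1 hT (N (e μ • y) - N (e μ • z)) t := by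
      simp only [Φ, ContinuousMap.sub_apply, ContinuousMap.smul_apply', ContinuousMap.add_apply,
        e, ContinuousMap.coe_mk, map_sub, smul_sub, smul_add]
      abel
    rw [h1, norm_smul, Real.norm_of_nonneg (Real.exp_pos _).le]
    have h2 := norm_duhL_weighted_le hκ hκ1 hT (N (e μ • y) - N (e μ • z)) t hμ1
      (M := max L 0 * ‖y - z‖) fun s => by
        refine (hN _ _ s).trans ?_
        have h3 : (e μ • y) s - (e μ • z) s = Real.exp (μ * s) • (y - z) s := by
          simp only [ContinuousMap.smul_apply', e, ContinuousMap.coe_mk, ContinuousMap.sub_apply,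
            smul_sub]
        rw [h3, norm_smul, Real.norm_of_nonneg (Real.exp_pos _).le]
        calc L * (Real.exp (μ * s) * ‖(y - z) s‖)
            ≤ max L 0 * (Real.exp (μ * s) * ‖y - z‖) := by
              gcongr
              · exact le_max_left _ _
              · exact (y - z).norm_coe_le_norm s
          _ = _ := by ring
    calc Real.exp (-μ * t) * ‖duhL hκ hκ1 hT (N (e μ • y) - N (e μ • z)) t‖
        ≤ Real.exp (-μ * t) *
          (5 * (μ - 1) ^ (-(κ / 2)) * (max L 0 * ‖y - z‖) * Real.exp (μ * t)) := by gcongr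
      _ = (Real.exp (-μ * t) * Real.exp (μ * t)) *
          (5 * (μ - 1) ^ (-(κ / 2)) * max L 0) * ‖y - z‖ := by ring
      _ = (5 * (μ - 1) ^ (-(κ / 2)) * max L 0) * ‖y - z‖ := by
          rw [← Real.exp_add]; simp
      _ ≤ ((1 / 2 : NNReal) : ℝ) * ‖y - z‖ := by
          gcongr
          simpa using hμ
  have hne : Nonempty (PathSpace κ T) := ⟨0⟩
  refine ⟨e μ • ContractingWith.fixedPoint Φ hΦ, ?_, fun w hw => ?_⟩
  · have h := hΦ.fixedPoint_isFixedPt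
    have h2 : e μ • Φ (ContractingWith.fixedPoint Φ hΦ) = e μ • ContractingWith.fixedPoint Φ hΦ := by
      rw [h]
    have h3 := he (-μ) (b + duhL hκ hκ1 hT (N (e μ • ContractingWith.fixedPoint Φ hΦ)))
    rw [neg_neg] at h3
    exact h2.symm.trans h3
  · have h3 := he (-μ) w
    rw [neg_neg] at h3
    have h : Function.IsFixedPt Φ (e (-μ) • w) := by
      show e (-μ) • (b + duhL hκ hκ1 hT (N (e μ • e (-μ) • w))) = e (-μ) • w
      rw [h3, ← hw]
    have h4 : e μ • (e (-μ) • w) = e μ • ContractingWith.fixedPoint Φ hΦ :=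
      congrArg (e μ • ·) (hΦ.fixedPoint_unique h)
    rwa [h3] at h4

end Operator

end GPAM

namespace GPAM

/-! ### Nemytskii operators -/

section Nemytskii

variable {K : Type*} [TopologicalSpace K] [CompactSpace K]

/-- The superposition operator `u ↦ f ∘ u`. -/
def nem {f : ℝ → ℝ} (hf : Continuous f) (u : C(K, ℝ)) : C(K, ℝ) := (⟨f, hf⟩ : C(ℝ, ℝ)).comp u

omit [CompactSpace K] in
lemma nem_apply {f : ℝ → ℝ} (hf : Continuous f) (u : C(K, ℝ)) (x : K) : nem hf u x = f (u x) := rfl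

lemma abs_sub_le_of_abs_deriv_le {f : ℝ → ℝ} (hf : Differentiable ℝ f) {L : ℝ}
    (hL : ∀ x, |deriv f x| ≤ L) (a b : ℝ) : |f b - f a| ≤ L * |b - a| :=
  convex_univ.norm_image_sub_le_of_norm_hasDerivWithin_le
    (fun x _ => (hf x).hasDerivAt.hasDerivWithinAt) (fun x _ => hL x) (mem_univ a) (mem_univ b)

lemma abs_taylor_le {f : ℝ → ℝ} (hf : Differentiable ℝ f) {L : ℝ} (hL0 : 0 ≤ L)
    (hL : ∀ x y, |deriv f y - deriv f x| ≤ L * |y - x|) (a b : ℝ) :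
    |f b - f a - deriv f a * (b - a)| ≤ L * |b - a| ^ 2 := by
  have h := (convex_uIcc a b).norm_image_sub_le_of_norm_hasDerivWithin_le
    (f := fun x => f x - deriv f a * x) (f' := fun x => deriv f x - deriv f a) (C := L * |b - a|)
    (fun x _ => ((hf x).hasDerivAt.sub
      (by simpa using (hasDerivAt_id x).const_mul (deriv f a))).hasDerivWithinAt)
    (fun x hx => (hL a x).trans (by
      have := abs_sub_left_of_mem_uIcc hx
      gcongr)) left_mem_uIcc right_mem_uIcc
  rw [Real.norm_eq_abs, Real.norm_eq_abs] at h
  convert! h using 1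
  · congr 1; ring
  · ring

/-- Taylor's remainder is quadratic at each point with a uniform constant, hence quadratic in the
sup norm. No such statement would hold with an `L²` norm in its place for general nonlinear `f`. -/
lemma hasFDerivAt_nem {f : ℝ → ℝ} (hf : Differentiable ℝ f) (hf' : Continuous (deriv f)) {L : ℝ}
    (hL0 : 0 ≤ L) (hL : ∀ x y, |deriv f y - deriv f x| ≤ L * |y - x|) (u : C(K, ℝ)) :
    HasFDerivAt (nem hf.continuous) (ContinuousLinearMap.mul ℝ C(K, ℝ) (nem hf' u)) u := by
  rw [hasFDerivAt_iff_isLittleO_nhds_zero]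
  have hO : (fun v : C(K, ℝ) => nem hf.continuous (u + v) - nem hf.continuous u -
      ContinuousLinearMap.mul ℝ C(K, ℝ) (nem hf' u) v) =O[𝓝 0] fun v => ‖v‖ ^ 2 := by
    refine Asymptotics.IsBigO.of_bound L (.of_forall fun v => ?_)
    rw [Real.norm_of_nonneg (by positivity)]
    refine (ContinuousMap.norm_le _ (by positivity)).2 fun x => ?_
    have h := abs_taylor_le hf hL0 hL (u x) (u x + v x)
    rw [add_sub_cancel_left] at h
    refine h.trans ?_
    gcongr
    exact v.norm_coe_le_norm x
  refine hO.trans_isLittleO ?_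
  have h1 : (fun v : C(K, ℝ) => ‖v‖ ^ 2) =o[𝓝 0] fun v => ‖v‖ := by
    have h2 : (fun v : C(K, ℝ) => ‖v‖) =o[𝓝 0] fun _ => (1 : ℝ) := by
      rw [Asymptotics.isLittleO_one_iff]
      exact continuous_norm.tendsto' 0 0 norm_zero
    simpa [sq] using h2.mul_isBigO (Asymptotics.isBigO_refl (fun v : C(K, ℝ) => ‖v‖) (𝓝 0))
  exact h1.of_norm_right

lemma lipschitz_deriv_of_bound {f : ℝ → ℝ} (hf : ContDiff ℝ 2 f) {L : ℝ}
    (hL : ∀ x, |iteratedDeriv 2 f x| ≤ L) (x y : ℝ) :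
    |deriv f y - deriv f x| ≤ L * |y - x| := by
  have h : ContDiff ℝ 1 (deriv f) := (contDiff_succ_iff_deriv (n := 1)).1 hf |>.2.2
  refine abs_sub_le_of_abs_deriv_le (h.differentiable (by norm_num)) (fun z => ?_) x y
  have := hL z
  rwa [iteratedDeriv_succ, iteratedDeriv_one] at this

/-- Induction on `n`: the derivative at `u` is multiplication by `nem f' u`, so it is as smooth as
the superposition operator of `f'`. One derivative more than `n` is asked because differentiability
was obtained from a Lipschitz `f'`. -/
lemma contDiff_nem (n : ℕ) {f : ℝ → ℝ} (hc : Continuous f) (hf : ContDiff ℝ (n + 1) f)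
    (hb : ∀ m ≤ n + 1, ∃ C, ∀ x, |iteratedDeriv m f x| ≤ C) :
    ContDiff ℝ n (nem hc : C(K, ℝ) → C(K, ℝ)) := by
  induction n generalizing f with
  | zero =>
    exact contDiff_zero.2 (ContinuousMap.continuous_postcomp _)
  | succ n ih =>
    have hf2 : ContDiff ℝ 2 f := hf.of_le (by norm_cast; omega)
    have hf' : ContDiff ℝ (n + 1) (deriv f) := by
      have := hf
      push_cast at this
      exact (contDiff_succ_iff_deriv.1 this).2.2
    have hd := ih hf'.continuous hf' fun m hm => by
      obtain ⟨C, hC⟩ := hb (m + 1) (by omega)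
      exact ⟨C, fun x => by rw [← iteratedDeriv_succ']; exact hC x⟩
    obtain ⟨L, hL⟩ := hb 2 (by omega)
    push_cast
    rw [contDiff_succ_iff_hasFDerivAt]
    refine ⟨fun u => ContinuousLinearMap.mul ℝ C(K, ℝ) (nem hf'.continuous u),
      (ContinuousLinearMap.contDiff _).comp hd, fun u => ?_⟩
    exact hasFDerivAt_nem (hf2.differentiable (by norm_num)) hf'.continuous
      ((abs_nonneg _).trans (hL 0)) (lipschitz_deriv_of_bound hf2 hL) u

end Nemytskii

/-! ### Multiplication of square integrable functions by continuous functions -/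

lemma memLp_mul (a : C(Torus, ℝ)) (k : CM) : MemLp (fun x => a x * k x) 2 torusMeasure := by
  refine MemLp.of_le_mul (c := ‖a‖) (Lp.memLp k) ?_ (.of_forall fun x => ?_)
  · exact a.continuous.aestronglyMeasurable.mul (Lp.aestronglyMeasurable k)
  · rw [norm_mul]
    gcongr
    exact a.norm_coe_le_norm x

/-- The product of a continuous and a square integrable function. -/
noncomputable def mulFun (a : C(Torus, ℝ)) (k : CM) : CM := (memLp_mul a k).toLp

lemma coeFn_mulFun (a : C(Torus, ℝ)) (k : CM) :
    mulFun a k =ᵐ[torusMeasure] fun x => a x * k x := (memLp_mul a k).coeFn_toLp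

lemma norm_mulFun_le (a : C(Torus, ℝ)) (k : CM) : ‖mulFun a k‖ ≤ ‖a‖ * ‖k‖ := by
  refine Lp.norm_le_mul_norm_of_ae_le_mul ?_
  filter_upwards [coeFn_mulFun a k] with x hx
  refine (congrArg _ hx).le.trans ?_
  rw [norm_mul]
  gcongr
  exact a.norm_coe_le_norm x

/-- Multiplication of square integrable by continuous functions. -/
noncomputable def mulCM : C(Torus, ℝ) →L[ℝ] CM →L[ℝ] CM :=
  LinearMap.mkContinuous₂
    (LinearMap.mk₂ ℝ mulFun
      (fun a b k => Lp.ext <| by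
        filter_upwards [coeFn_mulFun (a + b) k, coeFn_mulFun a k, coeFn_mulFun b k,
          Lp.coeFn_add (mulFun a k) (mulFun b k)] with x h1 h2 h3 h4
        rw [h1, h4, Pi.add_apply, h2, h3, ContinuousMap.add_apply, add_mul])
      (fun r a k => Lp.ext <| by
        filter_upwards [coeFn_mulFun (r • a) k, coeFn_mulFun a k,
          Lp.coeFn_smul r (mulFun a k)] with x h1 h2 h4
        rw [h1, h4, Pi.smul_apply, h2, ContinuousMap.smul_apply, smul_eq_mul, smul_eq_mul,
          mul_assoc])
      (fun a k l => Lp.ext <| by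
        filter_upwards [coeFn_mulFun a (k + l), coeFn_mulFun a k, coeFn_mulFun a l,
          Lp.coeFn_add (mulFun a k) (mulFun a l), Lp.coeFn_add k l] with x h1 h2 h3 h4 h5
        rw [h1, h4, Pi.add_apply, h2, h3, h5, Pi.add_apply, mul_add])
      (fun r a k => Lp.ext <| by
        filter_upwards [coeFn_mulFun a (r • k), coeFn_mulFun a k,
          Lp.coeFn_smul r (mulFun a k), Lp.coeFn_smul r k] with x h1 h2 h4 h5
        rw [h1, h4, Pi.smul_apply, h2, h5, Pi.smul_apply, smul_eq_mul, smul_eq_mul,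
          mul_left_comm]))
    1 fun a k => by
      rw [one_mul]
      exact norm_mulFun_le a k

lemma coeFn_mulCM (a : C(Torus, ℝ)) (k : CM) :
    mulCM a k =ᵐ[torusMeasure] fun x => a x * k x := coeFn_mulFun a k

lemma norm_mulCM_le (a : C(Torus, ℝ)) (k : CM) : ‖mulCM a k‖ ≤ ‖a‖ * ‖k‖ := norm_mulFun_le a k

/-! ### Paths as functions of time and space, and their products with `L²` functions -/

section Paths

variable {κ T : ℝ}

/-- Time-space. -/
abbrev TimeSpace (T : ℝ) : Type := Icc (0 : ℝ) T × Torus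

lemma norm_curry_le (a : C(TimeSpace T, ℝ)) (t : Icc (0 : ℝ) T) : ‖a.curry t‖ ≤ ‖a‖ :=
  (ContinuousMap.norm_le _ (norm_nonneg _)).2 fun x => a.norm_coe_le_norm (t, x)

/-- Multiplication of a square integrable function by a continuous function of time and space. -/
noncomputable def mulPath : C(TimeSpace T, ℝ) →L[ℝ] CM →L[ℝ] C(Icc (0 : ℝ) T, CM) :=
  LinearMap.mkContinuous₂
    (LinearMap.mk₂ ℝ
      (fun a k => ⟨fun t => mulCM (a.curry t) k,
        (mulCM.continuous.comp a.curry.continuous).clm_apply continuous_const⟩)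
      (fun a b k => ContinuousMap.ext fun t => by
        simp)
      (fun r a k => ContinuousMap.ext fun t => by
        simp)
      (fun a k l => ContinuousMap.ext fun t => by simp)
      (fun r a k => ContinuousMap.ext fun t => by simp))
    1 fun a k => by
      rw [one_mul]
      refine (ContinuousMap.norm_le _ (by positivity)).2 fun t => ?_
      refine (norm_mulCM_le _ _).trans ?_
      gcongr
      exact norm_curry_le a t

lemma mulPath_apply (a : C(TimeSpace T, ℝ)) (k : CM) (t : Icc (0 : ℝ) T) :
    mulPath a k t = mulCM (a.curry t) k := rfl

lemma coeFn_mulPath (a : C(TimeSpace T, ℝ)) (k : CM) (t : Icc (0 : ℝ) T) :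
    mulPath a k t =ᵐ[torusMeasure] fun x => a (t, x) * k x := coeFn_mulCM _ _

/-- Elements of the path space as continuous functions of time and space. -/
noncomputable def ev (hκ1 : κ < 1) : PathSpace κ T →L[ℝ] C(TimeSpace T, ℝ) :=
  LinearMap.mkContinuous
    { toFun := fun w =>
        (⟨fun t => Hol.toCL (sub_pos.2 hκ1) (w t), by fun_prop⟩ :
          C(Icc (0 : ℝ) T, C(Torus, ℝ))).uncurry
      map_add' := fun w v => by ext ⟨t, x⟩; simp
      map_smul' := fun r w => by ext ⟨t, x⟩; simp }
    (1 - (2 : ℝ) ^ (-(1 - κ)))⁻¹ fun w => by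
      have h0 : 0 ≤ (1 - (2 : ℝ) ^ (-(1 - κ)))⁻¹ :=
        inv_nonneg.2 (sub_nonneg.2 (two_rpow_neg_lt_one (sub_pos.2 hκ1)).le)
      refine (ContinuousMap.norm_le _ (by positivity)).2 fun p => ?_
      refine ((Hol.toC (w p.1)).norm_coe_le_norm p.2).trans ?_
      refine (Hol.norm_toC_le (sub_pos.2 hκ1) _).trans ?_
      gcongr
      exact w.norm_coe_le_norm p.1

lemma eval_eq (hκ1 : κ < 1) (w : PathSpace κ T) {s : ℝ} (hs : s ∈ Icc 0 T) (x : Torus) :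
    eval w s x = ev hκ1 w (⟨s, hs⟩, x) := by
  rw [eval, dif_pos hs]; rfl

lemma norm_curry_ev_sub_le (hκ1 : κ < 1) (w v : PathSpace κ T) (t : Icc (0 : ℝ) T) :
    ‖(ev hκ1 w).curry t - (ev hκ1 v).curry t‖ ≤
      (1 - (2 : ℝ) ^ (-(1 - κ)))⁻¹ * ‖w t - v t‖ := by
  have h := Hol.norm_toC_le (sub_pos.2 hκ1) (w t - v t)
  rwa [map_sub] at h

variable (hT : 0 ≤ T)

lemma duhamel_eq_duh {f : ℝ → Torus → ℝ} {φ : C(Icc (0 : ℝ) T, CM)}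
    (h : ∀ s : Icc (0 : ℝ) T, f s =ᵐ[torusMeasure] φ s) (t : Icc (0 : ℝ) T) :
    duhamel f t = duh hT φ t := by
  ext n
  refine intervalIntegral.integral_congr fun s hs => ?_
  rw [uIcc_of_le t.2.1] at hs
  have hs' : s ∈ Icc 0 T := ⟨hs.1, hs.2.trans t.2.2⟩
  simp only [projIcc_of_mem hT hs']
  rw [coeff_congr (h ⟨s, hs'⟩)]

end Paths

end GPAM

namespace GPAM

/-! ### The solution map and its derivatives -/

section SolutionMap

variable {κ T : ℝ} (hκ : 0 < κ) (hκ1 : κ < 1) (hT : 0 ≤ T)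

/-- The linear operator `v ↦ v - ∫_0^t P_{t-s} [a(s) v(s) h] ds`. -/
noncomputable def linOp (a : C(TimeSpace T, ℝ)) (h : CM) : PathSpace κ T →L[ℝ] PathSpace κ T :=
  ContinuousLinearMap.id ℝ _ - (duhL hκ hκ1 hT).comp
    ((mulPath.flip h).comp ((ContinuousLinearMap.mul ℝ C(TimeSpace T, ℝ) a).comp (ev hκ1)))

lemma linOp_apply (a : C(TimeSpace T, ℝ)) (h : CM) (v : PathSpace κ T) :
    linOp hκ hκ1 hT a h v = v - duhL hκ hκ1 hT (mulPath (a * ev hκ1 v) h) := rfl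

/-- Bijectivity is unique solvability of a linear Volterra equation, to which the weighted
contraction applies whatever the sizes of `a`, `h` and `T`. -/
lemma linOp_bijective (a : C(TimeSpace T, ℝ)) (h : CM) :
    Function.Bijective (linOp (κ := κ) hκ hκ1 hT a h) := by
  refine Function.bijective_iff_existsUnique _ |>.2 fun b => ?_
  have key := existsUnique_fixedPoint hκ hκ1 hT
    (fun v : PathSpace κ T => mulPath (a * ev hκ1 v) h)
    (‖a‖ * (1 - (2 : ℝ) ^ (-(1 - κ)))⁻¹ * ‖h‖) (fun w v t => by
      rw [mulPath_apply, mulPath_apply, ← sub_apply, ← map_sub]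
      refine (norm_mulCM_le _ _).trans ?_
      have h1 : (a * ev hκ1 w).curry t - (a * ev hκ1 v).curry t =
          a.curry t * ((ev hκ1 w).curry t - (ev hκ1 v).curry t) := by
        ext x; simp [mul_sub]
      calc ‖(a * ev hκ1 w).curry t - (a * ev hκ1 v).curry t‖ * ‖h‖
          ≤ (‖a‖ * ((1 - (2 : ℝ) ^ (-(1 - κ)))⁻¹ * ‖w t - v t‖)) * ‖h‖ := by
            rw [h1]
            gcongr
            refine (norm_mul_le _ _).trans ?_
            gcongr
            · exact norm_curry_le a t
            · exact norm_curry_ev_sub_le hκ1 w v t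
        _ = _ := by ring) b
  refine (existsUnique_congr fun v => ?_).1 key
  rw [linOp_apply, sub_eq_iff_eq_add]

/-- The inverse is bounded by the open mapping theorem. -/
lemma linOp_isInvertible (a : C(TimeSpace T, ℝ)) (h : CM) :
    (linOp (κ := κ) hκ hκ1 hT a h).IsInvertible := by
  have := completeSpace_path (T := T) hκ1
  obtain ⟨h1, h2⟩ := linOp_bijective (κ := κ) hκ hκ1 hT a h
  exact ⟨ContinuousLinearEquiv.ofBijective (linOp hκ hκ1 hT a h) (LinearMap.ker_eq_bot.2 h1)
    (LinearMap.range_eq_top.2 h2), ContinuousLinearEquiv.coe_ofBijective _ _ _⟩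

lemma exists_norm_le_linOp (a : C(TimeSpace T, ℝ)) (h : CM) :
    ∃ C, 0 ≤ C ∧ ∀ v, ‖v‖ ≤ C * ‖linOp (κ := κ) hκ hκ1 hT a h v‖ := by
  obtain ⟨e, he⟩ := linOp_isInvertible (κ := κ) hκ hκ1 hT a h
  refine ⟨‖(e.symm : PathSpace κ T →L[ℝ] PathSpace κ T)‖, ContinuousLinearMap.opNorm_nonneg _,
    fun v => ?_⟩
  have h1 := (e.symm : PathSpace κ T →L[ℝ] PathSpace κ T).le_opNorm (e v)
  rw [← he]
  simpa using h1

/-- Passes from the equation between Fourier coefficients to an operator equation on the path space,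
on which the rest of the argument works. -/
lemma isLinSolution_iff {g : ℝ → ℝ} (hg1 : Continuous (deriv g)) {h : CM} {w : PathSpace κ T}
    {f : ℝ → Torus → ℝ} {ψ : C(Icc (0 : ℝ) T, CM)}
    (hf : ∀ s : Icc (0 : ℝ) T, f s =ᵐ[torusMeasure] ψ s) (v : PathSpace κ T) :
    IsLinSolution g h w f v ↔
      linOp hκ hκ1 hT (nem hg1 (ev hκ1 w)) h v = duhL hκ hκ1 hT ψ := by
  have h1 : ∀ t : Icc (0 : ℝ) T,
      duhamel (fun s x => deriv g (eval w s x) * eval v s x * h x) t + duhamel f t =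
      coeff (Hol.toC ((duhL hκ hκ1 hT (mulPath (nem hg1 (ev hκ1 w) * ev hκ1 v) h) +
        duhL hκ hκ1 hT ψ) t)) := fun t => by
    rw [ContinuousMap.add_apply, Hol.coeff_toC_add, coeff_duhL, coeff_duhL,
      duhamel_eq_duh hT hf t, duhamel_eq_duh hT (fun s => ?_) t]
    filter_upwards [coeFn_mulPath (nem hg1 (ev hκ1 w) * ev hκ1 v) h s] with x hx
    rw [hx, eval_eq hκ1 w s.2, eval_eq hκ1 v s.2]
    rfl
  rw [linOp_apply, sub_eq_iff_eq_add']
  refine ⟨fun hv => PathSpace.ext_coeff fun t => ?_, fun hv t => ?_⟩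
  · rw [hv t, h1]
  · rw [h1, ← hv]

include hκ hκ1 hT in
lemma existsUnique_isLinSolution {g : ℝ → ℝ} (hg1 : Continuous (deriv g)) {h : CM}
    {w : PathSpace κ T} {f : ℝ → Torus → ℝ} {ψ : C(Icc (0 : ℝ) T, CM)}
    (hf : ∀ s : Icc (0 : ℝ) T, f s =ᵐ[torusMeasure] ψ s) :
    ∃! v : PathSpace κ T, IsLinSolution g h w f v := by
  refine (existsUnique_congr fun v => ?_).2
    ((linOp_bijective hκ hκ1 hT (nem hg1 (ev hκ1 w)) h).existsUnique (duhL hκ hκ1 hT ψ))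
  exact isLinSolution_iff hκ hκ1 hT hg1 hf v

variable {g : ℝ → ℝ} {u₀ : C(Torus, ℝ)}

lemma isSolution_iff (hg0 : Continuous g) {b : PathSpace κ T}
    (hb : ∀ t : Icc (0 : ℝ) T, coeff (Hol.toC (b t)) = heat t (coeff u₀)) (k : CM)
    (w : PathSpace κ T) :
    IsSolution g u₀ k w ↔ w = b + duhL hκ hκ1 hT (mulPath (nem hg0 (ev hκ1 w)) k) := by
  have h1 : ∀ t : Icc (0 : ℝ) T,
      heat t (coeff u₀) + duhamel (fun s x => g (eval w s x) * k x) t =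
      coeff (Hol.toC ((b + duhL hκ hκ1 hT (mulPath (nem hg0 (ev hκ1 w)) k)) t)) := fun t => by
    rw [ContinuousMap.add_apply, Hol.coeff_toC_add, coeff_duhL, hb,
      duhamel_eq_duh hT (fun s => ?_) t]
    filter_upwards [coeFn_mulPath (nem hg0 (ev hκ1 w)) k s] with x hx
    rw [hx, eval_eq hκ1 w s.2]
    rfl
  refine ⟨fun hv => PathSpace.ext_coeff fun t => ?_, fun hv t => ?_⟩
  · rw [hv t, h1]
  · rw [h1, ← hv]

include hκ hκ1 hT in
lemma existsUnique_isSolution (hg : ContDiff ℝ 7 g)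
    (hgb : ∀ m ≤ 7, ∃ C, ∀ x, |iteratedDeriv m g x| ≤ C) (hu₀ : IsHolder (1 + 2 * κ) u₀) (k : CM) :
    ∃! w : PathSpace κ T, IsSolution g u₀ k w := by
  obtain ⟨b, hb⟩ := exists_heat_path (T := T) hκ hκ1 hu₀
  obtain ⟨L, hL⟩ := hgb 1 (by norm_num)
  have hL0 : 0 ≤ L := (abs_nonneg _).trans (hL 0)
  have key := existsUnique_fixedPoint hκ hκ1 hT
    (fun w : PathSpace κ T => mulPath (nem hg.continuous (ev hκ1 w)) k)
    (L * (1 - (2 : ℝ) ^ (-(1 - κ)))⁻¹ * ‖k‖) (fun w v t => by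
      rw [mulPath_apply, mulPath_apply, ← sub_apply, ← map_sub]
      refine (norm_mulCM_le _ _).trans ?_
      rw [mul_right_comm]
      refine mul_le_mul_of_nonneg_right ?_ (norm_nonneg k)
      rw [mul_assoc]
      refine le_trans ?_ (mul_le_mul_of_nonneg_left (norm_curry_ev_sub_le hκ1 w v t) hL0)
      refine (ContinuousMap.norm_le _ (by positivity)).2 fun x => ?_
      refine (abs_sub_le_of_abs_deriv_le (hg.differentiable (by norm_num))
        (by simpa using hL) _ _).trans ?_
      gcongr
      exact ((ev hκ1 w).curry t - (ev hκ1 v).curry t).norm_coe_le_norm x) b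
  refine (existsUnique_congr fun w => ?_).2 key
  exact isSolution_iff hκ hκ1 hT hg.continuous hb k w

lemma hasFDerivAt_nem_of_bound (hg : ContDiff ℝ 6 g)
    (hgb : ∀ m ≤ 6, ∃ C, ∀ x, |iteratedDeriv m g x| ≤ C) (hg1 : Continuous (deriv g)) (u : C(TimeSpace T, ℝ)) :
    HasFDerivAt (nem hg.continuous) (ContinuousLinearMap.mul ℝ C(TimeSpace T, ℝ) (nem hg1 u)) u := by
  obtain ⟨L, hL⟩ := hgb 2 (by norm_num)
  exact hasFDerivAt_nem (hg.differentiable (by norm_num)) hg1 ((abs_nonneg _).trans (hL 0))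
    (lipschitz_deriv_of_bound (hg.of_le (by norm_num)) hL) u

lemma hasDerivAt_nem_of_bound (hg : ContDiff ℝ 6 g)
    (hgb : ∀ m ≤ 6, ∃ C, ∀ x, |iteratedDeriv m g x| ≤ C) (hg1 : Continuous (deriv g)) {y : ℝ → PathSpace κ T}
    {y' : PathSpace κ T} (hy : HasDerivAt y y' 0) :
    HasDerivAt (fun ε => nem hg.continuous (ev hκ1 (y ε)))
      (nem hg1 (ev hκ1 (y 0)) * ev hκ1 y') 0 := by
  have h1 : HasDerivAt (fun ε => ev hκ1 (y ε)) (ev hκ1 y') 0 :=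
    (ev hκ1).hasFDerivAt.comp_hasDerivAt 0 hy
  have h2 := hasFDerivAt_nem_of_bound (T := T) hg hgb hg1 (ev hκ1 (y 0))
  exact h2.comp_hasDerivAt 0 h1

lemma hasDerivAt_line (h k : CM) : HasDerivAt (fun ε : ℝ => h + ε • k) k 0 := by
  simpa using ((hasDerivAt_id (0 : ℝ)).smul_const k).const_add h

lemma hasDerivAt_bilin {A H B X : Type*} [NormedAddCommGroup A] [NormedSpace ℝ A]
    [NormedAddCommGroup H] [NormedSpace ℝ H] [NormedAddCommGroup B] [NormedSpace ℝ B]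
    [NormedAddCommGroup X] [NormedSpace ℝ X] (D : B →L[ℝ] X) (M : A →L[ℝ] H →L[ℝ] B)
    {G : ℝ → A} {G' : A} {y : ℝ → H} {y' : H} (hG : HasDerivAt G G' 0) (hy : HasDerivAt y y' 0) :
    HasDerivAt (fun ε => D (M (G ε) (y ε))) (D (M G' (y 0)) + D (M (G 0) y')) 0 := by
  rw [← map_add]
  exact D.hasFDerivAt.comp_hasDerivAt 0 ((M.hasFDerivAt.comp_hasDerivAt 0 hG).clm_apply hy)

/-! ### Smoothness of the solution map and its variation equations -/

section Differentiability

variable (hg : ContDiff ℝ 7 g) (hgb : ∀ m ≤ 7, ∃ C, ∀ x, |iteratedDeriv m g x| ≤ C)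
  (hu₀ : IsHolder (1 + 2 * κ) u₀)

include hκ hκ1 hT hg hgb hu₀

lemma isSolution_sol (k : CM) : IsSolution g u₀ k (sol g u₀ k : PathSpace κ T) :=
  Classical.epsilon_spec (existsUnique_isSolution hκ hκ1 hT hg hgb hu₀ k).exists

lemma sol_eq {b : PathSpace κ T}
    (hb : ∀ t : Icc (0 : ℝ) T, coeff (Hol.toC (b t)) = heat t (coeff u₀)) (k : CM) :
    (sol g u₀ k : PathSpace κ T) =
      b + duhL hκ hκ1 hT (mulPath (nem hg.continuous (ev hκ1 (sol g u₀ k))) k) :=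
  (isSolution_iff hκ hκ1 hT hg.continuous hb k _).1 (isSolution_sol hκ hκ1 hT hg hgb hu₀ k)

/-- Implicit function theorem for the mild equation, viewed as a `C²` map of the pair `(k, w)`. The
partial derivative in `w` is a Volterra operator, hence invertible at every point. -/
lemma contDiff_sol : ContDiff ℝ 2 (sol g u₀ : CM → PathSpace κ T) := by
  have := completeSpace_path (T := T) hκ1
  obtain ⟨b, hb⟩ := exists_heat_path (T := T) hκ hκ1 hu₀
  have hg1 : Continuous (deriv g) := hg.continuous_deriv (by norm_num)
  rw [contDiff_iff_contDiffAt]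
  intro h
  let f : CM × PathSpace κ T → PathSpace κ T := fun p =>
    p.2 - b - duhL hκ hκ1 hT (mulPath (nem hg.continuous (ev hκ1 p.2)) p.1)
  have hnem : ContDiff ℝ 2 (nem hg.continuous : C(TimeSpace T, ℝ) → C(TimeSpace T, ℝ)) :=
    contDiff_nem 2 hg.continuous (hg.of_le (by norm_num)) fun m hm => hgb m (by omega)
  have hG : ContDiff ℝ 2 fun p : CM × PathSpace κ T => mulPath (nem hg.continuous (ev hκ1 p.2)) := by
    have h1 : ContDiff ℝ 2 (mulPath (T := T)) := ContinuousLinearMap.contDiff _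
    exact h1.comp (hnem.comp ((ev hκ1).contDiff.comp contDiff_snd))
  have hf : ContDiff ℝ 2 f :=
    (contDiff_snd.sub contDiff_const).sub ((duhL hκ hκ1 hT).contDiff.comp
      (hG.clm_apply contDiff_fst))
  have hf0 : ∀ k w, f (k, w) = 0 ↔ w = sol g u₀ k := fun k w => by
    have h1 : f (k, w) = 0 ↔ IsSolution g u₀ k w := by
      rw [isSolution_iff hκ hκ1 hT hg.continuous hb, ← sub_eq_iff_eq_add']
      exact sub_eq_zero
    rw [h1]
    refine ⟨fun hw => ?_, ?_⟩
    · exact (existsUnique_isSolution hκ hκ1 hT hg hgb hu₀ k).unique hw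
        (isSolution_sol hκ hκ1 hT hg hgb hu₀ k)
    · rintro rfl
      exact isSolution_sol hκ hκ1 hT hg hgb hu₀ k
  set u : CM × PathSpace κ T := (h, sol g u₀ h) with hu
  have hd : (fderiv ℝ f u).comp (ContinuousLinearMap.inr ℝ CM (PathSpace κ T)) =
      linOp hκ hκ1 hT (nem hg1 (ev hκ1 (sol g u₀ h))) h := by
    have h1 : HasFDerivAt (fun w => f (h, w)) ((fderiv ℝ f u).comp
        (ContinuousLinearMap.inr ℝ CM (PathSpace κ T))) (sol g u₀ h) := by
      have h2 : HasFDerivAt f (fderiv ℝ f u) (h, sol g u₀ h) :=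
        (hf.differentiable (by norm_num) u).hasFDerivAt
      exact h2.comp _ (hasFDerivAt_prodMk_right h (sol g u₀ h))
    refine h1.unique ?_
    have h3 := (hasFDerivAt_nem_of_bound (hg.of_le (by norm_num)) (fun m hm => hgb m (by omega)) hg1
      (ev hκ1 (sol g u₀ h : PathSpace κ T))).comp
      (sol g u₀ h) (ev hκ1).hasFDerivAt
    have h4 := ((duhL hκ hκ1 hT).comp (mulPath.flip h)).hasFDerivAt.comp (sol g u₀ h) h3
    exact ((hasFDerivAt_id (sol g u₀ h)).sub_const b).sub h4
  have hinv : ((fderiv ℝ f u).comp (ContinuousLinearMap.inr ℝ CM (PathSpace κ T))).IsInvertible := by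
    rw [hd]
    exact linOp_isInvertible hκ hκ1 hT _ _
  have hfu : ContDiffAt ℝ 2 f u := hf.contDiffAt
  have h5 := hfu.contDiffAt_implicitFunction two_ne_zero hinv
  -- The local implicit function solves the mild equation, so global uniqueness identifies it with
  -- `sol`.
  refine h5.congr_of_eventuallyEq ?_
  filter_upwards [hfu.eventually_apply_implicitFunction two_ne_zero hinv] with k hk
  rw [(hf0 h _).2 rfl, hf0] at hk
  exact hk.symm

lemma hasDerivAt_sol_line (h k : CM) :
    HasDerivAt (fun ε : ℝ => (sol g u₀ (h + ε • k) : PathSpace κ T)) (der1 g u₀ h k) 0 := by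
  have h1 : HasFDerivAt (sol g u₀ : CM → PathSpace κ T) (fderiv ℝ (sol g u₀) h) (h + (0 : ℝ) • k) := by
    rw [zero_smul, add_zero]
    exact ((contDiff_sol hκ hκ1 hT hg hgb hu₀).differentiable (by norm_num) _).hasFDerivAt
  exact h1.comp_hasDerivAt 0 (hasDerivAt_line h k)

lemma hasDerivAt_der1_line (h k l : CM) :
    HasDerivAt (fun ε : ℝ => (der1 g u₀ (h + ε • k) l : PathSpace κ T)) (der2 g u₀ h k l) 0 := by
  have hc : ContDiff ℝ 1 (fderiv ℝ (sol g u₀ : CM → PathSpace κ T)) :=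
    (contDiff_sol hκ hκ1 hT hg hgb hu₀).fderiv_right (by norm_num)
  have hf : HasFDerivAt (fderiv ℝ (sol g u₀ : CM → PathSpace κ T))
      (fderiv ℝ (fderiv ℝ (sol g u₀)) h) (h + (0 : ℝ) • k) := by
    rw [zero_smul, add_zero]
    exact (hc.differentiable (by norm_num) _).hasFDerivAt
  have h2 : (der2 g u₀ h k l : PathSpace κ T) = fderiv ℝ (fderiv ℝ (sol g u₀)) h k l := by
    rw [der2, iteratedFDeriv_two_apply]; rfl
  rw [h2]
  have h3 := hf.clm_apply (hasFDerivAt_const l _)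
  have h4 := h3.comp_hasDerivAt 0 (hasDerivAt_line h k)
  simp only [ContinuousLinearMap.comp_zero, zero_add, ContinuousLinearMap.flip_apply] at h4
  exact h4

/-- The first variation equation. -/
lemma der1_eq (hg1 : Continuous (deriv g)) (h k : CM) :
    (der1 g u₀ h k : PathSpace κ T) =
      duhL hκ hκ1 hT (mulPath (nem hg1 (ev hκ1 (sol g u₀ h)) * ev hκ1 (der1 g u₀ h k)) h) +
      duhL hκ hκ1 hT (mulPath (nem hg.continuous (ev hκ1 (sol g u₀ h))) k) := by
  obtain ⟨b, hb⟩ := exists_heat_path (T := T) hκ hκ1 hu₀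
  have h1 := hasDerivAt_sol_line (T := T) hκ hκ1 hT hg hgb hu₀ h k
  have h2 := hasDerivAt_nem_of_bound hκ1 (hg.of_le (by norm_num)) (fun m hm => hgb m (by omega)) hg1 h1
  have h3 := (hasDerivAt_bilin (duhL hκ hκ1 hT) mulPath h2 (hasDerivAt_line h k)).const_add b
  have h4 := h1.unique (h3.congr_of_eventuallyEq (.of_forall fun ε =>
    sol_eq hκ hκ1 hT hg hgb hu₀ hb (h + ε • k)))
  rwa [zero_smul, add_zero] at h4

/-- Differentiates the first variation equation along `h + ε k` by the product rule. The two factors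
`k` and `l` outside the nonlinearity produce the singular source, the derivative of `g'(w)` the
regular one. -/
lemma der2_eq (hg1 : Continuous (deriv g)) (hg2 : Continuous (iteratedDeriv 2 g)) (h k l : CM) :
    (der2 g u₀ h k l : PathSpace κ T) =
      duhL hκ hκ1 hT (mulPath (nem hg1 (ev hκ1 (sol g u₀ h)) * ev hκ1 (der2 g u₀ h k l)) h) +
      duhL hκ hκ1 hT (mulPath (nem hg2 (ev hκ1 (sol g u₀ h)) * ev hκ1 (der1 g u₀ h k) *
        ev hκ1 (der1 g u₀ h l)) h) +
      duhL hκ hκ1 hT (mulPath (nem hg1 (ev hκ1 (sol g u₀ h)) * ev hκ1 (der1 g u₀ h k)) l +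
        mulPath (nem hg1 (ev hκ1 (sol g u₀ h)) * ev hκ1 (der1 g u₀ h l)) k) := by
  have hd2 : deriv (deriv g) = iteratedDeriv 2 g := by
    rw [iteratedDeriv_succ, iteratedDeriv_one]
  have hg2' : Continuous (deriv (deriv g)) := hd2 ▸ hg2
  have hn2 : ∀ u : C(TimeSpace T, ℝ), nem hg2' u = nem hg2 u := fun u => by
    ext p; rw [nem_apply, nem_apply, hd2]
  have hgd : ContDiff ℝ 6 (deriv g) :=
    ((contDiff_succ_iff_deriv (n := 6)).1 (hg.of_le (by norm_num))).2.2
  have hgdb : ∀ m ≤ 6, ∃ C, ∀ x, |iteratedDeriv m (deriv g) x| ≤ C := fun m hm => by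
    obtain ⟨C, hC⟩ := hgb (m + 1) (by omega)
    exact ⟨C, fun x => by rw [← iteratedDeriv_succ']; exact hC x⟩
  have h1 := hasDerivAt_sol_line (T := T) hκ hκ1 hT hg hgb hu₀ h k
  have hv := hasDerivAt_der1_line (T := T) hκ hκ1 hT hg hgb hu₀ h k l
  have hN0 := hasDerivAt_nem_of_bound hκ1 (hg.of_le (by norm_num)) (fun m hm => hgb m (by omega)) hg1 h1
  have hN1 : HasDerivAt (fun ε : ℝ => nem hg1 (ev hκ1 (sol g u₀ (h + ε • k) : PathSpace κ T)))
      _ 0 := hasDerivAt_nem_of_bound hκ1 hgd hgdb hg2' h1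
  have hev : HasDerivAt (fun ε : ℝ => ev hκ1 (der1 g u₀ (h + ε • k) l : PathSpace κ T))
      (ev hκ1 (der2 g u₀ h k l)) 0 := (ev hκ1).hasFDerivAt.comp_hasDerivAt 0 hv
  have h3 := (hasDerivAt_bilin (duhL (κ := κ) hκ hκ1 hT) mulPath (hN1.fun_mul hev)
    (hasDerivAt_line h k)).fun_add
    (hasDerivAt_bilin (duhL (κ := κ) hκ hκ1 hT) mulPath hN0 (hasDerivAt_const (0 : ℝ) l))
  have h4 := hv.unique (h3.congr_of_eventuallyEq (.of_forall fun ε =>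
    der1_eq hκ hκ1 hT hg hgb hu₀ hg1 (h + ε • k) l))
  rw [zero_smul, add_zero] at h4
  refine h4.trans ?_
  rw [hn2, map_zero, map_zero, add_zero, map_add (mulPath (T := T)), add_apply, map_add, map_add]
  abel

end Differentiability

end SolutionMap

end GPAM

namespace GPAM

/-! ### The two parts of the second derivative and the form `q` -/

section Parts

variable {κ T : ℝ} (hκ : 0 < κ) (hκ1 : κ < 1) (hT : 0 ≤ T) {g : ℝ → ℝ} {u₀ : C(Torus, ℝ)}

lemma regularSource_ae_eq (hg2 : Continuous (iteratedDeriv 2 g)) (h k l : CM) (s : Icc (0 : ℝ) T) :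
    regularSource g u₀ h κ T k l s =ᵐ[torusMeasure]
      mulPath (nem hg2 (ev hκ1 (sol g u₀ h)) * ev hκ1 (der1 g u₀ h k) *
        ev hκ1 (der1 g u₀ h l)) h s := by
  filter_upwards [coeFn_mulPath (nem hg2 (ev hκ1 (sol g u₀ h)) * ev hκ1 (der1 g u₀ h k) *
        ev hκ1 (der1 g u₀ h l)) h s] with x hx
  rw [hx, regularSource, eval_eq hκ1 _ s.2, eval_eq hκ1 _ s.2, eval_eq hκ1 _ s.2]
  rfl

lemma singularSource_ae_eq (hg1 : Continuous (deriv g)) (h k l : CM) (s : Icc (0 : ℝ) T) :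
    singularSource g u₀ h κ T k l s =ᵐ[torusMeasure]
      (mulPath (nem hg1 (ev hκ1 (sol g u₀ h)) * ev hκ1 (der1 g u₀ h k)) l +
        mulPath (nem hg1 (ev hκ1 (sol g u₀ h)) * ev hκ1 (der1 g u₀ h l)) k :
        C(Icc (0 : ℝ) T, CM)) s := by
  filter_upwards [coeFn_mulPath (nem hg1 (ev hκ1 (sol g u₀ h)) * ev hκ1 (der1 g u₀ h k)) l s,
    coeFn_mulPath (nem hg1 (ev hκ1 (sol g u₀ h)) * ev hκ1 (der1 g u₀ h l)) k s,
    Lp.coeFn_add (mulPath (nem hg1 (ev hκ1 (sol g u₀ h)) * ev hκ1 (der1 g u₀ h k)) l s)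
      (mulPath (nem hg1 (ev hκ1 (sol g u₀ h)) * ev hκ1 (der1 g u₀ h l)) k s)] with x h1 h2 h3
  rw [ContinuousMap.add_apply, h3, Pi.add_apply, h1, h2, singularSource, eval_eq hκ1 _ s.2,
    eval_eq hκ1 _ s.2, eval_eq hκ1 _ s.2]
  rfl

include hκ hκ1 hT

lemma existsUnique_isRegularPart (hg1 : Continuous (deriv g)) (hg2 : Continuous (iteratedDeriv 2 g))
    (h k l : CM) : ∃! v : PathSpace κ T, IsRegularPart g u₀ h k l v :=
  existsUnique_isLinSolution hκ hκ1 hT hg1 (regularSource_ae_eq hκ1 hg2 h k l)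

lemma existsUnique_isSingularPart (hg1 : Continuous (deriv g)) (h k l : CM) :
    ∃! v : PathSpace κ T, IsSingularPart g u₀ h k l v :=
  existsUnique_isLinSolution hκ hκ1 hT hg1 (singularSource_ae_eq hκ1 hg1 h k l)

lemma linOp_regularPart (hg1 : Continuous (deriv g)) (hg2 : Continuous (iteratedDeriv 2 g))
    (h k l : CM) :
    linOp hκ hκ1 hT (nem hg1 (ev hκ1 (sol g u₀ h))) h (regularPart g u₀ h k l : PathSpace κ T) =
      duhL hκ hκ1 hT (mulPath (nem hg2 (ev hκ1 (sol g u₀ h)) * ev hκ1 (der1 g u₀ h k) *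
        ev hκ1 (der1 g u₀ h l)) h) :=
  (isLinSolution_iff hκ hκ1 hT hg1 (regularSource_ae_eq hκ1 hg2 h k l) _).1
    (Classical.epsilon_spec (existsUnique_isRegularPart hκ hκ1 hT hg1 hg2 h k l).exists)

lemma linOp_singularPart (hg1 : Continuous (deriv g)) (h k l : CM) :
    linOp hκ hκ1 hT (nem hg1 (ev hκ1 (sol g u₀ h))) h (singularPart g u₀ h k l : PathSpace κ T) =
      duhL hκ hκ1 hT (mulPath (nem hg1 (ev hκ1 (sol g u₀ h)) * ev hκ1 (der1 g u₀ h k)) l +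
        mulPath (nem hg1 (ev hκ1 (sol g u₀ h)) * ev hκ1 (der1 g u₀ h l)) k) :=
  (isLinSolution_iff hκ hκ1 hT hg1 (singularSource_ae_eq hκ1 hg1 h k l) _).1
    (Classical.epsilon_spec (existsUnique_isSingularPart hκ hκ1 hT hg1 h k l).exists)

variable (hg : ContDiff ℝ 7 g) (hgb : ∀ m ≤ 7, ∃ C, ∀ x, |iteratedDeriv m g x| ≤ C)
  (hu₀ : IsHolder (1 + 2 * κ) u₀)

include hg hgb hu₀

/-- Both sides have the same image under the injective operator `linOp`. -/
lemma der2_eq_regularPart_add_singularPart (h k l : CM) :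
    (der2 g u₀ h k l : PathSpace κ T) = regularPart g u₀ h k l + singularPart g u₀ h k l := by
  have hg1 : Continuous (deriv g) := hg.continuous_deriv (by norm_num)
  have hg2 : Continuous (iteratedDeriv 2 g) := hg.continuous_iteratedDeriv 2 (by norm_num)
  apply (linOp_bijective hκ hκ1 hT (nem hg1 (ev hκ1 (sol g u₀ h))) h).1
  rw [map_add, linOp_regularPart hκ hκ1 hT hg1 hg2, linOp_singularPart hκ hκ1 hT hg1, linOp_apply]
  have h1 := der2_eq (T := T) hκ hκ1 hT hg hgb hu₀ hg1 hg2 h k l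
  rw [add_assoc] at h1
  exact sub_eq_iff_eq_add'.2 h1

lemma formQ_eq (F : PathSpace κ T → ℝ) (h k l : CM) :
    formQ g u₀ F h k l = fderiv ℝ F (sol g u₀ h) (regularPart g u₀ h k l) +
      iteratedFDeriv ℝ 2 F (sol g u₀ h) ![der1 g u₀ h k, der1 g u₀ h l] := by
  rw [formQ, formA, formASing, der2_eq_regularPart_add_singularPart hκ hκ1 hT hg hgb hu₀, map_add]
  ring

lemma linOp_der1 (hg1 : Continuous (deriv g)) (h k : CM) :
    linOp hκ hκ1 hT (nem hg1 (ev hκ1 (sol g u₀ h))) h (der1 g u₀ h k : PathSpace κ T) =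
      duhL hκ hκ1 hT (mulPath (nem hg.continuous (ev hκ1 (sol g u₀ h))) k) := by
  rw [linOp_apply]
  exact sub_eq_iff_eq_add'.2 (der1_eq (T := T) hκ hκ1 hT hg hgb hu₀ hg1 h k)

/-- The form `q` is a continuous symmetric bilinear form of the first derivatives of the solution
map. -/
lemma exists_formQ_eq_bilin {F : PathSpace κ T → ℝ} {h : CM}
    (hF : ContDiffAt ℝ 2 F (sol g u₀ h)) :
    ∃ B : PathSpace κ T →L[ℝ] PathSpace κ T →L[ℝ] ℝ, (∀ y z, B y z = B z y) ∧
      ∀ k l, formQ g u₀ F h k l = B (der1 g u₀ h k) (der1 g u₀ h l) := by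
  have hg1 : Continuous (deriv g) := hg.continuous_deriv (by norm_num)
  have hg2 : Continuous (iteratedDeriv 2 g) := hg.continuous_iteratedDeriv 2 (by norm_num)
  obtain ⟨e, he⟩ := linOp_isInvertible hκ hκ1 hT (nem hg1 (ev hκ1 (sol g u₀ h))) h
  -- `Λ` composes `DF`, the inverse Volterra operator and the Duhamel integral of a multiple of `h`,
  -- so that `DF[v^reg] = Λ(g''(w) v_k v_l)`.
  let Λ : C(TimeSpace T, ℝ) →L[ℝ] ℝ := (fderiv ℝ F (sol g u₀ h)).comp
    ((e.symm : PathSpace κ T →L[ℝ] PathSpace κ T).comp ((duhL hκ hκ1 hT).comp (mulPath.flip h)))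
  let B₁ : PathSpace κ T →L[ℝ] PathSpace κ T →L[ℝ] ℝ :=
    (ContinuousLinearMap.compL ℝ _ _ _ Λ).comp
      (((ContinuousLinearMap.mul ℝ C(TimeSpace T, ℝ)).bilinearComp
        ((ContinuousLinearMap.mul ℝ _ (nem hg2 (ev hκ1 (sol g u₀ h)))).comp (ev hκ1)) (ev hκ1)))
  have hB₁ : ∀ y z, B₁ y z = Λ (nem hg2 (ev hκ1 (sol g u₀ h)) * ev hκ1 y * ev hκ1 z) :=
    fun y z => rfl
  refine ⟨B₁ + fderiv ℝ (fderiv ℝ F) (sol g u₀ h), fun y z => ?_, fun k l => ?_⟩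
  · have h1 := (hF.isSymmSndFDerivAt (by simp)).eq y z
    simp only [add_apply, hB₁]
    rw [h1, mul_right_comm]
  · rw [formQ_eq hκ hκ1 hT hg hgb hu₀, iteratedFDeriv_two_apply]
    have h1 : (regularPart g u₀ h k l : PathSpace κ T) = e.symm (duhL hκ hκ1 hT
        (mulPath (nem hg2 (ev hκ1 (sol g u₀ h)) * ev hκ1 (der1 g u₀ h k) *
        ev hκ1 (der1 g u₀ h l)) h)) := by
      rw [ContinuousLinearEquiv.eq_symm_apply, ← linOp_regularPart hκ hκ1 hT hg1 hg2, ← he]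
      rfl
    rw [h1]
    rfl

end Parts

lemma contDiffAt_two_of_differentiableOn {E : Type*} [NormedAddCommGroup E] [NormedSpace ℝ E]
    {F : E → ℝ} {U : Set E} (hU : IsOpen U)
    (hF : ∀ m < 3, DifferentiableOn ℝ (iteratedFDeriv ℝ m F) U) {x : E} (hx : x ∈ U) :
    ContDiffAt ℝ 2 F x := by
  refine ContDiffOn.contDiffAt (s := U) ?_ (hU.mem_nhds hx)
  refine contDiffOn_of_differentiableOn (n := 2) fun m hm => ?_
  have hm' : m ≤ 2 := by exact_mod_cast hm
  exact (hF m (by omega)).congr fun y hy => iteratedFDerivWithin_of_isOpen m hU hy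

end GPAM

namespace GPAM

/-! ### Dyadic `L²` bounds -/

/-- The bounds `‖Δ_j c‖_{L²} ≤ M 2^{-γ j}`. -/
def DyadicL2 (γ M : ℝ) (c : Coeffs) : Prop :=
  ∀ j, ∑ n ∈ freqBox j, ‖(dyadic j n : ℂ) * c n‖ ^ 2 ≤ (M * ((2 : ℝ) ^ (-γ)) ^ j) ^ 2

/-- The torus has measure one, so `L²` norms are at most sup norms. -/
lemma dyadicL2_of_blockNorm_le {γ M : ℝ} {c : Coeffs} (h : ∀ j, blockNorm γ j c ≤ M) :
    DyadicL2 γ M c := fun j => by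
  rw [← integral_sq_norm_trig, ← block_eq_trig]
  refine (integral_sq_norm_le _).trans ?_
  gcongr
  exact norm_block_le_of_blockNorm_le (h j)

lemma DyadicL2.add {γ M N : ℝ} (hM : 0 ≤ M) (hN : 0 ≤ N) {c d : Coeffs} (hc : DyadicL2 γ M c)
    (hd : DyadicL2 γ N d) : DyadicL2 γ (2 * (M + N)) (c + d) := fun j => by
  have h1 : ∀ z w : ℂ, ‖z + w‖ ^ 2 ≤ 2 * ‖z‖ ^ 2 + 2 * ‖w‖ ^ 2 := fun z w => by
    have := norm_add_le z w
    nlinarith [norm_nonneg (z + w), sq_nonneg (‖z‖ - ‖w‖)]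
  have h2 : ∑ n ∈ freqBox j, ‖(dyadic j n : ℂ) * (c + d) n‖ ^ 2 ≤
      2 * ∑ n ∈ freqBox j, ‖(dyadic j n : ℂ) * c n‖ ^ 2 +
      2 * ∑ n ∈ freqBox j, ‖(dyadic j n : ℂ) * d n‖ ^ 2 := by
    rw [Finset.mul_sum, Finset.mul_sum, ← Finset.sum_add_distrib]
    refine Finset.sum_le_sum fun n _ => ?_
    rw [Pi.add_apply, mul_add]
    exact h1 _ _
  refine h2.trans ?_
  have h3 := hc j
  have h4 := hd j
  rw [mul_pow] at h3 h4 ⊢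
  have h5 : 0 ≤ (((2 : ℝ) ^ (-γ)) ^ j) ^ 2 := sq_nonneg _
  have h6 : 0 ≤ M * N * (((2 : ℝ) ^ (-γ)) ^ j) ^ 2 := by positivity
  nlinarith [mul_nonneg (sq_nonneg M) h5, mul_nonneg (sq_nonneg N) h5]

lemma exp_neg_le {T τ : ℝ} (hτ : τ ≤ T) (j : ℕ) :
    Real.exp (-((4 ^ j - 1) * τ)) ≤ Real.exp T * Real.exp (-(4 ^ j * τ)) := by
  rw [← Real.exp_add]
  exact Real.exp_le_exp.2 (by linarith)

/-- Measured in `L²`, a source bounded in `L²` gains two full derivatives: `4 ^ j` is the decay rate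
of the `j`-th block. The factor `exp T` compensates the `-1` in `le_lam`. -/
lemma dyadicL2_duh {T : ℝ} (hT : 0 ≤ T) {γ : ℝ} (hγ : γ ≤ 2) (φ : C(Icc (0 : ℝ) T, CM)) {t : ℝ}
    (ht : t ∈ Icc 0 T) : DyadicL2 γ (Real.exp T * ‖φ‖) (duh hT φ t) := fun j => by
  -- These vectors turn the `ℓ²` norm of the block coefficients into the norm of a vector valued
  -- sum, so that the integral can be estimated under the norm.
  let v : Freq → EuclideanSpace ℂ (freqBox j) := fun n =>
    WithLp.toLp 2 fun m => if m.1 = n then (dyadic j n : ℂ) else 0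
  have hv : ∀ c : Coeffs, ‖∑ n ∈ freqBox j, c n • v n‖ ^ 2 =
      ∑ n ∈ freqBox j, ‖(dyadic j n : ℂ) * c n‖ ^ 2 := fun c => by
    rw [EuclideanSpace.norm_sq_eq,
      ← Finset.sum_coe_sort (freqBox j) fun n => ‖(dyadic j n : ℂ) * c n‖ ^ 2]
    refine Finset.sum_congr rfl fun m _ => ?_
    congr 2
    rw [WithLp.ofLp_sum, Finset.sum_apply, Finset.sum_eq_single m.1]
    · simp [v, mul_comm]
    · intro n _ hn
      simp [v, hn.symm]
    · exact fun h => (h m.2).elim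
  rw [← hv]
  gcongr
  have h1 := norm_sum_duh_smul_le hT φ ht.1 (freqBox j) v
    (B := fun r => Real.exp T * ‖φ‖ * Real.exp (-(4 ^ j * (t - r)))) (by fun_prop)
    (fun r hr => by
      refine le_of_sq_le_sq ?_ (by positivity)
      rw [hv]
      refine (sum_sq_dyadic_heat_le j (sub_nonneg.2 hr.2) (freqBox j)
        (sum_sq_coeff_le _ _)).trans ?_
      refine pow_le_pow_left₀ (by positivity) ?_ 2
      rw [mul_right_comm]
      exact mul_le_mul (exp_neg_le (by linarith [hr.1, ht.2]) j) (φ.norm_coe_le_norm _)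
        (norm_nonneg _) (by positivity))
  refine h1.trans ?_
  rw [intervalIntegral.integral_const_mul]
  gcongr
  refine (integral_exp_le (by positivity)).trans ?_
  rw [one_div, ← inv_pow]
  gcongr
  rw [show (4 : ℝ)⁻¹ = 2 ^ (-2 : ℝ) by rw [Real.rpow_neg (by norm_num)]; norm_num]
  exact Real.rpow_le_rpow_of_exponent_le (by norm_num) (by linarith)

/-- At the least `J` with `|n| ≤ 2 ^ J`, the cut-offs of the two last blocks are `x` and `1 - x`,
and `x² + (1 - x)² ≥ 1/2`. For `J = 0` the block `0` alone has value one. -/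
lemma exists_one_le_sum_sq_dyadic (n : Freq) :
    ∃ J, ∀ J' ≥ J, 1 ≤ 2 * ∑ j ∈ Finset.range J', dyadic j n ^ 2 := by
  classical
  have hex : ∃ J : ℕ, freqNorm n ≤ 2 ^ J := by
    obtain ⟨J, hJ⟩ := pow_unbounded_of_one_lt (freqNorm n) (one_lt_two)
    exact ⟨J, hJ.le⟩
  have hsum : ∀ (s : Finset ℕ) (J' : ℕ), s ⊆ Finset.range J' →
      ∑ j ∈ s, dyadic j n ^ 2 ≤ ∑ j ∈ Finset.range J', dyadic j n ^ 2 := fun s J' h =>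
    Finset.sum_le_sum_of_subset_of_nonneg h fun j _ _ => sq_nonneg _
  obtain ⟨J, hJ, hmin⟩ : ∃ J, freqNorm n ≤ 2 ^ J ∧ ∀ i < J, (2 : ℝ) ^ i < freqNorm n :=
    ⟨Nat.find hex, Nat.find_spec hex, fun i hi => not_le.1 (Nat.find_min hex hi)⟩
  refine ⟨J + 1, fun J' hJ' => ?_⟩
  have h1 := lowPass_eq_one hJ
  cases J with
  | zero =>
    have h2 := hsum {0} J' (by rw [Finset.singleton_subset_iff, Finset.mem_range]; omega)
    rw [Finset.sum_singleton, show dyadic 0 n = 1 from h1] at h2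
    linarith
  | succ p =>
    have h2 := hsum {p, p + 1} J' (by
      intro i hi
      simp only [Finset.mem_insert, Finset.mem_singleton] at hi
      rw [Finset.mem_range]
      omega)
    rw [Finset.sum_pair (by omega)] at h2
    have h3 : dyadic (p + 1) n = 1 - lowPass p n := by rw [← h1]; rfl
    have h4 : dyadic p n = lowPass p n := by
      cases p with
      | zero => rfl
      | succ q =>
        show lowPass (q + 1) n - lowPass q n = _
        rw [lowPass_eq_zero (hmin (q + 1) (by omega)).le, sub_zero]
    rw [h3, h4] at h2
    nlinarith [sq_nonneg (2 * lowPass p n - 1)]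

/-- A multiplier of order `r` acts on a function with `γ > r` derivatives in `L²`. Almost
orthogonality of the blocks reduces the sum to a geometric series of ratio `4 ^ (r - γ)`. -/
lemma DyadicL2.sum_sq_le {γ M r K : ℝ} {c : Coeffs} (hc : DyadicL2 γ M c) (hr : r < γ)
    {m : Freq → ℂ} (hm : ∀ j n, dyadic j n ≠ 0 → ‖m n‖ ≤ K * ((2 : ℝ) ^ r) ^ j)
    (s : Finset Freq) :
    ∑ n ∈ s, ‖m n * c n‖ ^ 2 ≤ 2 * (1 - ((2 : ℝ) ^ (r - γ)) ^ 2)⁻¹ * (K * M) ^ 2 := by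
  choose J hJ using exists_one_le_sum_sq_dyadic
  set J' := s.sup J
  set q : ℝ := ((2 : ℝ) ^ (r - γ)) ^ 2 with hq
  have hq0 : 0 ≤ q := sq_nonneg _
  have hq1 : q < 1 :=
    pow_lt_one₀ (by positivity) (Real.rpow_lt_one_of_one_lt_of_neg one_lt_two (by linarith))
      two_ne_zero
  have h1 : ∀ n ∈ s, ‖m n * c n‖ ^ 2 ≤
      2 * ∑ j ∈ Finset.range J', ‖m n‖ ^ 2 * ‖(dyadic j n : ℂ) * c n‖ ^ 2 := fun n hn => by
    have h2 := mul_le_mul_of_nonneg_right (hJ n J' (Finset.le_sup hn)) (sq_nonneg ‖m n * c n‖)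
    rw [one_mul, mul_assoc, Finset.sum_mul] at h2
    refine h2.trans_eq ?_
    congr 1
    refine Finset.sum_congr rfl fun j _ => ?_
    rw [norm_mul, norm_mul, Complex.norm_real, Real.norm_eq_abs, mul_pow, mul_pow, sq_abs]
    ring
  have h2 : ∀ j, ∑ n ∈ s, ‖m n‖ ^ 2 * ‖(dyadic j n : ℂ) * c n‖ ^ 2 ≤ (K * M) ^ 2 * q ^ j :=
    fun j => by
    calc ∑ n ∈ s, ‖m n‖ ^ 2 * ‖(dyadic j n : ℂ) * c n‖ ^ 2
        ≤ ∑ n ∈ s, (K * ((2 : ℝ) ^ r) ^ j) ^ 2 * ‖(dyadic j n : ℂ) * c n‖ ^ 2 := by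
          refine Finset.sum_le_sum fun n _ => ?_
          by_cases hn : dyadic j n = 0
          · simp [hn]
          · gcongr
            exact hm j n hn
      _ ≤ (K * ((2 : ℝ) ^ r) ^ j) ^ 2 * ∑ n ∈ freqBox j, ‖(dyadic j n : ℂ) * c n‖ ^ 2 := by
          rw [← Finset.mul_sum]
          refine mul_le_mul_of_nonneg_left ?_ (sq_nonneg _)
          classical
          rw [← Finset.sum_filter_of_ne (p := fun n => n ∈ freqBox j) fun n _ hn => by
            by_contra hnb
            exact hn (by simp [dyadic_eq_zero hnb])]
          exact Finset.sum_le_sum_of_subset_of_nonneg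
            (fun n hn => (Finset.mem_filter.1 hn).2) fun n _ _ => by positivity
      _ ≤ (K * ((2 : ℝ) ^ r) ^ j) ^ 2 * (M * ((2 : ℝ) ^ (-γ)) ^ j) ^ 2 := by
          gcongr
          exact hc j
      _ = (K * M) ^ 2 * q ^ j := by
          rw [hq, sub_eq_add_neg, Real.rpow_add two_pos]
          ring
  calc ∑ n ∈ s, ‖m n * c n‖ ^ 2
      ≤ ∑ n ∈ s, 2 * ∑ j ∈ Finset.range J', ‖m n‖ ^ 2 * ‖(dyadic j n : ℂ) * c n‖ ^ 2 :=
        Finset.sum_le_sum h1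
    _ = 2 * ∑ j ∈ Finset.range J', ∑ n ∈ s, ‖m n‖ ^ 2 * ‖(dyadic j n : ℂ) * c n‖ ^ 2 := by
        rw [← Finset.mul_sum, Finset.sum_comm]
    _ ≤ 2 * ∑ j ∈ Finset.range J', (K * M) ^ 2 * q ^ j := by
        gcongr with j _
        exact h2 j
    _ = 2 * (∑ j ∈ Finset.range J', q ^ j) * (K * M) ^ 2 := by
        rw [← Finset.mul_sum]; ring
    _ ≤ 2 * (1 - q)⁻¹ * (K * M) ^ 2 := by
        gcongr
        rw [← tsum_geometric_of_lt_one hq0 hq1]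
        exact (summable_geometric_of_lt_one hq0 hq1).sum_le_tsum _ fun j _ => by positivity

/-! ### Translations -/

/-- Translation by `θ` in the `i`-th coordinate direction. -/
noncomputable def shift (i : Fin 2) (θ : ℝ) : Torus := Pi.single i (θ : UnitAddCircle)

lemma mFourier_shift (n : Freq) (i : Fin 2) (θ : ℝ) :
    UnitAddTorus.mFourier n (shift i θ) =
      Complex.exp (Complex.I * ((2 * Real.pi * n i * θ : ℝ) : ℂ)) := by
  show ∏ j, fourier (n j) (shift i θ j) = _
  rw [Finset.prod_eq_single i]
  · rw [shift, Pi.single_eq_same, fourier_coe_apply]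
    congr 1
    push_cast
    ring
  · intro j _ hj
    rw [shift, Pi.single_eq_of_ne hj]
    simp
  · simp

lemma norm_mFourier_shift_sub_one (n : Freq) (i : Fin 2) (θ : ℝ) :
    ‖UnitAddTorus.mFourier n (shift i θ) - 1‖ = 2 * |Real.sin (Real.pi * (n i * θ))| := by
  rw [mFourier_shift, Complex.norm_exp_I_mul_ofReal_sub_one, Real.norm_eq_abs, abs_mul,
    abs_of_pos two_pos]
  ring_nf

/-- With `x = θ 2 ^ j` the left side is at most `2` and at most `4πx`; both are below `4π x ^ ρ`,
the first for `x ≥ 1` and the second for `x ≤ 1`. -/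
lemma norm_mFourier_shift_sub_one_le {ρ : ℝ} (hρ : 0 ≤ ρ) (hρ1 : ρ ≤ 1) {j : ℕ} {n : Freq}
    (hn : dyadic j n ≠ 0) (i : Fin 2) {θ : ℝ} (hθ : 0 < θ) :
    ‖UnitAddTorus.mFourier n (shift i θ) - 1‖ ≤ 4 * Real.pi * θ ^ ρ * ((2 : ℝ) ^ ρ) ^ j := by
  have hpi := Real.pi_gt_three
  set x : ℝ := θ * 2 ^ j with hx
  have hx0 : 0 < x := by positivity
  have hxρ : θ ^ ρ * ((2 : ℝ) ^ ρ) ^ j = x ^ ρ := by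
    rw [hx, Real.mul_rpow hθ.le (by positivity), ← Real.rpow_natCast (2 ^ ρ), ← Real.rpow_mul
      (by norm_num), ← Real.rpow_natCast, ← Real.rpow_mul (by norm_num), mul_comm ρ]
  rw [norm_mFourier_shift_sub_one, mul_assoc _ (θ ^ ρ), hxρ]
  rcases le_total 1 x with h1 | h1
  · have h2 := Real.abs_sin_le_one (Real.pi * (n i * θ))
    have h3 := Real.one_le_rpow h1 hρ
    nlinarith
  · have h2 : |Real.sin (Real.pi * (n i * θ))| ≤ |Real.pi * (n i * θ)| := Real.abs_sin_le_abs
    have h3 : |(n i : ℝ)| ≤ 2 * 2 ^ j := by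
      have := (abs_le_freqNorm n i).trans (freqNorm_lt_of_dyadic_ne_zero hn).le
      rwa [pow_succ, mul_comm] at this
    have h4 : |Real.pi * (n i * θ)| ≤ Real.pi * (2 * x) := by
      rw [abs_mul, abs_mul, abs_of_pos Real.pi_pos, abs_of_pos hθ]
      refine mul_le_mul_of_nonneg_left ?_ Real.pi_pos.le
      calc |(n i : ℝ)| * θ ≤ 2 * 2 ^ j * θ := by gcongr
        _ = 2 * x := by rw [hx]; ring
    have h5 : x ≤ x ^ ρ := by
      conv_lhs => rw [← Real.rpow_one x]
      exact Real.rpow_le_rpow_of_exponent_ge hx0 h1 hρ1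
    nlinarith

/-- The step puts `z = |n i| θ` between `1/64` and `1/2`, a range in which `2 sin (π z) ≥ 4 z`. -/
lemma le_norm_mFourier_shift_sub_one {l : ℕ} {n : Freq} {i : Fin 2}
    (h1 : (2 : ℝ) ^ l ≤ 8 * |(n i : ℝ)|) (h2 : |(n i : ℝ)| ≤ 4 * 2 ^ l) :
    1 / 16 ≤ ‖UnitAddTorus.mFourier n (shift i (2 ^ (l + 3))⁻¹) - 1‖ := by
  rw [norm_mFourier_shift_sub_one]
  set z : ℝ := |(n i : ℝ)| * (2 ^ (l + 3))⁻¹ with hz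
  have hpos : (0 : ℝ) < 2 ^ (l + 3) := by positivity
  have hz1 : 1 / 64 ≤ z := by
    rw [hz, ← div_eq_mul_inv, le_div_iff₀ hpos, pow_add]
    linarith
  have hz2 : z ≤ 1 / 2 := by
    rw [hz, ← div_eq_mul_inv, div_le_iff₀ hpos, pow_add]
    linarith
  have h3 : |Real.sin (Real.pi * (n i * (2 ^ (l + 3))⁻¹))| = Real.sin (Real.pi * z) := by
    have h4 : 0 ≤ Real.sin (Real.pi * z) := by
      apply Real.sin_nonneg_of_nonneg_of_le_pi
      · have := Real.pi_pos; nlinarith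
      · have := Real.pi_pos; nlinarith
    rw [← abs_of_nonneg h4, hz]
    rcases abs_cases (n i : ℝ) with ⟨h, _⟩ | ⟨h, _⟩
    · rw [h]
    · rw [h, neg_mul, mul_neg, Real.sin_neg, abs_neg]
  rw [h3]
  have h5 := Real.mul_le_sin (x := Real.pi * z) (by have := Real.pi_pos; nlinarith)
    (by have := Real.pi_pos; nlinarith)
  have h6 : 2 / Real.pi * (Real.pi * z) = 2 * z := by field_simp
  linarith

end GPAM

namespace GPAM

/-! ### Finite differences of functions on the torus -/

/-- The difference `x ↦ f (x + y) - f x`. -/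
def diffC (y : Torus) (f : C(Torus, ℝ)) : C(Torus, ℝ) where
  toFun x := f (x + y) - f x
  continuous_toFun := by fun_prop

lemma diffC_apply (y : Torus) (f : C(Torus, ℝ)) (x : Torus) : diffC y f x = f (x + y) - f x := rfl

lemma coeff_diffC (y : Torus) (f : C(Torus, ℝ)) (n : Freq) :
    coeff (diffC y f) n = (UnitAddTorus.mFourier n y - 1) * coeff f n := by
  rw [coeff_eq_fcoeff, coeff_eq_fcoeff, sub_mul, one_mul,
    ← fcoeff_translate, ← fcoeff_sub (integrable_of_continuous (by fun_prop))
      (integrable_of_continuous (by fun_prop))]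
  simp only [diffC_apply, Complex.ofReal_sub]

lemma hasSum_sq_coeff (f : C(Torus, ℝ)) :
    HasSum (fun n => ‖coeff f n‖ ^ 2) (∫ x, f x ^ 2 ∂torusMeasure) := by
  have h1 := hasSum_sq_fcoeff (f := fun x => (f x : ℂ)) (memLp_of_continuous (by fun_prop))
  simp only [Complex.norm_real, Real.norm_eq_abs, sq_abs] at h1
  exact h1

lemma integral_sq_le_of_sum_le {f : C(Torus, ℝ)} {A : ℝ}
    (h : ∀ s : Finset Freq, ∑ n ∈ s, ‖coeff f n‖ ^ 2 ≤ A) : ∫ x, f x ^ 2 ∂torusMeasure ≤ A :=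
  hasSum_le_of_sum_le (hasSum_sq_coeff f) h

lemma exists_integral_sq_diffC_le {γ : ℝ} (hγ : 1 < γ) : ∃ C, 0 ≤ C ∧
    ∀ (M : ℝ) (f : C(Torus, ℝ)), DyadicL2 γ M (coeff f) → ∀ i θ, 0 < θ →
      ∫ x, diffC (shift i θ) f x ^ 2 ∂torusMeasure ≤ C * (θ * M) ^ 2 := by
  have hq : ((2 : ℝ) ^ (1 - γ)) ^ 2 ≤ 1 :=
    pow_le_one₀ (by positivity)
      (Real.rpow_lt_one_of_one_lt_of_neg one_lt_two (by linarith)).le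
  refine ⟨2 * (1 - ((2 : ℝ) ^ (1 - γ)) ^ 2)⁻¹ * (4 * Real.pi) ^ 2,
    mul_nonneg (mul_nonneg zero_le_two (inv_nonneg.2 (sub_nonneg.2 hq))) (sq_nonneg _),
    fun M f hf i θ hθ => integral_sq_le_of_sum_le fun s => ?_⟩
  simp only [coeff_diffC]
  refine (hf.sum_sq_le hγ (K := 4 * Real.pi * θ) (fun j n hn => ?_) s).trans_eq (by ring)
  simpa using norm_mFourier_shift_sub_one_le zero_le_one le_rfl hn i hθ

/-- Each of the two differences is bounded with exponent `(1 + ρ)/2 ≤ 1`, so that together they cost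
`1 + ρ < γ` derivatives. -/
lemma exists_integral_sq_diffC_diffC_le {γ ρ : ℝ} (hρ : 0 ≤ ρ) (hρ1 : ρ ≤ 1) (hγ : 1 + ρ < γ) :
    ∃ C, 0 ≤ C ∧ ∀ (M : ℝ) (f : C(Torus, ℝ)), DyadicL2 γ M (coeff f) → ∀ i θ, 0 < θ →
      ∫ x, diffC (shift i θ) (diffC (shift i θ) f) x ^ 2 ∂torusMeasure ≤
        C * (θ ^ (1 + ρ) * M) ^ 2 := by
  have hq : ((2 : ℝ) ^ (1 + ρ - γ)) ^ 2 ≤ 1 :=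
    pow_le_one₀ (by positivity)
      (Real.rpow_lt_one_of_one_lt_of_neg one_lt_two (by linarith)).le
  refine ⟨2 * (1 - ((2 : ℝ) ^ (1 + ρ - γ)) ^ 2)⁻¹ * ((4 * Real.pi) ^ 2) ^ 2,
    mul_nonneg (mul_nonneg zero_le_two (inv_nonneg.2 (sub_nonneg.2 hq))) (sq_nonneg _),
    fun M f hf i θ hθ => integral_sq_le_of_sum_le fun s => ?_⟩
  simp only [coeff_diffC, ← mul_assoc]
  refine (hf.sum_sq_le hγ (K := (4 * Real.pi) ^ 2 * θ ^ (1 + ρ)) (fun j n hn => ?_) s).trans_eq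
    (by ring)
  have h1 := norm_mFourier_shift_sub_one_le (ρ := (1 + ρ) / 2) (by linarith) (by linarith) hn i hθ
  have h2 : ∀ x : ℝ, 0 ≤ x → x ^ (1 + ρ) = (x ^ ((1 + ρ) / 2)) ^ 2 := fun x hx => by
    rw [← Real.rpow_natCast, ← Real.rpow_mul hx]
    congr 1
    push_cast
    ring
  rw [norm_mul, h2 θ hθ.le, h2 2 zero_le_two]
  calc _ ≤ (4 * Real.pi * θ ^ ((1 + ρ) / 2) * ((2 : ℝ) ^ ((1 + ρ) / 2)) ^ j) *
      (4 * Real.pi * θ ^ ((1 + ρ) / 2) * ((2 : ℝ) ^ ((1 + ρ) / 2)) ^ j) := by gcongr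
    _ = _ := by ring

/-- Bernstein's inequality takes one derivative and the difference takes `ρ`. What is left of `γ` is
positive and serves to sum the blocks. -/
lemma exists_abs_diffC_le {γ ρ : ℝ} (hρ : 0 ≤ ρ) (hρ1 : ρ ≤ 1) (hγ : 1 + ρ < γ) :
    ∃ C, 0 ≤ C ∧ ∀ (M : ℝ), 0 ≤ M → ∀ (f : C(Torus, ℝ)), DyadicL2 γ M (coeff f) →
      ∀ i θ, 0 < θ → ∀ x, |diffC (shift i θ) f x| ≤ C * (θ ^ ρ * M) := by
  set α := γ - (1 + ρ) with hα
  have hα0 : 0 < α := by linarith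
  have hq : (2 : ℝ) ^ (-α) < 1 := two_rpow_neg_lt_one hα0
  refine ⟨(1 - (2 : ℝ) ^ (-α))⁻¹ * (20 * Real.pi),
    mul_nonneg (inv_nonneg.2 (sub_nonneg.2 hq.le)) (by positivity),
    fun M hM f hf i θ hθ x => ?_⟩
  have h1 : ∀ j, blockNorm α j (coeff (diffC (shift i θ) f)) ≤ 20 * Real.pi * (θ ^ ρ * M) :=
    fun j => by
    have h2 : ‖block j (coeff (diffC (shift i θ) f))‖ ≤
        5 * 2 ^ j * (4 * Real.pi * θ ^ ρ * ((2 : ℝ) ^ ρ) ^ j * (M * ((2 : ℝ) ^ (-γ)) ^ j)) := by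
      rw [block_eq_trig]
      refine (norm_trig_le_sqrt _ _).trans
        (mul_le_mul (sqrt_card_freqBox_le j) ?_ (Real.sqrt_nonneg _) (by positivity))
      refine Real.sqrt_le_iff.2 ⟨by positivity, ?_⟩
      rw [mul_pow]
      refine le_trans ?_ (mul_le_mul_of_nonneg_left (hf j) (sq_nonneg _))
      rw [Finset.mul_sum]
      refine Finset.sum_le_sum fun n _ => ?_
      by_cases hn : dyadic j n = 0
      · simp [hn]
      · rw [coeff_diffC, mul_left_comm, norm_mul, mul_pow]
        gcongr
        exact norm_mFourier_shift_sub_one_le hρ hρ1 hn i hθ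
    rw [blockNorm, two_rpow_mul_nat]
    calc ((2 : ℝ) ^ α) ^ j * ‖block j (coeff (diffC (shift i θ) f))‖ ≤ _ :=
          mul_le_mul_of_nonneg_left h2 (by positivity)
      _ = 20 * Real.pi * (θ ^ ρ * M) * ((2 : ℝ) ^ α * 2 * 2 ^ ρ * 2 ^ (-γ)) ^ j := by
          rw [mul_pow, mul_pow, mul_pow]; ring
      _ = _ := by
          have h3 : (2 : ℝ) ^ α * 2 * 2 ^ ρ * 2 ^ (-γ) = 1 := by
            conv_lhs => rw [← Real.rpow_one 2, ← Real.rpow_mul zero_le_two,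
              ← Real.rpow_mul zero_le_two, ← Real.rpow_mul zero_le_two, ← Real.rpow_add two_pos,
              ← Real.rpow_add two_pos, ← Real.rpow_add two_pos]
            rw [hα, show 1 * (γ - (1 + ρ)) + 1 + 1 * ρ + 1 * -γ = 0 by ring, Real.rpow_zero]
          rw [h3, one_pow, mul_one]
  obtain ⟨f', hf', hn⟩ := exists_coeff_eq (coeff_neg (diffC (shift i θ) f))
    (summable_norm_block hα0 h1)
  have h4 : f' = diffC (shift i θ) f := coeffC_injective hf'
  rw [h4] at hn
  refine (ContinuousMap.norm_coe_le_norm (diffC (shift i θ) f) x).trans (hn.trans ?_)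
  refine (tsum_norm_block_le hα0 h1).trans_eq (by ring)

/-- Taylor expansion of both outer values about the middle one: the linear terms combine into the
second difference of `f`, the remainders are squares of first differences. -/
lemma abs_diffC_diffC_nem_le {g : ℝ → ℝ} (hg : ContDiff ℝ 2 g) {L₁ L₂ : ℝ}
    (h1 : ∀ x, |deriv g x| ≤ L₁) (h2 : ∀ x, |iteratedDeriv 2 g x| ≤ L₂) (f : C(Torus, ℝ))
    (y x : Torus) :
    |diffC y (diffC y (nem hg.continuous f)) x| ≤
      L₂ * diffC y f (x + y) ^ 2 + L₂ * diffC y f x ^ 2 + L₁ * |diffC y (diffC y f) x| := by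
  have hL2 : 0 ≤ L₂ := (abs_nonneg _).trans (h2 0)
  have hgd : Differentiable ℝ g := hg.differentiable (by norm_num)
  have ht := abs_taylor_le hgd hL2 (lipschitz_deriv_of_bound hg h2)
  simp only [diffC_apply, nem_apply]
  set a := f x
  set b := f (x + y)
  set c := f (x + y + y)
  have ha := ht b a
  have hc := ht b c
  rw [sq_abs] at ha hc
  have hb : |deriv g b * (c - b - (b - a))| ≤ L₁ * |c - b - (b - a)| := by
    rw [abs_mul]
    gcongr
    exact h1 b
  rw [show g c - g b - (g b - g a) = (g c - g b - deriv g b * (c - b)) +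
    (g a - g b - deriv g b * (a - b)) + deriv g b * (c - b - (b - a)) by ring]
  refine (abs_add_three _ _ _).trans ?_
  rw [show (b - a) ^ 2 = (a - b) ^ 2 by ring]
  exact add_le_add (add_le_add hc ha) hb

lemma integrable_of_continuous_real {f : Torus → ℝ} (hf : Continuous f) :
    Integrable f torusMeasure := integrable_continuousMap ⟨f, hf⟩

/-- In each squared difference one factor is estimated by its supremum `S` and the other in `L²`.
The orders `ρ` and `1` of the two factors add up to the order `1 + ρ` of the second difference. -/
lemma integral_sq_diffC_diffC_nem_le {g : ℝ → ℝ} (hg : ContDiff ℝ 2 g) {L₁ L₂ : ℝ}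
    (h1 : ∀ x, |deriv g x| ≤ L₁) (h2 : ∀ x, |iteratedDeriv 2 g x| ≤ L₂) (f : C(Torus, ℝ))
    (y : Torus) {S : ℝ} (hS : ∀ x, |diffC y f x| ≤ S) :
    ∫ x, diffC y (diffC y (nem hg.continuous f)) x ^ 2 ∂torusMeasure ≤
      6 * (L₂ * S) ^ 2 * ∫ x, diffC y f x ^ 2 ∂torusMeasure +
      3 * L₁ ^ 2 * ∫ x, diffC y (diffC y f) x ^ 2 ∂torusMeasure := by
  have hL2 : 0 ≤ L₂ := (abs_nonneg _).trans (h2 0)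
  have htr : ∫ x, diffC y f (x + y) ^ 2 ∂torusMeasure = ∫ x, diffC y f x ^ 2 ∂torusMeasure :=
    integral_add_right_eq_self (fun x => diffC y f x ^ 2) y
  have hp : ∀ x, diffC y (diffC y (nem hg.continuous f)) x ^ 2 ≤
      (3 * (L₂ * S) ^ 2 * diffC y f (x + y) ^ 2 + 3 * (L₂ * S) ^ 2 * diffC y f x ^ 2) +
        3 * L₁ ^ 2 * diffC y (diffC y f) x ^ 2 := fun x => by
    have h3 := abs_diffC_diffC_nem_le hg h1 h2 f y x
    have h4 : ∀ z, L₂ * diffC y f z ^ 2 ≤ L₂ * S * |diffC y f z| := fun z => by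
      rw [← sq_abs, mul_assoc, sq]
      gcongr
      exact hS z
    have h5 := h4 x
    have h6 := h4 (x + y)
    rw [← sq_abs (diffC y (diffC y (nem hg.continuous f)) x), ← sq_abs (diffC y f x),
      ← sq_abs (diffC y f (x + y)), ← sq_abs (diffC y (diffC y f) x)]
    set A := L₂ * S * |diffC y f x|
    set B := L₂ * S * |diffC y f (x + y)|
    set D := L₁ * |diffC y (diffC y f) x|
    have h7 : |diffC y (diffC y (nem hg.continuous f)) x| ≤ B + A + D := by linarith
    calc _ ≤ (B + A + D) ^ 2 := pow_le_pow_left₀ (abs_nonneg _) h7 2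
      _ ≤ 3 * B ^ 2 + 3 * A ^ 2 + 3 * D ^ 2 := by
          nlinarith [sq_nonneg (A - B), sq_nonneg (A - D), sq_nonneg (B - D)]
      _ = _ := by ring
  refine (integral_mono (integrable_of_continuous_real (by fun_prop))
    (integrable_of_continuous_real (by fun_prop)) hp).trans_eq ?_
  rw [integral_add (integrable_of_continuous_real (by fun_prop))
    (integrable_of_continuous_real (by fun_prop)),
    integral_add (integrable_of_continuous_real (by fun_prop))
    (integrable_of_continuous_real (by fun_prop)), integral_const_mul, integral_const_mul,
    integral_const_mul, htr]
  ring

/-- The Fourier coefficients of `g(f)` in a dyadic shell. -/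
lemma exists_sum_sq_coeff_nem_le {g : ℝ → ℝ} (hg : ContDiff ℝ 2 g) {L₁ L₂ : ℝ}
    (h1 : ∀ x, |deriv g x| ≤ L₁) (h2 : ∀ x, |iteratedDeriv 2 g x| ≤ L₂) {γ ρ M : ℝ} (hρ : 0 ≤ ρ)
    (hρ1 : ρ ≤ 1) (hγ : 1 + ρ < γ) (hM : 0 ≤ M) :
    ∃ A, 0 ≤ A ∧ ∀ f : C(Torus, ℝ), DyadicL2 γ M (coeff f) → ∀ (l : ℕ) (s : Finset Freq),
      (∀ n ∈ s, (∃ i, (2 : ℝ) ^ l ≤ 8 * |(n i : ℝ)|) ∧ ∀ i, |(n i : ℝ)| ≤ 4 * 2 ^ l) →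
      ∑ n ∈ s, ‖coeff (nem hg.continuous f) n‖ ^ 2 ≤ (A * ((2 : ℝ) ^ (-(1 + ρ))) ^ l) ^ 2 := by
  classical
  obtain ⟨C₁, hC₁, H₁⟩ := exists_integral_sq_diffC_le (γ := γ) (by linarith)
  obtain ⟨C₂, hC₂, H₂⟩ := exists_integral_sq_diffC_diffC_le hρ hρ1 hγ
  obtain ⟨C₃, hC₃, H₃⟩ := exists_abs_diffC_le hρ hρ1 hγ
  set W := 6 * (L₂ * (C₃ * M)) ^ 2 * (C₁ * M ^ 2) + 3 * L₁ ^ 2 * (C₂ * M ^ 2) with hW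
  have hW0 : 0 ≤ W := by positivity
  -- The factor `2` counts the coordinates, and `16 ^ 4` inverts the square of the second difference
  -- multiplier, which is at least `16 ^ (-2)` on the shell.
  refine ⟨Real.sqrt (2 * 16 ^ 4 * W), Real.sqrt_nonneg _, fun f hf l s hs => ?_⟩
  set θ : ℝ := (2 ^ (l + 3))⁻¹ with hθ
  have hθ0 : 0 < θ := by positivity
  have h3 : ∀ i, ∫ x, diffC (shift i θ) (diffC (shift i θ) (nem hg.continuous f)) x ^ 2
      ∂torusMeasure ≤ W * (θ ^ (1 + ρ)) ^ 2 := fun i => by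
    refine (integral_sq_diffC_diffC_nem_le hg h1 h2 f _ (H₃ M hM f hf i θ hθ0)).trans ?_
    calc _ ≤ 6 * (L₂ * (C₃ * (θ ^ ρ * M))) ^ 2 * (C₁ * (θ * M) ^ 2) +
          3 * L₁ ^ 2 * (C₂ * (θ ^ (1 + ρ) * M) ^ 2) := by
          gcongr
          · exact H₁ M f hf i θ hθ0
          · exact H₂ M f hf i θ hθ0
      _ = _ := by
          rw [Real.rpow_add hθ0, Real.rpow_one, hW]
          ring
  -- The shift acts in one direction only, so the shell is divided according to a coordinate that is
  -- comparable to `2 ^ l`.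
  have h4 : ∀ i, ∑ n ∈ s with (2 : ℝ) ^ l ≤ 8 * |(n i : ℝ)|, ‖coeff (nem hg.continuous f) n‖ ^ 2 ≤
      16 ^ 4 * (W * (θ ^ (1 + ρ)) ^ 2) := fun i => by
    refine le_trans ?_ (mul_le_mul_of_nonneg_left ((sum_le_hasSum
      {n ∈ s | (2 : ℝ) ^ l ≤ 8 * |(n i : ℝ)|} (fun n _ => sq_nonneg _)
      (hasSum_sq_coeff _)).trans (h3 i)) (by positivity))
    rw [Finset.mul_sum]
    refine Finset.sum_le_sum fun n hn => ?_
    rw [Finset.mem_filter] at hn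
    have h5 := le_norm_mFourier_shift_sub_one hn.2 ((hs n hn.1).2 i)
    rw [coeff_diffC, coeff_diffC, ← mul_assoc, norm_mul, norm_mul, mul_pow]
    have h6 : (1 : ℝ) ≤ 16 ^ 4 * (‖UnitAddTorus.mFourier n (shift i θ) - 1‖ *
        ‖UnitAddTorus.mFourier n (shift i θ) - 1‖) ^ 2 := by
      have h7 := pow_le_pow_left₀ (by norm_num) h5 4
      rw [← hθ] at h7
      nlinarith
    calc _ = 1 * ‖coeff (nem hg.continuous f) n‖ ^ 2 := (one_mul _).symm
      _ ≤ _ := mul_le_mul_of_nonneg_right h6 (sq_nonneg _)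
      _ = _ := by ring
  have h5 : ∑ n ∈ s, ‖coeff (nem hg.continuous f) n‖ ^ 2 ≤
      ∑ i, ∑ n ∈ s with (2 : ℝ) ^ l ≤ 8 * |(n i : ℝ)|, ‖coeff (nem hg.continuous f) n‖ ^ 2 := by
    simp only [Finset.sum_filter]
    rw [Finset.sum_comm]
    refine Finset.sum_le_sum fun n hn => ?_
    obtain ⟨i, hi⟩ := (hs n hn).1
    refine le_trans ?_ (Finset.single_le_sum (f := fun i =>
      if (2 : ℝ) ^ l ≤ 8 * |(n i : ℝ)| then ‖coeff (nem hg.continuous f) n‖ ^ 2 else 0)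
      (fun i _ => by positivity) (Finset.mem_univ i))
    rw [if_pos hi]
  have h6 : θ ^ (1 + ρ) ≤ ((2 : ℝ) ^ (-(1 + ρ))) ^ l := by
    rw [← two_rpow_mul_nat, neg_mul, mul_comm, ← mul_neg, mul_comm, neg_mul, ← mul_neg, mul_comm,
      Real.rpow_mul zero_le_two]
    refine Real.rpow_le_rpow hθ0.le ?_ (by linarith)
    rw [Real.rpow_neg zero_le_two, Real.rpow_natCast, hθ]
    gcongr
    · norm_num
    · omega
  refine h5.trans ((Finset.sum_le_sum fun i _ => h4 i).trans ?_)
  rw [Finset.sum_const, Finset.card_univ, Fintype.card_fin, mul_pow, Real.sq_sqrt (by positivity),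
    nsmul_eq_mul]
  calc _ = 2 * 16 ^ 4 * W * (θ ^ (1 + ρ)) ^ 2 := by push_cast; ring
    _ ≤ _ := by gcongr

end GPAM

namespace GPAM

/-! ### Products with distributions of negative regularity -/

/-- The complex valued version of a real function. -/
def ofRealC (a : C(Torus, ℝ)) : C(Torus, ℂ) where
  toFun x := (a x : ℂ)
  continuous_toFun := by fun_prop

lemma ofRealC_apply (a : C(Torus, ℝ)) (x : Torus) : ofRealC a x = (a x : ℂ) := rfl

lemma norm_ofRealC (a : C(Torus, ℝ)) : ‖ofRealC a‖ ≤ ‖a‖ :=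
  (ContinuousMap.norm_le _ (norm_nonneg _)).2 fun x => by
    rw [ofRealC_apply, Complex.norm_real]
    exact a.norm_coe_le_norm x

lemma fcoeff_mul_trig (a : C(Torus, ℂ)) (s : Finset Freq) (c : Coeffs) (n : Freq) :
    fcoeff (fun x => a x * trig s c x) n = ∑ m ∈ s, c m * fcoeff a (n - m) := by
  have h1 : (fun x => a x * trig s c x) =
      fun x => ∑ m ∈ s, c m * (UnitAddTorus.mFourier m x * a x) := by
    funext x
    rw [trig_apply, Finset.mul_sum]
    exact Finset.sum_congr rfl fun m _ => by ring
  rw [h1, fcoeff_finset_sum s fun m _ => integrable_of_continuous (by fun_prop)]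
  refine Finset.sum_congr rfl fun m _ => ?_
  rw [fcoeff_const_mul, fcoeff_mFourier_mul]

lemma mem_freqBox {j : ℕ} {n : Freq} : n ∈ freqBox j ↔ ∀ i, |(n i : ℝ)| ≤ 2 ^ (j + 1) := by
  simp only [freqBox, Fintype.mem_piFinset, Finset.mem_Icc, abs_le]
  refine forall_congr' fun i => ?_
  constructor
  · rintro ⟨h1, h2⟩
    exact ⟨by exact_mod_cast h1, by exact_mod_cast h2⟩
  · rintro ⟨h1, h2⟩
    exact ⟨by exact_mod_cast h1, by exact_mod_cast h2⟩

/-- The frequencies of size about `2 ^ l`. -/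
noncomputable def shell (l : ℕ) : Finset Freq :=
  open Classical in {n ∈ freqBox (l + 1) | ∃ i, (2 : ℝ) ^ l ≤ 8 * |(n i : ℝ)|}

lemma mem_shell {l : ℕ} {n : Freq} :
    n ∈ shell l ↔ (∃ i, (2 : ℝ) ^ l ≤ 8 * |(n i : ℝ)|) ∧ ∀ i, |(n i : ℝ)| ≤ 4 * 2 ^ l := by
  classical
  rw [shell, Finset.mem_filter, mem_freqBox, and_comm]
  simp only [pow_succ, show ∀ x : ℝ, x * 2 * 2 = 4 * x from fun x => by ring]

/-- One coordinate of `m` is at least `2 ^ l / 4`. Since `l ≥ j + 4`, subtracting `n` changes it by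
at most `2 ^ l / 8`, which explains the factor `8` in `shell`. -/
lemma sub_mem_shell {j l : ℕ} (hjl : j + 4 ≤ l) {n m : Freq} (hn : n ∈ freqBox j)
    (hm : dyadic l m ≠ 0) : n - m ∈ shell l := by
  obtain ⟨p, rfl⟩ : ∃ p, l = p + 1 := ⟨l - 1, by omega⟩
  have h1 : (2 : ℝ) ^ p < freqNorm m := by
    by_contra! h
    exact hm (dyadic_succ_eq_zero h)
  have h2 := mem_freqBox.1 hn
  have h3 : ∀ i, |(m i : ℝ)| ≤ 2 * 2 ^ (p + 1) := fun i => by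
    have := (abs_le_freqNorm m i).trans (freqNorm_lt_of_dyadic_ne_zero hm).le
    rwa [pow_succ, mul_comm] at this
  have h4 : (8 : ℝ) * 2 ^ (j + 1) ≤ 2 ^ (p + 1) := by
    calc (8 : ℝ) * 2 ^ (j + 1) = 2 ^ (j + 4) := by ring
      _ ≤ _ := pow_le_pow_right₀ (by norm_num) hjl
  have h5 : ∃ i, (2 : ℝ) ^ (p + 1) ≤ 4 * |(m i : ℝ)| := by
    by_contra! h
    have h6 : freqNorm m ^ 2 = (m 0 : ℝ) ^ 2 + (m 1 : ℝ) ^ 2 := Real.sq_sqrt (by positivity)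
    have h7 := h 0
    have h8 := h 1
    rw [pow_succ] at h7 h8
    have h9 : (0 : ℝ) < 2 ^ p := by positivity
    rw [← sq_abs (m 0 : ℝ), ← sq_abs (m 1 : ℝ)] at h6
    nlinarith [abs_nonneg (m 0 : ℝ), abs_nonneg (m 1 : ℝ)]
  rw [mem_shell]
  simp only [Pi.sub_apply, Int.cast_sub]
  obtain ⟨i, hi⟩ := h5
  refine ⟨⟨i, ?_⟩, fun i => ?_⟩
  · have h6 := abs_sub_abs_le_abs_sub (m i : ℝ) (n i : ℝ)
    rw [abs_sub_comm] at h6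
    linarith [h2 i]
  · have h6 := abs_sub (n i : ℝ) (m i : ℝ)
    have h7 : (0 : ℝ) < 2 ^ (j + 1) := by positivity
    linarith [h2 i, h3 i]

/-- Low frequencies of the product with a block of much higher frequency see only a shell of the
other factor. -/
lemma norm_trig_mul_block_le {j l : ℕ} (hjl : j + 4 ≤ l) (a : C(Torus, ℂ)) (c : Coeffs)
    {m : Freq → ℂ} {E A : ℝ} (hE : 0 ≤ E) (hA : 0 ≤ A) (hm : ∀ n, ‖m n‖ ≤ E)
    (ha : ∑ n ∈ shell l, ‖fcoeff a n‖ ^ 2 ≤ A ^ 2) :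
    ‖trig (freqBox j) fun n => m n * fcoeff (fun x => a x * block l c x) n‖ ≤
      5 * 2 ^ j * (E * (A * ‖block l c‖)) := by
  set al := trig (shell l) (fcoeff a) with hal
  -- In the convolution of coefficients only differences from the shell occur, so `a` may be
  -- replaced by its restriction `al` to the shell.
  have h1 : ∀ n ∈ freqBox j, fcoeff (fun x => a x * block l c x) n =
      fcoeff (fun x => al x * block l c x) n := fun n hn => by
    rw [block_eq_trig, fcoeff_mul_trig, fcoeff_mul_trig]
    refine Finset.sum_congr rfl fun p _ => ?_
    by_cases hp : dyadic l p = 0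
    · simp [hp]
    · rw [hal, fcoeff_trig, if_pos (sub_mem_shell hjl hn hp)]
  refine (norm_trig_le_sqrt _ _).trans
    (mul_le_mul (sqrt_card_freqBox_le j) ?_ (Real.sqrt_nonneg _) (by positivity))
  refine Real.sqrt_le_iff.2 ⟨by positivity, ?_⟩
  have h2 : ∫ x, ‖al x * block l c x‖ ^ 2 ∂torusMeasure ≤ (A * ‖block l c‖) ^ 2 := by
    have h3 : ∀ x, ‖al x * block l c x‖ ^ 2 ≤ ‖al x‖ ^ 2 * ‖block l c‖ ^ 2 := fun x => by
      rw [norm_mul, mul_pow]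
      gcongr
      exact (block l c).norm_coe_le_norm x
    refine (integral_mono (integrable_of_continuous_real (by fun_prop))
      (integrable_of_continuous_real (by fun_prop)) h3).trans ?_
    rw [integral_mul_const, mul_pow, hal, integral_sq_norm_trig]
    gcongr
  calc ∑ n ∈ freqBox j, ‖m n * fcoeff (fun x => a x * block l c x) n‖ ^ 2
      ≤ ∑ n ∈ freqBox j, E ^ 2 * ‖fcoeff (fun x => al x * block l c x) n‖ ^ 2 := by
        refine Finset.sum_le_sum fun n hn => ?_
        rw [norm_mul, mul_pow, h1 n hn]
        gcongr
        exact hm n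
    _ ≤ E ^ 2 * (A * ‖block l c‖) ^ 2 := by
        rw [← Finset.mul_sum]
        gcongr
        exact (sum_sq_fcoeff_le (memLp_of_continuous (by fun_prop)) _).trans h2
    _ = (E * (A * ‖block l c‖)) ^ 2 := by ring

lemma ofRealC_truncFun (J : ℕ) {c : Coeffs} (hc : ∀ n, c (-n) = starRingEnd ℂ (c n)) :
    ofRealC (truncFun J c) = ∑ l ∈ Finset.range (J + 1), block l c := by
  refine eq_of_fcoeff_eq fun n => ?_
  have h1 : fcoeff (ofRealC (truncFun J c)) = coeff (truncFun J c) := rfl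
  have h2 : (⇑(∑ l ∈ Finset.range (J + 1), block l c) : Torus → ℂ) =
      fun x => ∑ l ∈ Finset.range (J + 1), block l c x := by
    funext x; rw [ContinuousMap.sum_apply]
  rw [h1, coeff_truncFun J hc, h2,
    fcoeff_finset_sum _ fun l _ => integrable_of_continuous (block l c).continuous]
  simp only [fcoeff_block]
  rw [← Finset.sum_mul, ← Complex.ofReal_sum, sum_dyadic]
  rfl

lemma exp_neg_le_two_div {x : ℝ} (hx : 0 ≤ x) : Real.exp (-x) ≤ 2 / (1 + x ^ 2) := by
  rw [Real.exp_neg, inv_eq_one_div, div_le_div_iff₀ (Real.exp_pos x) (by positivity)]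
  have := Real.quadratic_le_exp_of_nonneg hx
  nlinarith

/-- The product is split by the frequency `2 ^ l` of the rough factor. For `l < j + 4` the sup norm
of `a` suffices, since `∑ β ^ l` is dominated by its top term. For `l ≥ j + 4` only the shell `l` of
`a` matters, and each term is of size `2 ^ j * 2 ^ ((κ - ρ) l)`, summable because `κ < ρ`. Either
way the heat factor supplies the denominator. -/
lemma exists_norm_block_heat_mul_le {κ ρ T : ℝ} (hκ : 0 ≤ κ) (hρ : κ < ρ) {A₀ A : ℝ}
    (hA₀ : 0 ≤ A₀) (hA : 0 ≤ A) :
    ∃ K, 0 ≤ K ∧ ∀ a : C(Torus, ℝ), ‖a‖ ≤ A₀ →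
      (∀ l, ∑ n ∈ shell l, ‖coeff a n‖ ^ 2 ≤ (A * ((2 : ℝ) ^ (-(1 + ρ))) ^ l) ^ 2) →
      ∀ c : Coeffs, (∀ n, c (-n) = starRingEnd ℂ (c n)) → ∀ N, 0 ≤ N →
      (∀ l, ‖block l c‖ ≤ N * ((2 : ℝ) ^ (1 + κ)) ^ l) → ∀ (J j : ℕ) (τ : ℝ), 0 ≤ τ → τ ≤ T →
      ‖block j (heat τ (coeff (a * truncFun J c : C(Torus, ℝ))))‖ ≤
        K * N * ((2 : ℝ) ^ (1 + κ)) ^ j / (1 + (4 ^ j * τ) ^ 2) := by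
  classical
  obtain ⟨C, hC, hmult⟩ := exists_multBound_dyadic_heat T
  set β : ℝ := (2 : ℝ) ^ (1 + κ) with hβ
  have hβ2 : 2 ≤ β := by
    rw [hβ]
    conv_lhs => rw [← Real.rpow_one 2]
    exact Real.rpow_le_rpow_of_exponent_le one_le_two (by linarith)
  set q : ℝ := (2 : ℝ) ^ (κ - ρ) with hq
  have hq1 : q < 1 := Real.rpow_lt_one_of_one_lt_of_neg one_lt_two (by linarith)
  have hq0 : 0 ≤ q := by positivity
  have hqi : 0 ≤ (1 - q)⁻¹ := inv_nonneg.2 (by linarith)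
  refine ⟨C * A₀ * β ^ 4 + 10 * Real.exp T * A * (1 - q)⁻¹, by positivity,
    fun a ha hsh c hc N hN hcN J j τ hτ hτT => ?_⟩
  set m : Freq → ℂ := fun n => (dyadic j n : ℂ) * (Real.exp (-(lam n * τ)) : ℂ) with hm
  set P : ℝ := 1 + (4 ^ j * τ) ^ 2 with hP
  have hP0 : 0 < P := by positivity
  set E : ℝ := 2 * Real.exp T / P with hE
  have hmE : ∀ n, ‖m n‖ ≤ E := fun n => by
    have h1 := norm_dyadic_heat_le j hτ (fun _ => 1) n
    rw [heat_apply, mul_one, norm_one, mul_one] at h1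
    refine (h1.trans (exp_neg_le hτT j)).trans ?_
    rw [hE, mul_comm 2, mul_div_assoc]
    gcongr
    exact exp_neg_le_two_div (by positivity)
  set lo := {l ∈ Finset.range (J + 1) | l < j + 4} with hlo
  set hi := {l ∈ Finset.range (J + 1) | ¬ l < j + 4} with hhi
  set G : C(Torus, ℂ) := ∑ l ∈ lo, block l c with hG
  have hsplit : ∀ n, coeff (a * truncFun J c : C(Torus, ℝ)) n =
      fcoeff (ofRealC a * G : C(Torus, ℂ)) n +
        ∑ l ∈ hi, fcoeff (fun x => ofRealC a x * block l c x) n := fun n => by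
    rw [← fcoeff_finset_sum hi fun l _ => integrable_of_continuous (by fun_prop),
      ← fcoeff_add (integrable_of_continuous (map_continuous _))
        (integrable_of_continuous (by fun_prop)), coeff_eq_fcoeff]
    congr 1
    funext x
    have h1 := congrArg (fun f : C(Torus, ℂ) => f x) (ofRealC_truncFun J hc)
    simp only [ofRealC_apply] at h1
    rw [ContinuousMap.mul_apply, Complex.ofReal_mul, h1, ContinuousMap.mul_apply,
      ← Finset.mul_sum, ← mul_add, hG, ContinuousMap.sum_apply, ContinuousMap.sum_apply,
      ofRealC_apply, hlo, hhi, Finset.sum_filter_add_sum_filter_not]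
  have hblock : block j (heat τ (coeff (a * truncFun J c : C(Torus, ℝ)))) =
      trig (freqBox j) (fun n => m n * fcoeff (ofRealC a * G : C(Torus, ℂ)) n) +
      ∑ l ∈ hi, trig (freqBox j)
        (fun n => m n * fcoeff (fun x => ofRealC a x * block l c x) n) := by
    ext x
    rw [block_eq_trig, ContinuousMap.add_apply, ContinuousMap.sum_apply]
    simp only [trig_apply]
    rw [Finset.sum_comm, ← Finset.sum_add_distrib]
    refine Finset.sum_congr rfl fun n _ => ?_
    rw [heat_apply, hsplit, ← Finset.sum_mul, ← Finset.mul_sum]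
    simp only [hm]
    ring
  have hlow : ‖trig (freqBox j) (fun n => m n * fcoeff (ofRealC a * G : C(Torus, ℂ)) n)‖ ≤
      C / P * (A₀ * (N * (β ^ 4 * β ^ j))) := by
    refine ((hmult j τ hτ hτT).norm_trig_fcoeff_le _
      (fun n hn => by simp [dyadic_eq_zero hn]) _).trans ?_
    gcongr
    refine (norm_mul_le _ _).trans ?_
    gcongr
    · exact (norm_ofRealC a).trans ha
    · calc ‖G‖ ≤ ∑ l ∈ lo, ‖block l c‖ := norm_sum_le _ _
        _ ≤ ∑ l ∈ lo, N * β ^ l := Finset.sum_le_sum fun l _ => hcN l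
        _ ≤ ∑ l ∈ Finset.range (j + 4), N * β ^ l :=
            Finset.sum_le_sum_of_subset_of_nonneg
              (fun l hl => Finset.mem_range.2 (Finset.mem_filter.1 hl).2)
              fun l _ _ => by positivity
        _ ≤ N * (β ^ 4 * β ^ j) := by
            rw [← Finset.mul_sum, ← pow_add, add_comm 4]
            gcongr
            -- As `β ≥ 2`, the geometric sum over `l < j + 4` is below `β ^ (j + 4)`.
            rw [geom_sum_eq (by linarith)]
            rw [div_le_iff₀ (by linarith)]
            have : 0 < β ^ (j + 4) := by positivity
            nlinarith
  have hhigh : ∀ l ∈ hi, ‖trig (freqBox j)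
      (fun n => m n * fcoeff (fun x => ofRealC a x * block l c x) n)‖ ≤
      5 * 2 ^ j * E * A * N * q ^ l := fun l hl => by
    refine (norm_trig_mul_block_le (not_lt.1 (Finset.mem_filter.1 hl).2) (ofRealC a) c
      (by positivity) (by positivity) hmE (hsh l)).trans ?_
    calc _ ≤ 5 * 2 ^ j * (E * (A * ((2 : ℝ) ^ (-(1 + ρ))) ^ l * (N * β ^ l))) := by
          gcongr
          exact hcN l
      _ = 5 * 2 ^ j * E * A * N * ((2 : ℝ) ^ (-(1 + ρ)) * β) ^ l := by rw [mul_pow]; ring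
      _ = _ := by
          rw [hβ, ← Real.rpow_add two_pos, hq]
          congr 3
          ring
  have h2j : (2 : ℝ) ^ j ≤ β ^ j := pow_le_pow_left₀ zero_le_two hβ2 j
  rw [hblock]
  calc _ ≤ C / P * (A₀ * (N * (β ^ 4 * β ^ j))) + ∑ l ∈ hi, 5 * 2 ^ j * E * A * N * q ^ l :=
        (norm_add_le _ _).trans (add_le_add hlow
          ((norm_sum_le _ _).trans (Finset.sum_le_sum hhigh)))
    _ ≤ C / P * (A₀ * (N * (β ^ 4 * β ^ j))) + 5 * β ^ j * E * A * N * (1 - q)⁻¹ := by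
        rw [← Finset.mul_sum]
        gcongr
        rw [← tsum_geometric_of_lt_one hq0 hq1]
        exact (summable_geometric_of_lt_one hq0 hq1).sum_le_tsum _ fun j _ => by positivity
    _ = _ := by
        rw [hE]
        field_simp
        ring

end GPAM

namespace GPAM

/-! ### The first derivative of the solution map in the norm of `B` -/

lemma integral_inv_one_add_sq_le {a : ℝ} (ha : 0 < a) (t : ℝ) :
    ∫ s in (0 : ℝ)..t, (1 + (a * (t - s)) ^ 2)⁻¹ ≤ 2 / a := by
  have h1 := intervalIntegral.integral_comp_sub_left (fun s => (1 + (a * s) ^ 2)⁻¹) t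
    (a := 0) (b := t)
  have h2 := intervalIntegral.integral_comp_mul_left (fun s => (1 + s ^ 2)⁻¹) ha.ne'
    (a := 0) (b := t)
  rw [sub_self, sub_zero] at h1
  rw [mul_zero, integral_inv_one_add_sq, Real.arctan_zero, sub_zero, smul_eq_mul] at h2
  rw [h1, h2, div_eq_inv_mul]
  gcongr
  have h3 := Real.arctan_lt_pi_div_two (a * t)
  have h4 := Real.pi_lt_four
  linarith

lemma coeff_mulCM_toCM (a f : C(Torus, ℝ)) :
    coeff (mulCM a (toCM f)) = coeff (a * f : C(Torus, ℝ)) := by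
  refine coeff_congr ?_
  filter_upwards [coeFn_mulCM a (toCM f), coeFn_toCM f] with x h1 h2
  rw [h1, h2]
  rfl

/-- The projection of `L²` on low frequencies. -/
noncomputable def truncCM (J : ℕ) (k : CM) : CM := toCM (truncFun J (coeff k))

lemma coeff_truncCM (J : ℕ) (k : CM) : coeff (truncCM J k) = truncC J (coeff k) := by
  rw [truncCM, coeff_toCM, coeff_truncFun J (coeff_neg k)]

lemma hasSum_sq_coeff_CM (k : CM) : HasSum (fun n => ‖coeff k n‖ ^ 2) (‖k‖ ^ 2) := by
  have h := hasSum_sq_fcoeff (memLp_ofReal k)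
  rwa [integral_sq_CM] at h

/-- Parseval's identity and dominated convergence on the frequencies. -/
lemma tendsto_truncCM (k : CM) : Tendsto (fun J => truncCM J k) atTop (𝓝 k) := by
  rw [tendsto_iff_norm_sub_tendsto_zero]
  have h1 : ∀ J, ‖truncCM J k - k‖ ^ 2 = ∑' n, ‖coeff (truncCM J k - k : CM) n‖ ^ 2 := fun J =>
    (hasSum_sq_coeff_CM _).tsum_eq.symm
  have h2 : ∀ J n, coeff (truncCM J k - k : CM) n = ((lowPass J n - 1 : ℝ) : ℂ) * coeff k n :=
    fun J n => by
    rw [coeff_sub_CM, coeff_truncCM]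
    simp only [Pi.sub_apply, truncC]
    push_cast
    ring
  have h3 : Tendsto (fun J => ∑' n, ‖coeff (truncCM J k - k : CM) n‖ ^ 2) atTop
      (𝓝 (∑' _ : Freq, 0)) := by
    refine tendsto_tsum_of_dominated_convergence (hasSum_sq_coeff_CM k).summable (fun n => ?_)
      (.of_forall fun J n => ?_)
    · obtain ⟨J₀, hJ₀⟩ := pow_unbounded_of_one_lt (freqNorm n) (one_lt_two)
      refine tendsto_const_nhds.congr' ?_
      filter_upwards [eventually_ge_atTop J₀] with J hJ
      rw [h2, lowPass_eq_one (hJ₀.le.trans (pow_le_pow_right₀ one_le_two hJ))]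
      simp
    · rw [Real.norm_of_nonneg (sq_nonneg _), h2, norm_mul, mul_pow, Complex.norm_real,
        Real.norm_eq_abs]
      refine mul_le_of_le_one_left (sq_nonneg _) (pow_le_one₀ (abs_nonneg _) ?_)
      have h4 : 0 ≤ lowPass J n := Real.smoothTransition.nonneg _
      have h5 : lowPass J n ≤ 1 := Real.smoothTransition.le_one _
      rw [abs_le]
      constructor <;> linarith
  simp only [← h1, tsum_zero] at h3
  have h4 := (Real.continuous_sqrt.tendsto 0).comp h3
  simpa only [Function.comp_def, Real.sqrt_sq (norm_nonneg _), Real.sqrt_zero] using h4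

/-! ### The Duhamel integral of a product and the bound of `der1` in the norm of `B` -/

section Key

variable {κ T : ℝ} (hκ : 0 < κ) (hκ1 : κ < 1) (hT : 0 ≤ T)

/-- Integrating `1 / (1 + (4 ^ j τ)²)` in time yields a multiple of `4 ^ (-j)`, which cancels `2 ^
((1 - κ) j) * 2 ^ ((1 + κ) j)` exactly; this is why the decay of blocks was proved with an
integrable profile. -/
lemma exists_norm_duhL_mulPath_le {ρ : ℝ} (hρ : κ < ρ) {a : C(TimeSpace T, ℝ)} {A : ℝ}
    (hA : 0 ≤ A) (ha : ∀ t l, ∑ n ∈ shell l, ‖coeff (a.curry t) n‖ ^ 2 ≤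
      (A * ((2 : ℝ) ^ (-(1 + ρ))) ^ l) ^ 2) :
    ∃ C, 0 ≤ C ∧ ∀ k : CM, ‖duhL hκ hκ1 hT (mulPath a k)‖ ≤ C * ‖embB hκ k‖ := by
  obtain ⟨K, hK, H⟩ := exists_norm_block_heat_mul_le (T := T) hκ.le hρ (norm_nonneg a) hA
  refine ⟨2 * K, by positivity, fun k => ?_⟩
  have hN : ∀ l, ‖block l (coeff k)‖ ≤ ‖embB hκ k‖ * ((2 : ℝ) ^ (1 + κ)) ^ l := fun l => by
    have := norm_block_le_of_blockNorm_le (Besov.blockNorm_le (embB hκ k) l)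
    rw [toCoeffs_embB, show -(-1 - κ) = 1 + κ by ring] at this
    exact this
  -- The product estimate handles finitely many blocks. The bound for truncations does not depend on
  -- `J`, and `k ↦ duhL (mulPath a k)` is continuous on `L²`, so it survives the limit.
  have hJ : ∀ J, ‖duhL hκ hκ1 hT (mulPath a (truncCM J k))‖ ≤ 2 * K * ‖embB hκ k‖ := fun J => by
    refine (ContinuousMap.norm_le _ (by positivity)).2 fun t => Hol.norm_le fun j => ?_
    rw [coeff_duhL, blockNorm]
    have h1 := norm_block_duh_le hT (mulPath a (truncCM J k)) t.2.1 j
      (B := fun r => K * ‖embB hκ k‖ * ((2 : ℝ) ^ (1 + κ)) ^ j *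
        (1 + (4 ^ j * ((t : ℝ) - r)) ^ 2)⁻¹)
      (continuous_const.mul (Continuous.inv₀ (by fun_prop) fun r => by positivity))
      (fun r hr => by
        rw [mulPath_apply, truncCM, coeff_mulCM_toCM, ← div_eq_mul_inv]
        exact H _ (norm_curry_le a _) (ha _) (coeff k) (coeff_neg k) _ (norm_nonneg _) hN J j _
          (sub_nonneg.2 hr.2) (by linarith [hr.1, t.2.2]))
    rw [intervalIntegral.integral_const_mul] at h1
    have h2 : ((2 : ℝ) ^ (1 - κ)) ^ j * ((2 : ℝ) ^ (1 + κ)) ^ j = 4 ^ j := by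
      rw [← mul_pow, ← Real.rpow_add two_pos, show 1 - κ + (1 + κ) = 2 by ring]
      norm_num
    calc (2 : ℝ) ^ ((1 - κ) * j) * ‖block j (duh hT (mulPath a (truncCM J k)) t)‖
        ≤ (2 : ℝ) ^ ((1 - κ) * j) * (K * ‖embB hκ k‖ * ((2 : ℝ) ^ (1 + κ)) ^ j * (2 / 4 ^ j)) := by
          gcongr
          refine h1.trans ?_
          gcongr
          exact integral_inv_one_add_sq_le (by positivity) _
      _ = 2 * K * ‖embB hκ k‖ *
          (((2 : ℝ) ^ (1 - κ)) ^ j * ((2 : ℝ) ^ (1 + κ)) ^ j / 4 ^ j) := by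
          rw [two_rpow_mul_nat]; ring
      _ = 2 * K * ‖embB hκ k‖ := by
          rw [h2, div_self (by positivity), mul_one]
  have hlim : Tendsto (fun J => ‖duhL hκ hκ1 hT (mulPath a (truncCM J k))‖) atTop
      (𝓝 ‖duhL hκ hκ1 hT (mulPath a k)‖) :=
    ((((duhL hκ hκ1 hT).comp (mulPath a)).continuous.tendsto k).comp (tendsto_truncCM k)).norm
  exact le_of_tendsto hlim (.of_forall hJ)

variable {g : ℝ → ℝ} {u₀ : C(Torus, ℝ)} (hg : ContDiff ℝ 7 g)
  (hgb : ∀ m ≤ 7, ∃ C, ∀ x, |iteratedDeriv m g x| ≤ C) (hu₀ : IsHolder (1 + 2 * κ) u₀)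

include hκ hκ1 hT hg hgb hu₀

/-- The datum contributes `1 + 2κ` derivatives; the Duhamel term has two in `L²`, which is enough as
`κ < 1/2`. -/
lemma exists_dyadicL2_sol (hκ2 : κ < 1 / 2) (h : CM) :
    ∃ M, 0 ≤ M ∧ ∀ t : Icc (0 : ℝ) T,
      DyadicL2 (1 + 2 * κ) M (coeff (Hol.toC ((sol g u₀ h : PathSpace κ T) t))) := by
  obtain ⟨b, hb⟩ := exists_heat_path (T := T) hκ hκ1 hu₀
  obtain ⟨M, hM⟩ := hu₀
  have hM0 : 0 ≤ M := (blockNorm_nonneg _ _ _).trans (hM 0)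
  obtain ⟨φ, hφ⟩ : ∃ φ, (sol g u₀ h : PathSpace κ T) = b + duhL hκ hκ1 hT φ :=
    ⟨_, sol_eq hκ hκ1 hT hg hgb ⟨M, hM⟩ hb h⟩
  refine ⟨2 * (M + Real.exp T * ‖φ‖), by positivity, fun t => ?_⟩
  rw [hφ, ContinuousMap.add_apply, Hol.coeff_toC_add, hb, coeff_duhL]
  have h1 : DyadicL2 (1 + 2 * κ) M (heat t (coeff u₀)) :=
    dyadicL2_of_blockNorm_le fun j => (blockNorm_heat_le j t.2.1 _).trans (hM j)
  exact h1.add hM0 (by positivity) (dyadicL2_duh hT (by linarith) φ t.2)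

/-- The first derivative of the solution map is bounded for the norm of `B`. -/
lemma exists_norm_der1_le (hκ2 : κ < 1 / 2) (h : CM) :
    ∃ C, 0 ≤ C ∧ ∀ k, ‖(der1 g u₀ h k : PathSpace κ T)‖ ≤ C * ‖embB hκ k‖ := by
  have hg1 : Continuous (deriv g) := hg.continuous_deriv (by norm_num)
  obtain ⟨C₁, hC₁, h1⟩ := exists_norm_le_linOp hκ hκ1 hT (nem hg1 (ev hκ1 (sol g u₀ h))) h
  obtain ⟨M, hM, hsol⟩ := exists_dyadicL2_sol (T := T) hκ hκ1 hT hg hgb hu₀ hκ2 h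
  obtain ⟨L₁, hL₁⟩ := hgb 1 (by norm_num)
  obtain ⟨L₂, hL₂⟩ := hgb 2 (by norm_num)
  -- The value `ρ = 3κ/2` lies strictly between `κ`, needed for the product, and `2κ`, granted by
  -- the regularity of the solution.
  obtain ⟨A, hA, hshell⟩ := exists_sum_sq_coeff_nem_le (hg.of_le (by norm_num)) (L₁ := L₁)
    (by simpa using hL₁) hL₂ (γ := 1 + 2 * κ) (ρ := 3 / 2 * κ) (by linarith) (by linarith)
    (by linarith) hM
  obtain ⟨C₂, hC₂, h2⟩ := exists_norm_duhL_mulPath_le hκ hκ1 hT (ρ := 3 / 2 * κ) (by linarith)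
    (a := nem hg.continuous (ev hκ1 (sol g u₀ h))) hA
    (fun t l => hshell _ (hsol t) l (shell l) fun n hn => mem_shell.1 hn)
  refine ⟨C₁ * C₂, by positivity, fun k => (h1 _).trans ?_⟩
  rw [linOp_der1 hκ hκ1 hT hg hgb hu₀ hg1, mul_assoc]
  gcongr
  exact h2 k

end Key

end GPAM

namespace GPAM

/-! ### Random signs -/

/-- The choices of signs. -/
noncomputable def signs (I : Type*) [Fintype I] [DecidableEq I] : Finset (I → ℝ) :=
  Fintype.piFinset fun _ => {1, -1}

section Signs

variable {I : Type*} [Fintype I] [DecidableEq I]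

lemma mem_signs {ε : I → ℝ} : ε ∈ signs I ↔ ∀ i, ε i = 1 ∨ ε i = -1 := by
  simp [signs, Fintype.mem_piFinset]

lemma card_signs : (signs I).card = 2 ^ Fintype.card I := by
  rw [signs, Fintype.card_piFinset, Finset.prod_const, Finset.card_univ,
    Finset.card_pair (by norm_num)]

/-- The exponential factors over the signs into a product of `2 cosh (a i)`, and `cosh x ≤ exp (x² /
2)`. -/
lemma sum_signs_exp_le (a : I → ℝ) :
    ∑ ε ∈ signs I, Real.exp (∑ i, ε i * a i) ≤ (signs I).card * Real.exp ((∑ i, a i ^ 2) / 2) := by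
  have h1 : ∑ ε ∈ signs I, Real.exp (∑ i, ε i * a i) = ∏ i, (2 * Real.cosh (a i)) := by
    simp only [Real.exp_sum]
    rw [signs, ← Finset.prod_univ_sum (fun _ : I => ({1, -1} : Finset ℝ))
      fun i x => Real.exp (x * a i)]
    refine Finset.prod_congr rfl fun i _ => ?_
    rw [Finset.sum_pair (by norm_num), Real.cosh_eq]
    ring_nf
  rw [h1, Finset.prod_mul_distrib, Finset.prod_const, Finset.card_univ, card_signs, Finset.sum_div,
    Real.exp_sum]
  push_cast
  gcongr with i _
  exact Real.cosh_le_exp_half_sq _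

lemma pow_two_mul_le (m : ℕ) (y : ℝ) :
    y ^ (2 * m) ≤ (2 * m).factorial * (Real.exp y + Real.exp (-y)) := by
  have h1 : |y| ^ (2 * m) / (2 * m).factorial ≤ Real.exp |y| :=
    Real.pow_div_factorial_le_exp _ (abs_nonneg y) _
  have h2 : |y| ^ (2 * m) = y ^ (2 * m) := by rw [pow_mul, pow_mul, sq_abs]
  rw [div_le_iff₀ (by positivity), h2] at h1
  refine h1.trans ?_
  rw [mul_comm]
  gcongr
  rcases abs_cases y with ⟨h, _⟩ | ⟨h, _⟩
  · rw [h]; linarith [Real.exp_pos (-y)]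
  · rw [h]; linarith [Real.exp_pos y]

/-- Khintchine's inequality for even moments, with a crude constant. -/
lemma sum_signs_pow_le (m : ℕ) {a : I → ℝ} {R : ℝ} (hR : 0 < R) (ha : ∑ i, a i ^ 2 ≤ R ^ 2) :
    ∑ ε ∈ signs I, (∑ i, ε i * a i) ^ (2 * m) ≤
      (signs I).card * (4 * (2 * m).factorial * R ^ (2 * m)) := by
  have h1 : ∀ σ : ℝ, σ ^ 2 = 1 →
      ∑ ε ∈ signs I, Real.exp (∑ i, ε i * (σ * a i / R)) ≤ (signs I).card * 2 := fun σ hσ => by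
    refine (sum_signs_exp_le _).trans ?_
    gcongr
    have h2 : ∑ i, (σ * a i / R) ^ 2 ≤ 1 := by
      simp only [div_pow, mul_pow, hσ, one_mul]
      rw [← Finset.sum_div]
      exact div_le_one_of_le₀ ha (sq_nonneg R)
    calc Real.exp ((∑ i, (σ * a i / R) ^ 2) / 2) ≤ Real.exp (1 / 2) :=
          Real.exp_le_exp.2 (by linarith)
      _ ≤ 2 := by
          have h3 := Real.exp_one_lt_d9
          have h4 : Real.exp (1 / 2) ^ 2 = Real.exp 1 := by
            rw [← Real.exp_nat_mul]; norm_num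
          nlinarith [Real.exp_pos (1 / 2)]
  have h2 : ∀ ε : I → ℝ, (∑ i, ε i * a i) ^ (2 * m) ≤ R ^ (2 * m) * ((2 * m).factorial *
      (Real.exp (∑ i, ε i * (1 * a i / R)) + Real.exp (∑ i, ε i * (-1 * a i / R)))) := fun ε => by
    have h3 : ∑ i, ε i * (1 * a i / R) = (∑ i, ε i * a i) / R := by
      rw [Finset.sum_div]
      exact Finset.sum_congr rfl fun i _ => by ring
    have h4 : ∑ i, ε i * (-1 * a i / R) = -((∑ i, ε i * a i) / R) := by
      rw [Finset.sum_div, ← Finset.sum_neg_distrib]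
      exact Finset.sum_congr rfl fun i _ => by ring
    rw [h3, h4]
    refine le_trans (le_of_eq ?_) (mul_le_mul_of_nonneg_left (pow_two_mul_le m _) (by positivity))
    rw [← mul_pow, mul_div_cancel₀ _ hR.ne']
  refine (Finset.sum_le_sum fun ε _ => h2 ε).trans ?_
  rw [← Finset.mul_sum, ← Finset.mul_sum, Finset.sum_add_distrib]
  calc _ ≤ R ^ (2 * m) * ((2 * m).factorial * ((signs I).card * 2 + (signs I).card * 2)) := by
        gcongr
        · exact h1 1 (by norm_num)
        · exact h1 (-1) (by norm_num)
    _ = _ := by ring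

end Signs

/-! ### A Nikolskii inequality -/

/-- The frequencies with coordinates of size at most `R`. -/
noncomputable def cube (R : ℕ) : Finset Freq := Fintype.piFinset fun _ => Finset.Icc (-(R : ℤ)) R

lemma mem_cube {R : ℕ} {n : Freq} : n ∈ cube R ↔ ∀ i, |n i| ≤ R := by
  simp [cube, Fintype.mem_piFinset, abs_le]

lemma card_cube (R : ℕ) : (cube R).card = (2 * R + 1) ^ 2 := by
  simp only [cube, Fintype.card_piFinset, Finset.prod_const, Finset.card_univ, Fintype.card_fin,
    Int.card_Icc]
  congr 1
  omega

lemma fcoeff_pow_trig {R : ℕ} (c : Coeffs) (m : ℕ) {n : Freq} (hn : n ∉ cube (m * R)) :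
    fcoeff (trig (cube R) c ^ m : C(Torus, ℂ)) n = 0 := by
  induction m generalizing n with
  | zero =>
    have h1 : ((trig (cube R) c ^ 0 : C(Torus, ℂ)) : Torus → ℂ) =
        UnitAddTorus.mFourier (0 : Freq) := by
      rw [pow_zero, UnitAddTorus.mFourier_zero]
    rw [h1, fcoeff_mFourier, if_neg]
    rintro rfl
    exact hn (mem_cube.2 (by simp))
  | succ m ih =>
    have h1 : ((trig (cube R) c ^ (m + 1) : C(Torus, ℂ)) : Torus → ℂ) =
        fun x => (trig (cube R) c ^ m : C(Torus, ℂ)) x * trig (cube R) c x := by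
      rw [pow_succ]; rfl
    rw [h1, fcoeff_mul_trig]
    refine Finset.sum_eq_zero fun p hp => ?_
    rw [ih, mul_zero]
    intro h
    refine hn (mem_cube.2 fun i => ?_)
    have h2 := mem_cube.1 h i
    have h3 := mem_cube.1 hp i
    rw [Pi.sub_apply] at h2
    have h4 := abs_add_le (n i - p i) (p i)
    rw [sub_add_cancel] at h4
    push_cast at h2 ⊢
    linarith

/-- Bernstein's inequality applied to the `m`-th power, a polynomial with frequencies in `cube (m *
R)`. The number of frequencies then enters only to the first power against the `2m`-th power of the
norm. -/
lemma norm_pow_trig_cube_le {R : ℕ} (c : Coeffs) (m : ℕ) :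
    ‖trig (cube R) c‖ ^ (2 * m) ≤
      (2 * (m * R : ℕ) + 1) ^ 2 * ∫ x, ‖trig (cube R) c x‖ ^ (2 * m) ∂torusMeasure := by
  set f := trig (cube R) c with hf
  obtain ⟨x, -, hx⟩ := isCompact_univ.exists_isMaxOn (univ_nonempty (α := Torus))
    (f.continuous.norm.continuousOn)
  have hx' : ‖f‖ ≤ ‖f x‖ := (ContinuousMap.norm_le _ (norm_nonneg _)).2 fun y => hx (mem_univ y)
  have h1 : (f ^ m : C(Torus, ℂ)) = trig (cube (m * R)) (fcoeff (f ^ m : C(Torus, ℂ))) := by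
    refine eq_of_fcoeff_eq fun n => ?_
    rw [fcoeff_trig]
    split_ifs with h
    · rfl
    · exact fcoeff_pow_trig c m h
  have h2 : ‖f x‖ ^ m ≤ Real.sqrt (cube (m * R)).card *
      Real.sqrt (∫ x, ‖f x‖ ^ (2 * m) ∂torusMeasure) := by
    have h3 : ‖f x‖ ^ m = ‖(f ^ m : C(Torus, ℂ)) x‖ := by
      rw [ContinuousMap.pow_apply, norm_pow]
    rw [h3]
    refine ((f ^ m : C(Torus, ℂ)).norm_coe_le_norm x).trans ?_
    conv_lhs => rw [h1]
    refine (norm_trig_le_sqrt _ _).trans ?_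
    refine mul_le_mul_of_nonneg_left (Real.sqrt_le_sqrt ?_) (Real.sqrt_nonneg _)
    refine (sum_sq_fcoeff_le (memLp_of_continuous (map_continuous _)) _).trans_eq ?_
    refine integral_congr_ae (.of_forall fun y => ?_)
    simp only [ContinuousMap.pow_apply, norm_pow]
    rw [← pow_mul, mul_comm]
  have hI : 0 ≤ ∫ x, ‖f x‖ ^ (2 * m) ∂torusMeasure := integral_nonneg fun x => by positivity
  calc ‖f‖ ^ (2 * m) ≤ ‖f x‖ ^ (2 * m) := by gcongr
    _ = (‖f x‖ ^ m) ^ 2 := by rw [← pow_mul, mul_comm]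
    _ ≤ _ := pow_le_pow_left₀ (by positivity) h2 2
    _ = _ := by
        rw [mul_pow, Real.sq_sqrt (by positivity), Real.sq_sqrt hI, card_cube]
        congr 1
        push_cast
        ring

lemma freqBox_eq_cube (j : ℕ) : freqBox j = cube (2 ^ (j + 1)) := by
  rw [freqBox, cube]
  push_cast
  rfl

lemma norm_pow_block_le (j : ℕ) (c : Coeffs) {m : ℕ} (hm : 1 ≤ m) :
    ‖block j c‖ ^ (2 * m) ≤
      (5 * m * 2 ^ j) ^ 2 * ∫ x, ‖block j c x‖ ^ (2 * m) ∂torusMeasure := by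
  rw [block_eq_trig, freqBox_eq_cube]
  refine (norm_pow_trig_cube_le _ m).trans ?_
  have h1 : (1 : ℝ) ≤ m := by exact_mod_cast hm
  have h2 : (1 : ℝ) ≤ 2 ^ j := one_le_pow₀ one_le_two
  gcongr
  push_cast
  rw [pow_succ]
  nlinarith

/-! ### Random series in the space `B` -/

section RandomSeries

variable {I : Type*} [Fintype I] [DecidableEq I]

lemma block_coeff_real (j : ℕ) (k : CM) (x : Torus) :
    ((block j (coeff k) x).re : ℂ) = block j (coeff k) x := by
  refine ofReal_re_eq (fun n => ?_) x
  rw [fcoeff_block, fcoeff_block, dyadic_neg, coeff_neg, map_mul, Complex.conj_ofReal]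

/-- The evaluation of a block at a point. -/
noncomputable def blockAt (j : ℕ) (x : Torus) : CM →ₗ[ℝ] ℝ where
  toFun k := (block j (coeff k) x).re
  map_add' k l := by rw [coeff_add_CM, block_add]; rfl
  map_smul' r k := by rw [coeff_smul_CM, block_smul]; simp

lemma norm_block_apply (j : ℕ) (x : Torus) (k : CM) :
    ‖block j (coeff k) x‖ = |blockAt j x k| := by
  rw [← block_coeff_real, Complex.norm_real]
  rfl

lemma abs_blockAt_le (j : ℕ) (x : Torus) (k : CM) : |blockAt j x k| ≤ 5 * 2 ^ j * ‖k‖ := by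
  rw [← norm_block_apply]
  exact ((block j (coeff k)).norm_coe_le_norm x).trans (norm_block_coeff_le k j)

omit [DecidableEq I] in
-- Bessel's inequality for the functional `L`, proved by testing `L` on `∑ L (v i) • v i`.
lemma sum_sq_apply_le {H : Type*} [NormedAddCommGroup H] [InnerProductSpace ℝ H] {v : I → H}
    (hv : Orthonormal ℝ v) (L : H →ₗ[ℝ] ℝ) {C : ℝ} (hL : ∀ k, |L k| ≤ C * ‖k‖) :
    ∑ i, L (v i) ^ 2 ≤ C ^ 2 := by
  set A := ∑ i, L (v i) ^ 2 with hA
  have hA0 : 0 ≤ A := Finset.sum_nonneg fun i _ => sq_nonneg _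
  have h1 : L (∑ i, L (v i) • v i) = A := by
    rw [map_sum, hA]
    exact Finset.sum_congr rfl fun i _ => by rw [map_smul, smul_eq_mul, sq]
  have h2 : ‖∑ i, L (v i) • v i‖ ^ 2 = A := by
    rw [← real_inner_self_eq_norm_sq, hv.inner_sum]
    exact Finset.sum_congr rfl fun i _ => by simp [sq]
  have h3 := hL (∑ i, L (v i) • v i)
  rw [h1, abs_of_nonneg hA0] at h3
  rcases hA0.eq_or_lt with h | h
  · rw [← h]; positivity
  · have h4 : A ^ 2 ≤ C ^ 2 * A := by
      rw [← h2, ← mul_pow, h2]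
      exact pow_le_pow_left₀ hA0 h3 2
    nlinarith

/-- The supremum is traded for an `L^{2m}` norm at the price of about `2 ^ (2j)`. At a fixed point
Khintchine's inequality applies with variance bounded by Bessel's inequality, independently of the
number of vectors. -/
lemma sum_signs_norm_block_pow_le {v : I → CM} (hv : Orthonormal ℝ v) (j : ℕ) {m : ℕ}
    (hm : 1 ≤ m) :
    ∑ ε ∈ signs I, ‖block j (coeff (∑ i, ε i • v i : CM))‖ ^ (2 * m) ≤
      (5 * m * 2 ^ j) ^ 2 * ((signs I).card * (4 * (2 * m).factorial * (5 * 2 ^ j) ^ (2 * m))) := by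
  refine (Finset.sum_le_sum fun ε _ => norm_pow_block_le j _ hm).trans ?_
  rw [← Finset.mul_sum, ← integral_finsetSum _ fun ε _ =>
    integrable_of_continuous_real (by fun_prop)]
  gcongr
  have h1 : ∀ x, ∑ ε ∈ signs I, ‖block j (coeff (∑ i, ε i • v i : CM)) x‖ ^ (2 * m) ≤
      (signs I).card * (4 * (2 * m).factorial * (5 * 2 ^ j) ^ (2 * m)) := fun x => by
    refine le_trans (le_of_eq (Finset.sum_congr rfl fun ε _ => ?_))
      (sum_signs_pow_le m (by positivity)
        (sum_sq_apply_le hv (blockAt j x) (abs_blockAt_le j x)))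
    rw [norm_block_apply, map_sum, pow_mul, sq_abs, ← pow_mul]
    simp only [map_smul, smul_eq_mul]
  refine (integral_mono (integrable_of_continuous_real (by fun_prop)) (integrable_const _)
    h1).trans_eq ?_
  simp

/-- The discrete form of the fact that white noise lives in `B`. What matters is that `M` depends on
neither the size of `I` nor the orthonormal family. -/
lemma exists_sum_signs_norm_embB_le {κ : ℝ} (hκ : 0 < κ) :
    ∃ M, 0 ≤ M ∧ ∀ (I : Type) [Fintype I] [DecidableEq I] (v : I → CM), Orthonormal ℝ v →
      ∑ ε ∈ signs I, ‖embB hκ (∑ i, ε i • v i)‖ ≤ (signs I).card * M := by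
  -- High moments make the cost `2 ^ (2j)` of the supremum smaller than the gain `2 ^ (-2mκj)`.
  obtain ⟨m, hm⟩ := exists_nat_gt (1 / κ)
  have hm1 : 1 ≤ m := by
    by_contra! h
    have : (m : ℝ) = 0 := by exact_mod_cast Nat.lt_one_iff.1 h
    rw [this] at hm
    exact absurd hm (not_lt.2 (by positivity))
  have hmκ : 1 < m * κ := by rwa [div_lt_iff₀ hκ] at hm
  set q : ℝ := (2 : ℝ) ^ (2 - 2 * m * κ) with hq
  have hq0 : 0 ≤ q := by positivity
  have hq1 : q < 1 := Real.rpow_lt_one_of_one_lt_of_neg one_lt_two (by linarith)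
  have hqi : 0 ≤ (1 - q)⁻¹ := inv_nonneg.2 (by linarith)
  set D : ℝ := (5 * m) ^ 2 * (4 * (2 * m).factorial * 5 ^ (2 * m)) with hD
  have hD0 : 0 ≤ D := by positivity
  refine ⟨D * (1 - q)⁻¹ + 1, by positivity, fun I _ _ v hv => ?_⟩
  set β : (I → ℝ) → ℕ → ℝ := fun ε j => blockNorm (-1 - κ) j (coeff (∑ i, ε i • v i : CM)) with hβ
  have hβ0 : ∀ ε j, 0 ≤ β ε j := fun ε j => blockNorm_nonneg _ _ _
  have hsum : ∀ j, ∑ ε ∈ signs I, β ε j ^ (2 * m) ≤ (signs I).card * D * q ^ j := fun j => by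
    have h1 : ∀ ε, β ε j ^ (2 * m) = ((2 : ℝ) ^ ((-1 - κ) * j)) ^ (2 * m) *
        ‖block j (coeff (∑ i, ε i • v i : CM))‖ ^ (2 * m) := fun ε => by
      rw [hβ, ← mul_pow]; rfl
    simp only [h1]
    rw [← Finset.mul_sum]
    refine (mul_le_mul_of_nonneg_left (sum_signs_norm_block_pow_le hv j hm1)
      (by positivity)).trans_eq ?_
    have h2 : ((2 : ℝ) ^ ((-1 - κ) * j)) ^ (2 * m) * ((2 ^ j) ^ 2 * (2 ^ j) ^ (2 * m)) = q ^ j := by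
      have h3 : ∀ a : ℝ, ((2 : ℝ) ^ a) ^ j = 2 ^ (a * j) := fun a => (two_rpow_mul_nat a j).symm
      rw [hq, h3, ← Real.rpow_natCast (2 : ℝ) j, ← Real.rpow_mul_natCast zero_le_two,
        ← Real.rpow_mul_natCast zero_le_two, ← Real.rpow_mul_natCast zero_le_two,
        ← Real.rpow_add two_pos, ← Real.rpow_add two_pos]
      congr 1
      push_cast
      ring
    rw [← h2, hD]
    ring
  have hsm : ∀ ε ∈ signs I, Summable fun j => β ε j ^ (2 * m) := fun ε hε => by
    refine Summable.of_nonneg_of_le (fun j => pow_nonneg (hβ0 ε j) _) (fun j => ?_)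
      ((summable_geometric_of_lt_one hq0 hq1).mul_left ((signs I).card * D))
    exact (Finset.single_le_sum (f := fun ε => β ε j ^ (2 * m))
      (fun ε _ => pow_nonneg (hβ0 ε j) _) hε).trans (hsum j)
  -- For nonnegative `x` one has `x ≤ x ^ (2m) + 1`, which replaces Jensen's inequality.
  have hnorm : ∀ ε ∈ signs I, ‖embB hκ (∑ i, ε i • v i)‖ ≤ ∑' j, β ε j ^ (2 * m) + 1 :=
    fun ε hε => by
    refine Besov.norm_le fun j => ?_
    have h1 : β ε j ^ (2 * m) ≤ ∑' j, β ε j ^ (2 * m) :=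
      (hsm ε hε).le_tsum j fun i _ => pow_nonneg (hβ0 ε i) _
    rw [toCoeffs_embB]
    show β ε j ≤ _
    rcases le_total (β ε j) 1 with h | h
    · have := pow_nonneg (hβ0 ε j) (2 * m)
      linarith
    · have := le_self_pow₀ h (n := 2 * m) (by omega)
      linarith
  refine (Finset.sum_le_sum hnorm).trans ?_
  rw [Finset.sum_add_distrib, ← Summable.tsum_finsetSum hsm, Finset.sum_const, nsmul_eq_mul,
    mul_one, mul_add, mul_one]
  gcongr
  calc ∑' j, ∑ ε ∈ signs I, β ε j ^ (2 * m) ≤ ∑' j, (signs I).card * D * q ^ j :=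
        Summable.tsum_le_tsum hsum (summable_sum hsm)
          ((summable_geometric_of_lt_one hq0 hq1).mul_left _)
    _ = _ := by rw [tsum_mul_left, tsum_geometric_of_lt_one hq0 hq1, mul_assoc]

end RandomSeries

end GPAM

namespace GPAM

/-! ### Compact symmetric operators -/

/-- The spectral theorem: a Hilbert basis of eigenvectors. -/
lemma exists_hilbertBasis_eigenvectors {H : Type} [NormedAddCommGroup H] [InnerProductSpace ℝ H]
    [CompleteSpace H] {S : H →L[ℝ] H} (hc : IsCompactOperator S) (hs : S.IsSymmetric) :
    ∃ (ι : Type) (b : HilbertBasis ι ℝ H) (μ : ι → ℝ), ∀ i, S (b i) = μ i • b i := by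
  let V : ℝ → Submodule ℝ H := fun μ => Module.End.eigenspace (S : Module.End ℝ H) μ
  have hV : ∀ μ x, x ∈ V μ ↔ S x = μ • x := fun μ x => Module.End.mem_eigenspace_iff
  have hcl : ∀ μ, IsClosed (V μ : Set H) := fun μ => by
    have : (V μ : Set H) = {x | S x = μ • x} := by ext x; exact hV μ x
    rw [this]
    exact isClosed_eq S.continuous (continuous_const_smul μ)
  have : ∀ μ, CompleteSpace (V μ) := fun μ => (hcl μ).completeSpace_coe
  choose w b hb using fun μ => exists_hilbertBasis ℝ (V μ)
  let v : (Σ μ, w μ) → H := fun a => (b a.1 a.2 : H)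
  have hv : Orthonormal ℝ v :=
    hs.orthogonalFamily_eigenspaces.orthonormal_sigma_orthonormal fun μ => (b μ).orthonormal
  -- A vector orthogonal to the Hilbert bases of all eigenspaces is orthogonal to the eigenspaces
  -- themselves, by expansion in those bases; the spectral theorem then makes it vanish.
  have hperp : (Submodule.span ℝ (range v))ᗮ = ⊥ := by
    rw [eq_bot_iff, ← ContinuousLinearMap.orthogonalComplement_iSup_eigenspaces_eq_bot hc hs,
      ← Submodule.iInf_orthogonal, le_iInf_iff]
    intro μ x hx y hy
    have h1 := (b μ).hasSum_repr ⟨y, hy⟩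
    have h2 := h1.mapL (((innerSL ℝ).flip x).comp (V μ).subtypeL)
    refine h2.unique ?_
    convert hasSum_zero with i
    have h3 : inner ℝ ((b μ i : V μ) : H) x = 0 := hx _ (Submodule.subset_span ⟨⟨μ, i⟩, rfl⟩)
    have h4 : (((innerSL ℝ).flip x).comp (V μ).subtypeL) (b μ i) = 0 := h3
    rw [map_smul, h4, smul_zero]
  refine ⟨Σ μ, w μ, HilbertBasis.mkOfOrthogonalEqBot hv hperp, fun a => a.1, fun a => ?_⟩
  rw [HilbertBasis.coe_mkOfOrthogonalEqBot]
  exact (hV _ _).1 (b a.1 a.2).2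

lemma orthonormal_smul_signs {H ι : Type*} [NormedAddCommGroup H] [InnerProductSpace ℝ H]
    {v : ι → H} (hv : Orthonormal ℝ v) {σ : ι → ℝ} (hσ : ∀ i, σ i = 1 ∨ σ i = -1) :
    Orthonormal ℝ fun i => σ i • v i := by
  refine ⟨fun i => ?_, fun i j hij => ?_⟩
  · rw [norm_smul, hv.1 i]
    rcases hσ i with h | h <;> simp [h]
  · simp only [inner_smul_left, inner_smul_right, hv.2 hij, mul_zero]

/-- A compact symmetric operator with absolutely summable eigenvalues is trace class. -/
lemma isTraceClass_of_hilbertBasis {H : Type} [NormedAddCommGroup H] [InnerProductSpace ℝ H]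
    {S : H →L[ℝ] H} {ι : Type} (b : HilbertBasis ι ℝ H) {μ : ι → ℝ}
    (hb : ∀ i, S (b i) = μ i • b i) (hμ : Summable fun i => |μ i|) : IsTraceClass S := by
  classical
  set σ : ι → ℝ := fun i => if μ i < 0 then -1 else 1 with hσ
  have hσ2 : ∀ i, σ i = 1 ∨ σ i = -1 := fun i => by
    rw [hσ]
    by_cases h : μ i < 0 <;> simp [h]
  have hσμ : ∀ i, |μ i| * σ i = μ i := fun i => by
    rw [hσ]
    by_cases h : μ i < 0
    · simp [h, abs_of_neg h]
    · simp [h, abs_of_nonneg (not_lt.1 h)]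
  refine ⟨ι, fun i => |μ i|, b, fun i => σ i • b i, b.orthonormal, ?_, fun i => abs_nonneg _, hμ,
    fun x => ?_⟩
  · exact orthonormal_smul_signs b.orthonormal hσ2
  · have h1 := (b.hasSum_repr x).mapL S
    convert h1 using 1
    funext i
    rw [map_smul, hb, b.repr_apply_apply, smul_smul, smul_smul]
    congr 1
    conv_rhs => rw [← hσμ i]
    ring

end GPAM

namespace GPAM

/-! ### Bilinear forms that are bounded for the norm of `B` -/

lemma CM.ext_coeff {k l : CM} (h : coeff k = coeff l) : k = l := by
  have h1 := hasSum_sq_coeff_CM (k - l)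
  rw [coeff_sub_CM, h, sub_self] at h1
  have h2 : ‖k - l‖ ^ 2 = 0 := h1.unique (by simp)
  exact sub_eq_zero.1 (norm_eq_zero.1 (pow_eq_zero_iff two_ne_zero |>.1 h2))

lemma norm_truncCM_le (J : ℕ) (k : CM) : ‖truncCM J k‖ ≤ ‖k‖ := by
  refine le_of_sq_le_sq ?_ (norm_nonneg k)
  refine hasSum_le (fun n => ?_) (hasSum_sq_coeff_CM (truncCM J k)) (hasSum_sq_coeff_CM k)
  rw [coeff_truncCM, truncC, norm_mul, mul_pow, Complex.norm_real, Real.norm_eq_abs, sq_abs]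
  refine mul_le_of_le_one_left (sq_nonneg _) (pow_le_one₀ ?_ ?_)
  · exact Real.smoothTransition.nonneg _
  · exact Real.smoothTransition.le_one _

/-- The projection on low frequencies as a continuous linear operator. -/
noncomputable def truncL (J : ℕ) : CM →L[ℝ] CM :=
  LinearMap.mkContinuous
    { toFun := truncCM J
      map_add' := fun k l => CM.ext_coeff <| by
        rw [coeff_add_CM, coeff_truncCM, coeff_truncCM, coeff_truncCM, coeff_add_CM]
        funext n
        simp only [truncC, Pi.add_apply, mul_add]
      map_smul' := fun r k => CM.ext_coeff <| by
        rw [RingHom.id_apply, coeff_smul_CM, coeff_truncCM, coeff_truncCM, coeff_smul_CM]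
        funext n
        simp only [truncC, Pi.smul_apply, mul_smul_comm] } 1
    fun k => by
      rw [one_mul]
      exact norm_truncCM_le J k

lemma truncL_apply (J : ℕ) (k : CM) : truncL J k = truncCM J k := rfl

/-- The functions with frequencies in a finite box. -/
noncomputable def bandLimited (J : ℕ) : Submodule ℝ CM :=
  ⨅ n : {n : Freq // n ∉ freqBox J}, LinearMap.ker (coeffL n.1 : CM →ₗ[ℝ] ℂ)

lemma mem_bandLimited {J : ℕ} {k : CM} : k ∈ bandLimited J ↔ ∀ n ∉ freqBox J, coeff k n = 0 := by
  simp [bandLimited, Submodule.mem_iInf, coeffL_apply]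

lemma finiteDimensional_bandLimited (J : ℕ) : FiniteDimensional ℝ (bandLimited J) := by
  let f : bandLimited J →ₗ[ℝ] (freqBox J → ℂ) :=
    LinearMap.pi fun n => (coeffL n.1 : CM →ₗ[ℝ] ℂ) ∘ₗ (bandLimited J).subtype
  refine FiniteDimensional.of_injective f fun k l hkl => Subtype.ext (CM.ext_coeff ?_)
  funext n
  by_cases hn : n ∈ freqBox J
  · exact congrFun hkl ⟨n, hn⟩
  · rw [mem_bandLimited.1 k.2 n hn, mem_bandLimited.1 l.2 n hn]

lemma isCompactOperator_truncL (J : ℕ) : IsCompactOperator (truncL J) := by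
  have := finiteDimensional_bandLimited J
  have h1 : ∀ k, truncL J k ∈ bandLimited J := fun k => mem_bandLimited.2 fun n hn => by
    rw [truncL_apply, coeff_truncCM, truncC, lowPass_eq_zero_of_notMem hn]
    simp
  have : ProperSpace (bandLimited J) := FiniteDimensional.proper ℝ _
  have h2 := isCompactOperator_of_locallyCompactSpace_dom
    ((truncL J).codRestrict (bandLimited J) h1)
  exact h2.clm_comp (bandLimited J).subtypeL

/-! ### From boundedness in `B` to trace class and to the extension -/

section

variable {κ : ℝ} (hκ : 0 < κ)

lemma exists_norm_embB_sub_truncCM_le :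
    ∃ C, 0 ≤ C ∧ ∀ J k, ‖embB hκ (k - truncCM J k)‖ ≤ C * ((2 : ℝ) ^ (-κ)) ^ J * ‖k‖ := by
  obtain ⟨C, hC, H⟩ := exists_blockNorm_sub_truncC_le
  refine ⟨C * 5, by positivity, fun J k => Besov.norm_le fun j => ?_⟩
  rw [toCoeffs_embB, coeff_sub_CM, coeff_truncCM]
  rcases lt_or_ge j J with h | h
  · rw [(H _ J j _).1 h]
    positivity
  · refine (H _ J j _).2.trans ?_
    calc C * blockNorm (-1 - κ) j (coeff k) ≤ C * (5 * ‖k‖ * ((2 : ℝ) ^ (-κ)) ^ j) := by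
          gcongr
          exact blockNorm_coeff_le κ k j
      _ ≤ C * (5 * ‖k‖ * ((2 : ℝ) ^ (-κ)) ^ J) := by
          gcongr C * (5 * ‖k‖ * ?_)
          exact pow_le_pow_of_le_one (by positivity) (two_rpow_neg_lt_one hκ).le h
      _ = _ := by ring

/-- `S` is the operator norm limit of the finite rank operators `S ∘ truncL J`, the error being of
order `2 ^ (-κ J)`. -/
lemma isCompactOperator_of_norm_le_embB {S : CM →L[ℝ] CM} {C : ℝ} (hC : 0 ≤ C)
    (hS : ∀ k, ‖S k‖ ≤ C * ‖embB hκ k‖) : IsCompactOperator S := by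
  obtain ⟨D, hD, H⟩ := exists_norm_embB_sub_truncCM_le hκ
  have h1 : Tendsto (fun J => S.comp (truncL J)) atTop (𝓝 S) := by
    rw [tendsto_iff_norm_sub_tendsto_zero]
    refine squeeze_zero (fun J => norm_nonneg _) (fun J => ?_) (tendsto_geometric hκ (C * D))
    rw [norm_sub_rev]
    refine ContinuousLinearMap.opNorm_le_bound _ (by positivity) fun k => ?_
    rw [sub_apply, ContinuousLinearMap.comp_apply, ← map_sub, truncL_apply]
    refine (hS _).trans ?_
    calc _ ≤ C * (D * ((2 : ℝ) ^ (-κ)) ^ J * ‖k‖) := by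
          gcongr
          exact H J k
      _ = _ := by ring
  exact isCompactOperator_of_tendsto h1
    (.of_forall fun J => (isCompactOperator_truncL J).clm_comp S)

lemma exists_inner_eq (q : CM →L[ℝ] CM →L[ℝ] ℝ) :
    ∃ S : CM →L[ℝ] CM, ∀ k l, inner ℝ (S k) l = q k l := by
  let f : CM → CM := fun k => (InnerProductSpace.toDual ℝ CM).symm (q k)
  have hf : ∀ k l, inner ℝ (f k) l = q k l := fun k l =>
    InnerProductSpace.toDual_symm_apply
  refine ⟨LinearMap.mkContinuous
    { toFun := f
      map_add' := fun k l => ext_inner_right ℝ fun m => by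
        rw [inner_add_left, hf, hf, hf, map_add, add_apply]
      map_smul' := fun r k => ext_inner_right ℝ fun m => by
        rw [RingHom.id_apply, real_inner_smul_left, hf, hf, map_smul]
        rfl } ‖q‖ fun k => ?_, hf⟩
  show ‖f k‖ ≤ _
  rw [LinearIsometryEquiv.norm_map]
  exact q.le_opNorm k

/-- For `X = ∑ ε_i v_i` and `Y = ∑ ε_i σ_i v_i`, with `σ_i` the sign of `μ_i`, one has `⟨S Y, X⟩ = ∑
|μ_i|` for every choice of signs `ε`. Some choice makes both norms in `B` at most `2M`. -/
lemma exists_sum_abs_eigenvalues_le {S : CM →L[ℝ] CM} {C : ℝ} (hC : 0 ≤ C)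
    (hS : ∀ k l, inner ℝ (S k) l ≤ C * ‖embB hκ k‖ * ‖embB hκ l‖) :
    ∃ K, ∀ (I : Type) [Fintype I] (v : I → CM) (μ : I → ℝ), Orthonormal ℝ v →
      (∀ i, S (v i) = μ i • v i) → ∑ i, |μ i| ≤ K := by
  classical
  obtain ⟨M, hM, H⟩ := exists_sum_signs_norm_embB_le hκ
  refine ⟨C * (2 * M) * (2 * M), fun I _ v μ hv hμ => ?_⟩
  set σ : I → ℝ := fun i => if μ i < 0 then -1 else 1 with hσ
  have hσ2 : ∀ i, σ i = 1 ∨ σ i = -1 := fun i => by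
    rw [hσ]
    by_cases h : μ i < 0 <;> simp [h]
  have hσμ : ∀ i, σ i * μ i = |μ i| := fun i => by
    rw [hσ]
    by_cases h : μ i < 0
    · simp [h, abs_of_neg h]
    · simp [h, abs_of_nonneg (not_lt.1 h)]
  -- The vectors `σ_i v_i` are again orthonormal, so the sum of the two norms has average at most
  -- `2M`, and some `ε` does no worse than the average.
  obtain ⟨ε, hε, hle⟩ : ∃ ε ∈ signs I, ‖embB hκ (∑ i, ε i • v i)‖ +
      ‖embB hκ (∑ i, ε i • σ i • v i)‖ ≤ 2 * M := by
    refine Finset.exists_le_of_sum_le ?_ ?_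
    · rw [← Finset.card_pos, card_signs]
      positivity
    · rw [Finset.sum_add_distrib, Finset.sum_const, nsmul_eq_mul]
      linarith [H I _ hv, H I _ (orthonormal_smul_signs hv hσ2)]
  generalize hX : ∑ i, ε i • v i = X at hle
  generalize hY : ∑ i, ε i • σ i • v i = Y at hle
  have h1 : S Y = ∑ i, (ε i * |μ i|) • v i := by
    rw [← hY, map_sum]
    refine Finset.sum_congr rfl fun i _ => ?_
    rw [map_smul, map_smul, hμ, smul_smul, smul_smul, ← hσμ, mul_assoc]
  have h2 : inner ℝ (S Y) X = ∑ i, |μ i| := by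
    rw [h1, ← hX, hv.inner_sum]
    refine Finset.sum_congr rfl fun i _ => ?_
    rcases mem_signs.1 hε i with h | h <;> simp [h]
  rw [← h2]
  refine (hS _ _).trans ?_
  have h3 := norm_nonneg (embB hκ X)
  have h4 := norm_nonneg (embB hκ Y)
  gcongr <;> linarith

/-- A symmetric bilinear form that is bounded for the norm of `B` is trace class. -/
lemma isTraceClassForm_of_abs_le (q : CM →L[ℝ] CM →L[ℝ] ℝ) (hsym : ∀ k l, q k l = q l k) {C : ℝ}
    (hC : 0 ≤ C) (hq : ∀ k l, |q k l| ≤ C * ‖embB hκ k‖ * ‖embB hκ l‖) :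
    IsTraceClassForm fun k l => q k l := by
  obtain ⟨S, hS⟩ := exists_inner_eq q
  have hSle : ∀ k l, inner ℝ (S k) l ≤ C * ‖embB hκ k‖ * ‖embB hκ l‖ := fun k l => by
    rw [hS]
    exact (le_abs_self _).trans (hq k l)
  have hSn : ∀ k, ‖S k‖ ≤ C * 5 * ‖embB hκ k‖ := fun k => by
    -- The form is tested with `l = S k`, whose norm in `B` is controlled by its norm in `L²`.
    have h1 : ‖S k‖ ^ 2 ≤ C * 5 * ‖embB hκ k‖ * ‖S k‖ := by
      rw [← real_inner_self_eq_norm_sq]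
      refine (hSle _ _).trans ?_
      calc _ ≤ C * ‖embB hκ k‖ * (5 * ‖S k‖) := by
            gcongr
            exact norm_embB_le hκ _
        _ = _ := by ring
    rcases (norm_nonneg (S k)).eq_or_lt with h | h
    · rw [← h]; positivity
    · nlinarith
  have hsymm : S.IsSymmetric := fun k l => by
    show inner ℝ (S k) l = inner ℝ k (S l)
    rw [real_inner_comm (S l) k, hS, hS, hsym]
  obtain ⟨ι, b, μ, hb⟩ := exists_hilbertBasis_eigenvectors
    (isCompactOperator_of_norm_le_embB hκ (by positivity) hSn) hsymm
  obtain ⟨K, hK⟩ := exists_sum_abs_eigenvalues_le hκ hC hSle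
  have hsum : Summable fun i => |μ i| :=
    summable_of_sum_le (c := K) (fun i => abs_nonneg _) fun u => by
      rw [← Finset.sum_coe_sort u fun i => |μ i|]
      exact hK u (fun i => b i) (fun i => μ i) (b.orthonormal.comp _ Subtype.val_injective)
        fun i => hb i
  exact ⟨S, hS, isTraceClass_of_hilbertBasis b hb hsum⟩

lemma exists_bilin_bound {X : Type*} [NormedAddCommGroup X] [NormedSpace ℝ X]
    (B : X →L[ℝ] X →L[ℝ] ℝ) (D : CM →L[ℝ] X) {C : ℝ} (hC : 0 ≤ C)
    (hD : ∀ k, ‖D k‖ ≤ C * ‖embB hκ k‖) :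
    ∃ q : CM →L[ℝ] CM →L[ℝ] ℝ, (∀ k l, q k l = B (D k) (D l)) ∧
      ∃ K, 0 ≤ K ∧ ∀ k l, |q k l| ≤ K * ‖embB hκ k‖ * ‖embB hκ l‖ := by
  refine ⟨B.bilinearComp D D, fun k l => rfl, ‖B‖ * C ^ 2, by positivity, fun k l => ?_⟩
  refine (B.le_opNorm₂ (D k) (D l)).trans ?_
  calc ‖B‖ * ‖D k‖ * ‖D l‖ ≤ ‖B‖ * (C * ‖embB hκ k‖) * (C * ‖embB hκ l‖) := by
        gcongr
        · exact hD k
        · exact hD l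
    _ = _ := by ring

lemma bilin_ext_of_embB {E : Type*} [NormedAddCommGroup E] [NormedSpace ℝ E]
    {Q R : Besov (-1 - κ) →L[ℝ] E} (h : ∀ k, Q (embB hκ k) = R (embB hκ k)) : Q = R :=
  ContinuousLinearMap.coeFn_injective <| (denseRange_embB hκ).equalizer Q.continuous R.continuous
    (funext h)

/-- Extension by density in one variable after the other, each step keeping the constant `C`. -/
lemma exists_extension (q : CM →L[ℝ] CM →L[ℝ] ℝ) {C : ℝ} (hC : 0 ≤ C)
    (hq : ∀ k l, |q k l| ≤ C * ‖embB hκ k‖ * ‖embB hκ l‖) :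
    ∃ Q : Besov (-1 - κ) →L[ℝ] Besov (-1 - κ) →L[ℝ] ℝ, ‖Q‖ ≤ C ∧
      ∀ k l, Q (embB hκ k) (embB hκ l) = q k l := by
  have hd := denseRange_embB hκ
  let f : CM → Besov (-1 - κ) →L[ℝ] ℝ := fun k => (q k : CM →ₗ[ℝ] ℝ).extendOfNorm (embB hκ)
  have hf : ∀ k l, f k (embB hκ l) = q k l := fun k l =>
    LinearMap.extendOfNorm_eq hd ⟨C * ‖embB hκ k‖, fun l => hq k l⟩ l
  have hfn : ∀ k, ‖f k‖ ≤ C * ‖embB hκ k‖ := fun k =>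
    LinearMap.opNorm_extendOfNorm_le hd (by positivity) fun l => hq k l
  let fL : CM →ₗ[ℝ] Besov (-1 - κ) →L[ℝ] ℝ :=
    { toFun := f
      map_add' := fun k l => bilin_ext_of_embB hκ fun m => by
        rw [add_apply, hf, hf, hf, map_add, add_apply]
      map_smul' := fun r k => bilin_ext_of_embB hκ fun m => by
        rw [RingHom.id_apply, smul_apply, hf, hf, map_smul, smul_apply] }
  refine ⟨fL.extendOfNorm (embB hκ), LinearMap.opNorm_extendOfNorm_le hd hC hfn, fun k l => ?_⟩
  rw [LinearMap.extendOfNorm_eq hd ⟨C, hfn⟩]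
  exact hf k l

lemma extension_unique {q : CM → CM → ℝ} {Q R : Besov (-1 - κ) →L[ℝ] Besov (-1 - κ) →L[ℝ] ℝ}
    (hQ : ∀ k l, Q (embB hκ k) (embB hκ l) = q k l)
    (hR : ∀ k l, R (embB hκ k) (embB hκ l) = q k l) : Q = R :=
  bilin_ext_of_embB hκ fun k => bilin_ext_of_embB hκ fun l => by rw [hQ, hR]

/-- Any admissible constant bounds the norm of the extension built from it, and by uniqueness that
extension is `Q`. -/
lemma isLeast_norm_extension (q : CM →L[ℝ] CM →L[ℝ] ℝ)
    {Q : Besov (-1 - κ) →L[ℝ] Besov (-1 - κ) →L[ℝ] ℝ}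
    (hQ : ∀ k l, Q (embB hκ k) (embB hκ l) = q k l) :
    IsLeast {C : ℝ | 0 ≤ C ∧ ∀ k l, |q k l| ≤ C * ‖embB hκ k‖ * ‖embB hκ l‖} ‖Q‖ := by
  refine ⟨⟨norm_nonneg Q, fun k l => ?_⟩, fun C hC => ?_⟩
  · rw [← hQ]
    exact Q.le_opNorm₂ _ _
  · obtain ⟨R, hR, hRq⟩ := exists_extension hκ q hC.1 hC.2
    rwa [extension_unique hκ hQ hRq]

end

end GPAM

/-! ### Assembly of the theorem -/

theorem mainTheorem4
    (κ : ℝ) (hκ : 0 < κ) (hκ' : κ < 1 / 2)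
    (T : ℝ) (hT : 0 < T)
    (g : ℝ → ℝ) (hg : ContDiff ℝ 7 g)
    (hgb : ∀ m ≤ 7, ∃ C, ∀ x, |iteratedDeriv m g x| ≤ C)
    (hg0 : ∀ m ≤ 2, iteratedDeriv m g 0 = 0)
    (u₀ : C(GPAM.Torus, ℝ)) (hu₀ : GPAM.IsHolder (1 + 2 * κ) u₀)
    (F : GPAM.PathSpace κ T → ℝ)
    -- `F` is bounded and continuous
    (hF : Continuous F) (hFb : ∃ C, ∀ y, |F y| ≤ C)
    -- `h` is the unique minimiser of `F(w_h) + ‖h‖² / 2`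
    (h : GPAM.CM)
    (hmin : ∀ k, k ≠ h → GPAM.phaseFunctional g u₀ F h < GPAM.phaseFunctional g u₀ F k)
    -- `F` is three times differentiable near `w_h`, with bounded derivatives
    (U : Set (GPAM.PathSpace κ T)) (hU : IsOpen U) (hhU : GPAM.sol g u₀ h ∈ U)
    (hFdiff : ∀ m < 3, DifferentiableOn ℝ (iteratedFDeriv ℝ m F) U)
    (M : ℕ → ℝ)
    (hFM : ∀ m, 1 ≤ m → m ≤ 3 → ∀ v ∈ U, ∀ y,
      |iteratedFDeriv ℝ m F v (fun _ => y)| ≤ M m * ‖y‖ ^ m)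
    -- the minimiser is non-degenerate
    (hnd : ∀ k : GPAM.CM, k ≠ 0 →
      0 < iteratedFDeriv ℝ 2 (GPAM.phaseFunctional g u₀ F) h ![k, k]) :
    -- all the objects are well-defined
    (∀ k, ∃! w : GPAM.PathSpace κ T, GPAM.IsSolution g u₀ k w) ∧
    ContDiffAt ℝ 2 (GPAM.sol g u₀ : GPAM.CM → GPAM.PathSpace κ T) h ∧
    (∀ k l, ∃! v : GPAM.PathSpace κ T, GPAM.IsRegularPart g u₀ h k l v) ∧
    (∀ k l, ∃! v : GPAM.PathSpace κ T, GPAM.IsSingularPart g u₀ h k l v) ∧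
    -- the formula for `q_h = A_h - Ã_h`
    (∀ k l, GPAM.formQ g u₀ F h k l =
      fderiv ℝ F (GPAM.sol g u₀ h) (GPAM.regularPart g u₀ h k l) +
        iteratedFDeriv ℝ 2 F (GPAM.sol g u₀ h)
          ![GPAM.der1 g u₀ h k, GPAM.der1 g u₀ h l]) ∧
    -- `q_h` is trace class on `L²`
    GPAM.IsTraceClassForm (GPAM.formQ g u₀ F h) ∧
    -- `q_h` has a unique continuous bilinear extension to `B × B`, with the same norm
    (∃! Q : GPAM.Besov (-1 - κ) →L[ℝ] GPAM.Besov (-1 - κ) →L[ℝ] ℝ,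
      ∀ k l, Q (GPAM.embB hκ k) (GPAM.embB hκ l) = GPAM.formQ g u₀ F h k l) ∧
    (∀ Q : GPAM.Besov (-1 - κ) →L[ℝ] GPAM.Besov (-1 - κ) →L[ℝ] ℝ,
      (∀ k l, Q (GPAM.embB hκ k) (GPAM.embB hκ l) = GPAM.formQ g u₀ F h k l) →
      IsLeast {C : ℝ | 0 ≤ C ∧ ∀ k l,
        |GPAM.formQ g u₀ F h k l| ≤ C * ‖GPAM.embB hκ k‖ * ‖GPAM.embB hκ l‖} ‖Q‖) := by
  have hκ1 : κ < 1 := by linarith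
  have hg1 : Continuous (deriv g) := hg.continuous_deriv (by norm_num)
  have hg2 : Continuous (iteratedDeriv 2 g) := hg.continuous_iteratedDeriv 2 (by norm_num)
  obtain ⟨B, hBsymm, hB⟩ := GPAM.exists_formQ_eq_bilin hκ hκ1 hT.le hg hgb hu₀
    (GPAM.contDiffAt_two_of_differentiableOn hU hFdiff hhU)
  obtain ⟨C, hC, hder⟩ := GPAM.exists_norm_der1_le (T := T) hκ hκ1 hT.le hg hgb hu₀ hκ' h
  -- Composing `B` with the derivative of the solution map represents `formQ` as a continuous
  -- bilinear form on `L²` that is bounded in the norm of `B`; the last three claims need only this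
  -- and symmetry.
  obtain ⟨q, hqB, K, hK, hqle⟩ := GPAM.exists_bilin_bound hκ B (fderiv ℝ (GPAM.sol g u₀) h) hC hder
  have hq : GPAM.formQ g u₀ F h = fun k l => q k l :=
    funext fun k => funext fun l => (hB k l).trans (hqB k l).symm
  refine ⟨fun k => GPAM.existsUnique_isSolution hκ hκ1 hT.le hg hgb hu₀ k,
    (GPAM.contDiff_sol hκ hκ1 hT.le hg hgb hu₀).contDiffAt,
    fun k l => GPAM.existsUnique_isRegularPart hκ hκ1 hT.le hg1 hg2 h k l,
    fun k l => GPAM.existsUnique_isSingularPart hκ hκ1 hT.le hg1 h k l,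
    fun k l => GPAM.formQ_eq hκ hκ1 hT.le hg hgb hu₀ F h k l, ?_, ?_, ?_⟩
  · rw [hq]
    exact GPAM.isTraceClassForm_of_abs_le hκ q (fun k l => by
      rw [hqB, hqB]
      exact hBsymm _ _) hK hqle
  · obtain ⟨Q, -, hQ⟩ := GPAM.exists_extension hκ q hK hqle
    rw [hq]
    exact ⟨Q, hQ, fun R hR => GPAM.extension_unique hκ hR hQ⟩
  · rw [hq]
    exact fun Q hQ => GPAM.isLeast_norm_extension hκ q hQ
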